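/- **Setting.** Let $d,K\ge 1$. In each round $t=1,\dots,T$ a context $\mathcal A_t=(x_{t,a})_{a\in[K]}\in(\mathbb R^d)^K$ is drawn i.i.d. from a law under which $\|x_{t,a}\|\le 1$ for all $a$; the player pulls an arm $a_t\in[K]$ and observes only $Y_t=y_{t,a_t}$; write $X_t=x_{t,a_t}$. Each context is independent of everything that precedes it (earlier contexts, arms, rewards, and all random draws of the algorithm made so far). Rewards satisfy $y_{t,a}\in[0,1]$, and, conditionally on the past, the current context and the pulled arm, $y_{t,a}$ has mean $\mu(x_{t,a}^T\theta^*)$ and the noise $\epsilon_t=Y_t-\mu(X_t^T\theta^*)$ is sub-Gaussian with parameter $R>0$, i.e. $\mathbb E[e^{\lambda\epsilon_t}\mid\cdot]\le e^{\lambda^2R^2/2}$ for all $\lambda\in\mathbb R$. Here $\theta^*\in\mathbb R^d$ is unknown and $\mu:\mathbb R\to[0,1]$ is strictly increasing. The regret is $R(T)=\sum_{t=1}^T[\max_a\mu(x_{t,a}^T\theta^*)-\mu(X_t^T\theta^*)]$. **Assumptions.** (i) $\mu$ is differentiable and $|\mu'|\le L_\mu$ for a constant $L_\mu>0$. (ii)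 $c_3>0$, where $c_\eta=\inf\{\mu'(x^T\theta):\|x\|\le1,\ \|\theta-\theta^*\|\le\eta\}$. (iii) $\lambda_{\min}\big(\mathbb E[\frac1K\sum_a x_{t,a}x_{t,a}^T]\big)\ge\sigma_0^2$ for a constant $\sigma_0>0$. (iv) $\lambda_f:=\inf_{\theta\in\mathbb R^d}\lambda_{\min}(\mathbb E[\tilde X_\theta\tilde X_\theta^T])>0$, where $\tilde X_\theta$ is the feature vector $x_{t,a}$ with $a\in\operatorname{argmax}_a\theta^Tx_{t,a}$ (ties broken by any fixed measurable rule). **Parameters.** For constants $C_1,C_2$ put $\alpha=\max\{c_3,d,\log T\}/\lambda_f$, $\tau=\lceil\max\{\tau_1,\tau_2\}\rceil$ with $$\tau_1=\Big(\tfrac{C_1\sqrt d+C_2\sqrt{2\log T}}{\sigma_0^2}\Big)^2+\tfrac{32R^2[d+2\log T]}{c_1^2\sigma_0^2},\qquad \tau_2=\Big(\tfrac{C_1\sqrt d+C_2\sqrt{3\log T}}{\lambda_f}\Big)^2+\tfrac{2\alpha}{c_3\lambda_f},$$ and $g_1(j)=\frac{R}{c_1}\sqrt{\frac d2\log(1+\frac{2j\tau}{d})+2\log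 T}$, $g_2(j)=\frac\tau\alpha\sqrt{1+\log j}$. **Algorithm (SGD-TS).** In rounds $1,\dots,\tau$ pull arms uniformly at random, independently of everything else so far. Compute from these rounds an estimate $\hat\theta_\tau$ that solves $\sum_{t=1}^\tau(Y_t-\mu(X_t^T\theta))X_t=0$ whenever a solution exists (and is arbitrary otherwise). Let $\mathcal C$ be the closed ball of radius $2$ around $\hat\theta_\tau$ and $\tilde\theta_0=\hat\theta_\tau$. At the beginning of round $j\tau+1$, $j\ge1$, set $\tilde\theta_j=\Pi_{\mathcal C}\big(\tilde\theta_{j-1}-\frac1{\alpha j}\sum_{s=(j-1)\tau+1}^{j\tau}(\mu(X_s^T\tilde\theta_{j-1})-Y_s)X_s\big)$, with $\Pi_{\mathcal C}$ the metric projection, $\bar\theta_j=\frac1j\sum_{q=1}^j\tilde\theta_q$, and draw, given the past, $\theta^{\rm TS}_j\sim\mathcal N\big(\bar\theta_j,(\frac{2c_3g_1(j)^2}{\alpha j}+\frac{2g_2(j)^2}{j})I_d\big)$. In each round $t>\tau$ pull an arm $a_t$ maximizing $\mu(x_{t,a}^T\theta^{\rm TS}_j)$, where $j=\lfloor(t-1)/\tau\rfloor$.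 **Theorem.** There are universal constants $C_1,C_2>0$ such that for every such bandit: 1. for every $T$ with $\tau\le T$, SGD-TS run with the above $\alpha$ and $\tau$ satisfies $$\mathbb E[R(T)]\le\tau+\frac7T+L_\mu p\sqrt{\tau T}\Big[2\sqrt{\tfrac{c_3}{\alpha}}\,g_1(J)+2g_2(J)\Big]+L_\mu p\sqrt{\tau T}\,u\sqrt{\tfrac{2c_3g_1(J)^2}{\alpha}+2g_2(J)^2}\,\sqrt{1+\log J},$$ where $J=\lfloor T/\tau\rfloor$, $u=\sqrt{2\log(K\tau T^2)}$ and $p=1+\dfrac{2}{\frac1{4\sqrt{\pi e}}-\frac1{T^2}}$; 2. in particular $\mathbb E[R(T)]=\tilde O(\sqrt T)$: there are $A\in\mathbb R$ and $k\in\mathbb N$, depending only on $d,K,R,L_\mu,\sigma_0,c_1,c_3,\lambda_f$, such that SGD-TS run with the above $\alpha$ and $\tau$ satisfies $\mathbb E[R(T)]\le A\sqrt T(\log T)^k$ for all $T\ge2$. -/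

import Mathlib

open MeasureTheory ProbabilityTheory

noncomputable section

/-- The feature space `ℝ^d` with its Euclidean norm. -/
abbrev Feat (d : ℕ) : Type := EuclideanSpace ℝ (Fin d)

/-- The smallest eigenvalue of a (symmetric) real matrix. -/
def lambdaMin {d : ℕ} (M : Matrix (Fin d) (Fin d) ℝ) : ℝ := sInf (spectrum ℝ M)

/-- The rank-one matrix `x xᵀ`. -/
def outer {d : ℕ} (x : Feat d) : Matrix (Fin d) (Fin d) ℝ :=
  Matrix.of fun i k => x i * x k

/-- Entrywise expectation of a random matrix. -/
def matExp {S : Type*} [MeasurableSpace S] {d : ℕ} (ν : Measure S)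
    (M : S → Matrix (Fin d) (Fin d) ℝ) : Matrix (Fin d) (Fin d) ℝ :=
  Matrix.of fun i k => ∫ s, M s i k ∂ν

/-- `c_η = inf { μ'(xᵀθ) : ‖x‖ ≤ 1, ‖θ - θ*‖ ≤ η }`. -/
def cEta {d : ℕ} (μ : ℝ → ℝ) (θstar : Feat d) (η : ℝ) : ℝ :=
  sInf {r : ℝ | ∃ x θ : Feat d, ‖x‖ ≤ 1 ∧ ‖θ - θstar‖ ≤ η ∧ r = deriv μ (inner ℝ x θ)}

/-- `λ_f = inf_θ λ_min(E[X̃_θ X̃_θᵀ])`, where `X̃_θ = x (best θ x)` is the feature vector of the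
optimal arm for the parameter `θ` in the context `x = (x_a)_a`. -/
def lambdaF {d K : ℕ} (ν : Measure (Fin K → Feat d))
    (best : Feat d → (Fin K → Feat d) → Fin K) : ℝ :=
  ⨅ θ : Feat d, lambdaMin (matExp ν fun x => outer (x (best θ x)))

/-- A `K`-armed stochastic generalized linear bandit with `d`-dimensional features, together with
the standing assumptions. -/
structure GLBandit (d K : ℕ) where
  /-- the link function -/
  μ : ℝ → ℝ
  /-- the true parameter -/
  θstar : Feat d
  /-- the law of the context `(x_{t,a})_{a ∈ [K]}` of one round -/
  ν : Measure (Fin K → Feat d)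
  /-- the sub-Gaussian parameter of the noise -/
  R : ℝ
  /-- the bound on `|μ'|` -/
  L : ℝ
  /-- the constant of the regularity condition -/
  σ₀ : ℝ
  /-- the tie-breaking convention that makes `argmax_a θᵀ x_a` a single arm in the definition
  of `λ_f`; any convention is allowed -/
  best : Feat d → (Fin K → Feat d) → Fin K
  prob : IsProbabilityMeasure ν
  norm_le : ∀ᵐ x ∂ν, ∀ a, ‖x a‖ ≤ 1
  strictMono : StrictMono μ
  μ_mem : ∀ z, μ z ∈ Set.Icc (0 : ℝ) 1
  differentiable : Differentiable ℝ μ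
  L_pos : 0 < L
  deriv_le : ∀ z, |deriv μ z| ≤ L
  R_pos : 0 < R
  c₃_pos : 0 < cEta μ θstar 3
  σ₀_pos : 0 < σ₀
  regular : σ₀ ^ 2 ≤ lambdaMin (matExp ν fun x => (K : ℝ)⁻¹ • ∑ a, outer (x a))
  best_measurable : ∀ θ, Measurable (best θ)
  best_max : ∀ (θ : Feat d) (x : Fin K → Feat d) (a : Fin K), inner ℝ θ (x a) ≤ inner ℝ θ (x (best θ x))
  lambdaF_pos : 0 < lambdaF ν best

/-- The numerical parameters of a bandit that enter the algorithm and the regret bound. -/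
structure GLBParams where
  d : ℕ
  K : ℕ
  R : ℝ
  L : ℝ
  σ₀ : ℝ
  c₁ : ℝ
  c₃ : ℝ
  lamF : ℝ

def GLBandit.params {d K : ℕ} (B : GLBandit d K) : GLBParams where
  d := d
  K := K
  R := B.R
  L := B.L
  σ₀ := B.σ₀
  c₁ := cEta B.μ B.θstar 1
  c₃ := cEta B.μ B.θstar 3
  lamF := lambdaF B.ν B.best

namespace GLBParams

/-- `α = max{c₃, d, log T} / λ_f`. -/
def alpha (q : GLBParams) (T : ℕ) : ℝ :=
  max (max q.c₃ (q.d : ℝ)) (Real.log T) / q.lamF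

def tau₁ (q : GLBParams) (C₁ C₂ : ℝ) (T : ℕ) : ℝ :=
  ((C₁ * √(q.d : ℝ) + C₂ * √(2 * Real.log T)) / q.σ₀ ^ 2) ^ 2
    + 32 * q.R ^ 2 * ((q.d : ℝ) + 2 * Real.log T) / (q.c₁ ^ 2 * q.σ₀ ^ 2)

def tau₂ (q : GLBParams) (C₁ C₂ : ℝ) (T : ℕ) (α : ℝ) : ℝ :=
  ((C₁ * √(q.d : ℝ) + C₂ * √(3 * Real.log T)) / q.lamF) ^ 2 + 2 * α / (q.c₃ * q.lamF)

/-- The block length `τ = ⌈max{τ₁, τ₂}⌉`, for `α = max{c₃, d, log T} / λ_f`. -/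
def tau (q : GLBParams) (C₁ C₂ : ℝ) (T : ℕ) : ℕ :=
  ⌈max (q.tau₁ C₁ C₂ T) (q.tau₂ C₁ C₂ T (q.alpha T))⌉₊

def g₁ (q : GLBParams) (T τ j : ℕ) : ℝ :=
  q.R / q.c₁ * √((q.d : ℝ) / 2 * Real.log (1 + 2 * (j : ℝ) * (τ : ℝ) / (q.d : ℝ))
    + 2 * Real.log T)

def g₂ (τ : ℕ) (α : ℝ) (j : ℕ) : ℝ := (τ : ℝ) / α * √(1 + Real.log j)

/-- The scalar `2 c₃ g₁(j)² / (α j) + 2 g₂(j)² / j`; the covariance matrix of the `j`-th draw is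
this scalar times the identity. -/
def tsVar (q : GLBParams) (T τ : ℕ) (α : ℝ) (j : ℕ) : ℝ :=
  2 * q.c₃ * q.g₁ T τ j ^ 2 / (α * j) + 2 * g₂ τ α j ^ 2 / j

/-- The regret bound, as a function of `T`, `τ` and `α`. -/
def regretBound (q : GLBParams) (T τ : ℕ) (α : ℝ) : ℝ :=
  let J : ℕ := T / τ
  let u : ℝ := √(2 * Real.log ((q.K : ℝ) * τ * (T : ℝ) ^ 2))
  let p : ℝ := 1 + 2 / (1 / (4 * √(Real.pi * Real.exp 1)) - 1 / (T : ℝ) ^ 2)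
  (τ : ℝ) + 7 / (T : ℝ)
    + q.L * p * √((τ : ℝ) * T) * (2 * √(q.c₃ / α) * q.g₁ T τ J + 2 * g₂ τ α J)
    + q.L * p * √((τ : ℝ) * T) * u
        * √(2 * q.c₃ * q.g₁ T τ J ^ 2 / α + 2 * g₂ τ α J ^ 2) * √(1 + Real.log (J : ℝ))

end GLBParams

/-- Metric projection onto the closed ball with centre `c` and radius `r`
(see `norm_sub_projBall_le`). -/
def projBall {d : ℕ} (c : Feat d) (r : ℝ) (x : Feat d) : Feat d :=
  if ‖x - c‖ ≤ r then x else c + (r / ‖x - c‖) • (x - c)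

/-- `projBall c r x` lies in the ball. -/
theorem projBall_mem {d : ℕ} (c : Feat d) {r : ℝ} (hr : 0 ≤ r) (x : Feat d) :
    ‖projBall c r x - c‖ ≤ r := by
  unfold projBall
  split_ifs with h
  · exact h
  · have hx : 0 < ‖x - c‖ := lt_of_le_of_lt hr (not_le.mp h)
    rw [add_sub_cancel_left, norm_smul, Real.norm_of_nonneg (by positivity),
      div_mul_cancel₀ _ hx.ne']

/-- `projBall c r x` is a nearest point of the ball to `x`. -/
theorem norm_sub_projBall_le {d : ℕ} (c : Feat d) {r : ℝ} (hr : 0 ≤ r) (x y : Feat d)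
    (hy : ‖y - c‖ ≤ r) : ‖x - projBall c r x‖ ≤ ‖x - y‖ := by
  unfold projBall
  split_ifs with h
  · simp
  · have hlt := not_le.mp h
    have hx : 0 < ‖x - c‖ := lt_of_le_of_lt hr hlt
    have h1 : x - (c + (r / ‖x - c‖) • (x - c)) = (1 - r / ‖x - c‖) • (x - c) := by
      rw [sub_smul, one_smul]; abel
    have h2 : 0 ≤ 1 - r / ‖x - c‖ := by
      rw [sub_nonneg, div_le_one hx]; exact hlt.le
    have h3 : ‖x - c‖ ≤ ‖x - y‖ + ‖y - c‖ := norm_sub_le_norm_sub_add_norm_sub x y c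
    rw [h1, norm_smul, Real.norm_of_nonneg h2, sub_mul, one_mul, div_mul_cancel₀ _ hx.ne']
    linarith

/-- The random quantities of a play: contexts, pulled arms, rewards of all arms, the maximum
likelihood estimate after the first block, and the Gaussian vectors behind the Thompson draws.
Rounds and draws are numbered from `1`. -/
structure Play (d K : ℕ) (Ω : Type*) where
  ctx : ℕ → Ω → Fin K → Feat d
  arm : ℕ → Ω → Fin K
  rew : ℕ → Fin K → Ω → ℝ
  mle : Ω → Feat d
  Z : ℕ → Ω → Feat d

namespace Play

variable {d K : ℕ} {Ω : Type*}

/-- `X_t`, the feature vector of the pulled arm. -/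
def X (W : Play d K Ω) (t : ℕ) (ω : Ω) : Feat d := W.ctx t ω (W.arm t ω)

/-- `Y_t`, the observed reward. -/
def Y (W : Play d K Ω) (t : ℕ) (ω : Ω) : ℝ := W.rew t (W.arm t ω) ω

/-- The gradient of the `j`-th aggregated loss,
`∇l_{j,τ}(θ) = ∑_{s=(j-1)τ+1}^{jτ} (-Y_s X_s + μ(X_sᵀθ) X_s)`. -/
def gradLoss (W : Play d K Ω) (μ : ℝ → ℝ) (τ j : ℕ) (ω : Ω) (θ : Feat d) : Feat d :=
  ∑ s ∈ Finset.Icc ((j - 1) * τ + 1) (j * τ),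
    (-(W.Y s ω • W.X s ω) + μ (inner ℝ (W.X s ω) θ) • W.X s ω)

/-- The projected SGD iterates: `θ̃_0 = θ̂_τ` and, for `j ≥ 1`,
`θ̃_j = Π_C(θ̃_{j-1} - (α j)⁻¹ ∇l_{j,τ}(θ̃_{j-1}))`, `C` the ball of radius `2` around `θ̂_τ`. -/
def sgd (W : Play d K Ω) (μ : ℝ → ℝ) (τ : ℕ) (α : ℝ) : ℕ → Ω → Feat d
  | 0, ω => W.mle ω
  | j + 1, ω => projBall (W.mle ω) 2
      (W.sgd μ τ α j ω
        - (1 / (α * ((j + 1 : ℕ) : ℝ))) • W.gradLoss μ τ (j + 1) ω (W.sgd μ τ α j ω))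

/-- `θ̄_j = j⁻¹ ∑_{q=1}^j θ̃_q`. -/
def sgdAvg (W : Play d K Ω) (μ : ℝ → ℝ) (τ : ℕ) (α : ℝ) (j : ℕ) (ω : Ω) : Feat d :=
  (1 / (j : ℝ)) • ∑ q ∈ Finset.Icc 1 j, W.sgd μ τ α q ω

/-- The Thompson sample `θ^TS_j = θ̄_j + √v_j Z_j`, `v_j I_d` the covariance matrix; it is a
draw from `N(θ̄_j, v_j I_d)` when `Z_j` is standard Gaussian and independent of the past. -/
def thetaTS (W : Play d K Ω) (B : GLBandit d K) (T τ : ℕ) (α : ℝ) (j : ℕ) (ω : Ω) : Feat d :=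
  W.sgdAvg B.μ τ α j ω + √(B.params.tsVar T τ α j) • W.Z j ω

/-- `F_t`, the σ-algebra of the contexts, pulled arms and observed rewards of rounds `1, …, t`. -/
@[reducible] def hist (W : Play d K Ω) (t : ℕ) : MeasurableSpace Ω :=
  ⨆ s ∈ Finset.Icc 1 t,
    (MeasurableSpace.comap (W.ctx s) inferInstance ⊔ MeasurableSpace.comap (W.arm s) inferInstance
      ⊔ MeasurableSpace.comap (W.Y s) inferInstance)

/-- The σ-algebra of the Gaussian draws made before round `t` is played, or at its beginning:
draw `i ≥ 1` is made at the beginning of round `i τ + 1`. -/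
@[reducible] def draws (W : Play d K Ω) (τ t : ℕ) : MeasurableSpace Ω :=
  ⨆ i ∈ {i : ℕ | 1 ≤ i ∧ i * τ < t}, MeasurableSpace.comap (W.Z i) inferInstance

/-- Everything that has happened before the context of round `t` is revealed. -/
@[reducible] def pre (W : Play d K Ω) (τ t : ℕ) : MeasurableSpace Ω := W.hist (t - 1) ⊔ W.draws τ t

/-- The above and the context of round `t`. -/
@[reducible] def preArm (W : Play d K Ω) (τ t : ℕ) : MeasurableSpace Ω :=
  W.pre τ t ⊔ MeasurableSpace.comap (W.ctx t) inferInstance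

/-- The above and the arm pulled at round `t`. -/
@[reducible] def preReward (W : Play d K Ω) (τ t : ℕ) : MeasurableSpace Ω :=
  W.preArm τ t ⊔ MeasurableSpace.comap (W.arm t) inferInstance

/-- The cumulative regret `∑_{t=1}^T [max_a μ(x_{t,a}ᵀθ*) - μ(X_tᵀθ*)]`. -/
def regret (W : Play d K Ω) (B : GLBandit d K) (T : ℕ) (ω : Ω) : ℝ :=
  ∑ t ∈ Finset.Icc 1 T,
    ((⨆ a : Fin K, B.μ (inner ℝ (W.ctx t ω a) B.θstar))
      - B.μ (inner ℝ (W.X t ω) B.θstar))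

/-- `W` is a play of horizon `T` of the bandit `B` by the algorithm SGD-TS with block length `τ`
and parameter `α`. -/
structure IsSGDTS [MeasurableSpace Ω] (W : Play d K Ω) (B : GLBandit d K) (T τ : ℕ) (α : ℝ)
    (P : Measure Ω) : Prop where
  ctx_measurable : ∀ t, Measurable (W.ctx t)
  arm_measurable : ∀ t, Measurable (W.arm t)
  rew_measurable : ∀ t a, Measurable (W.rew t a)
  Z_measurable : ∀ j, Measurable (W.Z j)
  /-- the contexts are i.i.d. with law `ν`: each is independent of all that precedes it -/
  ctx_law : ∀ t, 1 ≤ t → t ≤ T → P.map (W.ctx t) = B.ν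
  ctx_indep : ∀ t, 1 ≤ t → t ≤ T →
    Indep (MeasurableSpace.comap (W.ctx t) inferInstance) (W.pre τ t) P
  /-- rewards lie in `[0, 1]` and have the mean prescribed by the generalized linear model -/
  rew_mem : ∀ t, 1 ≤ t → t ≤ T → ∀ a ω, W.rew t a ω ∈ Set.Icc (0 : ℝ) 1
  rew_mean : ∀ t, 1 ≤ t → t ≤ T → ∀ a,
    P[W.rew t a | W.preReward τ t] =ᵐ[P] fun ω => B.μ (inner ℝ (W.ctx t ω a) B.θstar)
  /-- the noise `ε_t = Y_t - μ(X_tᵀθ*)` is conditionally sub-Gaussian with parameter `R` -/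
  noise_subG : ∀ t, 1 ≤ t → t ≤ T → ∀ l : ℝ,
    P[fun ω => Real.exp (l * (W.Y t ω - B.μ (inner ℝ (W.X t ω) B.θstar))) | W.preReward τ t]
      ≤ᵐ[P] fun _ => Real.exp (l ^ 2 * B.R ^ 2 / 2)
  /-- in the first `τ` rounds the arm is chosen uniformly at random -/
  arm_uniform : ∀ t, 1 ≤ t → t ≤ T → t ≤ τ → ∀ a, P.real (W.arm t ⁻¹' {a}) = 1 / (K : ℝ)
  arm_indep : ∀ t, 1 ≤ t → t ≤ T → t ≤ τ →
    Indep (MeasurableSpace.comap (W.arm t) inferInstance) (W.preArm τ t) P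
  /-- `θ̂_τ` is computed from the first `τ` observations, and it solves the likelihood equation
  whenever that equation has a solution -/
  mle_measurable : τ ≤ T → Measurable[W.hist τ] W.mle
  mle_solves : τ ≤ T → ∀ ω,
    (∃ θ : Feat d, ∑ t ∈ Finset.Icc 1 τ,
      (W.Y t ω - B.μ (inner ℝ (W.X t ω) θ)) • W.X t ω = 0) →
    ∑ t ∈ Finset.Icc 1 τ,
      (W.Y t ω - B.μ (inner ℝ (W.X t ω) (W.mle ω))) • W.X t ω = 0
  /-- the `j`-th Gaussian draw is standard and independent of all that precedes it -/
  Z_law : ∀ j, 1 ≤ j → j * τ < T → P.map (W.Z j) = stdGaussian (Feat d)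
  Z_indep : ∀ j, 1 ≤ j → j * τ < T →
    Indep (MeasurableSpace.comap (W.Z j) inferInstance) (W.hist (j * τ) ⊔ W.draws τ (j * τ)) P
  /-- after the first `τ` rounds the arm maximizes `μ(x_{t,a}ᵀ θ^TS_j)`, `j = ⌊(t - 1)/τ⌋` -/
  arm_max : ∀ t, τ < t → t ≤ T → ∀ ω a,
    B.μ (inner ℝ (W.ctx t ω a) (W.thetaTS B T τ α ((t - 1) / τ) ω))
      ≤ B.μ (inner ℝ (W.X t ω) (W.thetaTS B T τ α ((t - 1) / τ) ω))

end Play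

end

noncomputable section

open scoped ENNReal

/-! ### Nets of the Euclidean unit ball -/

/-! The regret is bounded round by round on an event of large probability; neither optimism nor
anti-concentration of the Thompson draw is used. Suppose the averaged iterate is within `e` of
`θstar` and every feature of the round has inner product at most `u` in absolute value with the
Gaussian vector. Since the pulled arm is best for the Thompson sample, its score under `θstar` is at
most `2 (e + u √v)` below that of the best arm, `v` being the variance of the draw, and the
Lipschitz bound on `μ` finishes (`instRegret_le`). The factor `p` of the stated bound is at least
`2`, which absorbs the lost constant; the separate `g₁` term is slack, and `g₁` matters only through
`v`.

The substance is therefore that the average of the first `j` iterates is within `g₂(j) / √j` of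
`θstar`, simultaneously for all `j`, outside an event of probability `4 / T²`
(`measure_not_goodRun_le`, `GoodRun.norm_sgdAvg_sub_le`). Two facts drive it. First, after the first
block each block has empirical second moments at least `7/8 τ λ_f`: the pulled arm maximizes a
linear score whose parameter has a Gaussian component, so ties between distinct features are null
and the conditional second moment is at least `λ_f`. With `c₃` this makes each block loss strongly
monotone around `θstar`. Second, the squared errors obey a descent recursion with contraction `1 -
7/(2q)`; weighting by `q³` makes it telescope and leaves a negative term that pays for the quadratic
variation of the martingale noise (`descent_recursion`), so the squared error at step `j` is at most
`(τ/α)² / j`.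

The recursion needs a start within distance `1` of `θstar`. In the first block the arms are uniform;
after whitening by the square root of the feature second moment, the noise is dominated by the
curvature in every direction. Then the likelihood equation has a solution, and all its solutions lie
in the unit ball around `θstar`.

All concentration for the run comes from one Chernoff bound for exponential supermartingales
(`measure_lt_sum_le_exp`), made uniform over directions by finite nets. Summing `1/√j` over blocks
gives the explicit bound. For the second claim every parameter is polylogarithmic in `T`; when `T <
τ` the trivial bound `T` is already below a polylogarithm. -/

theorem exists_half_net (d : ℕ) : ∃ N : Finset (Feat d), N.card ≤ 5 ^ d ∧
    (∀ v ∈ N, ‖v‖ ≤ 1) ∧ ∀ w : Feat d, ‖w‖ ≤ 1 → ∃ v ∈ N, ‖w - v‖ ≤ 1 / 2 := by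
  classical
  by_contra! H
  -- If no set of at most `5 ^ d` points is a net, points can be added greedily at mutual distance
  -- at least `1/2` until there are `5 ^ d + 1` of them.
  have key : ∀ n : ℕ, n ≤ 5 ^ d + 1 → ∃ s : Finset (Feat d), s.card = n ∧ (∀ c ∈ s, ‖c‖ ≤ 1) ∧
      ∀ c ∈ s, ∀ c' ∈ s, c ≠ c' → 1 / 2 ≤ ‖c - c'‖ := by
    intro n
    induction n with
    | zero => intro _; exact ⟨∅, by simp⟩
    | succ n ih =>
      intro hn
      obtain ⟨s, hs, h1, h2⟩ := ih (by omega)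
      obtain ⟨w, hw, hws⟩ := H s (by omega) h1
      have hmem : w ∉ s := fun h => by have := hws w h; simp at this; linarith
      refine ⟨insert w s, by rw [Finset.card_insert_of_notMem hmem, hs], ?_, ?_⟩
      · intro c hc
        rcases Finset.mem_insert.mp hc with rfl | hc
        exacts [hw, h1 c hc]
      · intro c hc c' hc' hne
        rcases Finset.mem_insert.mp hc with h | h <;> rcases Finset.mem_insert.mp hc' with h' | h'
        · exact absurd (h.trans h'.symm) hne
        · rw [h]; exact (hws c' h').le
        · rw [h', norm_sub_rev]; exact (hws c h).le
        · exact h2 c h c' h' hne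
  obtain ⟨s, hs, h1, h2⟩ := key _ le_rfl
  have hinj : Function.Injective fun x : Feat d => (2 : ℝ) • x :=
    smul_right_injective _ two_ne_zero
  -- Doubling gives points at mutual distance at least `1` in the ball of radius `2`, the
  -- normalization of the packing bound.
  have := Besicovitch.card_le_of_separated (s.image fun x => (2 : ℝ) • x)
    (by
      intro c hc
      obtain ⟨x, hx, rfl⟩ := Finset.mem_image.mp hc
      rw [norm_smul]; norm_num; exact h1 x hx)
    (by
      intro c hc c' hc' hne
      obtain ⟨x, hx, rfl⟩ := Finset.mem_image.mp hc
      obtain ⟨y, hy, rfl⟩ := Finset.mem_image.mp hc'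
      have hxy : x ≠ y := fun h => hne (by rw [h])
      have := h2 x hx y hy hxy
      rw [← smul_sub, norm_smul]; norm_num; linarith)
  rw [Finset.card_image_of_injective _ hinj, hs, finrank_euclideanSpace_fin] at this
  omega

/-- The residual `w - v`, rescaled by `2 ^ k`, lies in the unit ball again, so one more half net
halves the error at the price of a factor `5 ^ d`. -/
theorem exists_dyadic_net (d k : ℕ) : ∃ N : Finset (Feat d), N.card ≤ 5 ^ (d * k) ∧
    ∀ w : Feat d, ‖w‖ ≤ 1 → ∃ v ∈ N, ‖w - v‖ ≤ (1 / 2) ^ k := by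
  classical
  induction k with
  | zero => exact ⟨{0}, by simp, fun w hw => ⟨0, by simp, by simpa using hw⟩⟩
  | succ k ih =>
    obtain ⟨N, hN, hcov⟩ := ih
    obtain ⟨M, hM, -, hcov'⟩ := exists_half_net d
    refine ⟨Finset.image₂ (fun v m => v + ((1 / 2 : ℝ) ^ k) • m) N M, ?_, fun w hw => ?_⟩
    · calc _ ≤ N.card * M.card := Finset.card_image₂_le _ _ _
        _ ≤ 5 ^ (d * k) * 5 ^ d := Nat.mul_le_mul hN hM
        _ = 5 ^ (d * (k + 1)) := by rw [← pow_add]; ring_nf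
    · obtain ⟨v, hv, hwv⟩ := hcov w hw
      have h2 : ‖((2 : ℝ) ^ k) • (w - v)‖ ≤ 1 := by
        rw [norm_smul, Real.norm_of_nonneg (by positivity)]
        calc (2 : ℝ) ^ k * ‖w - v‖ ≤ 2 ^ k * (1 / 2) ^ k := by gcongr
          _ = 1 := by rw [← mul_pow]; norm_num
      obtain ⟨m, hm, hwm⟩ := hcov' _ h2
      refine ⟨_, Finset.mem_image₂_of_mem hv hm, ?_⟩
      have : w - (v + ((1 / 2 : ℝ) ^ k) • m)
          = ((1 / 2 : ℝ) ^ k) • (((2 : ℝ) ^ k) • (w - v) - m) := by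
        rw [smul_sub, smul_smul, ← mul_pow]; norm_num; abel
      rw [this, norm_smul, Real.norm_of_nonneg (by positivity), pow_succ]
      gcongr

/-- Each useful centre is replaced by a point of the unit ball that it serves, which doubles the
error. Centres must lie in the ball because the exponential moment bounds are available only for
directions of norm at most one. -/
theorem exists_net_in_unit_ball (d k : ℕ) : ∃ N : Finset (Feat d), N.card ≤ 5 ^ (d * k) ∧
    (∀ v ∈ N, ‖v‖ ≤ 1) ∧ ∀ w : Feat d, ‖w‖ ≤ 1 → ∃ v ∈ N, ‖w - v‖ ≤ 2 * (1 / 2) ^ k := by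
  classical
  obtain ⟨N, hN, hcov⟩ := exists_dyadic_net d k
  let f : Feat d → Feat d := fun v =>
    if h : ∃ w : Feat d, ‖w‖ ≤ 1 ∧ ‖w - v‖ ≤ (1 / 2) ^ k then h.choose else 0
  refine ⟨N.image f, Finset.card_image_le.trans hN, fun v hv => ?_, fun w hw => ?_⟩
  · obtain ⟨x, -, rfl⟩ := Finset.mem_image.mp hv
    simp only [f]
    split_ifs with h
    · exact h.choose_spec.1
    · simp
  · obtain ⟨v, hv, hwv⟩ := hcov w hw
    have h : ∃ w : Feat d, ‖w‖ ≤ 1 ∧ ‖w - v‖ ≤ (1 / 2) ^ k := ⟨w, hw, hwv⟩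
    refine ⟨f v, Finset.mem_image_of_mem f hv, ?_⟩
    have h2 : ‖f v - v‖ ≤ (1 / 2) ^ k := by simp only [f, dif_pos h]; exact h.choose_spec.2
    calc ‖w - f v‖ ≤ ‖w - v‖ + ‖v - f v‖ := norm_sub_le_norm_sub_add_norm_sub w v _
      _ ≤ (1 / 2) ^ k + (1 / 2) ^ k := by rw [norm_sub_rev v]; gcongr
      _ = _ := by ring

/-- A net point within `1/2` of the normalized vector already sees half of the norm. -/
theorem norm_le_two_mul_of_half_net {d : ℕ} {N : Finset (Feat d)}
    (hN : ∀ w : Feat d, ‖w‖ ≤ 1 → ∃ v ∈ N, ‖w - v‖ ≤ 1 / 2) {z : Feat d} {b : ℝ} (hb : 0 ≤ b)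
    (h : ∀ v ∈ N, inner ℝ v z ≤ b) : ‖z‖ ≤ 2 * b := by
  rcases eq_or_ne z 0 with rfl | hz
  · simpa using hb
  have hz' : 0 < ‖z‖ := norm_pos_iff.mpr hz
  obtain ⟨v, hv, hd⟩ := hN (‖z‖⁻¹ • z) (by
    rw [norm_smul, norm_inv, norm_norm, inv_mul_cancel₀ hz'.ne'])
  have h1 : inner ℝ (‖z‖⁻¹ • z) z = ‖z‖ := by
    rw [real_inner_smul_left, real_inner_self_eq_norm_sq]; field_simp
  have h2 : inner ℝ (‖z‖⁻¹ • z - v) z ≤ 1 / 2 * ‖z‖ :=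
    (real_inner_le_norm _ _).trans (by gcongr)
  rw [inner_sub_left, h1] at h2
  linarith [h v hv]

/-! ### Smallest eigenvalues and second moments -/

/-- Subtracting a scalar matrix shifts the spectrum; finiteness of the spectrum makes the infimum a
genuine lower bound. -/
theorem posSemidef_sub_lambdaMin {d : ℕ} {M : Matrix (Fin d) (Fin d) ℝ} (hM : M.IsHermitian) :
    (M - lambdaMin M • (1 : Matrix (Fin d) (Fin d) ℝ)).PosSemidef := by
  rw [Matrix.posSemidef_iff_isHermitian_and_spectrum_nonneg]
  refine ⟨hM.sub (Matrix.isHermitian_one.smul (IsSelfAdjoint.all _)), fun r hr => ?_⟩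
  have h : r + lambdaMin M ∈ spectrum ℝ M := by
    rw [← Algebra.algebraMap_eq_smul_one, sub_eq_add_neg, ← map_neg, add_comm,
      ← spectrum.add_mem_add_iff (s := lambdaMin M)] at hr
    simpa [add_comm, ← add_assoc] using hr
  have hb : BddBelow (spectrum ℝ M) := (Matrix.finite_real_spectrum (A := M)).bddBelow
  have := csInf_le hb h
  change 0 ≤ r
  unfold lambdaMin at this
  linarith

theorem lambdaMin_mul_norm_sq_le {d : ℕ} {M : Matrix (Fin d) (Fin d) ℝ} (hM : M.IsHermitian)
    (v : Feat d) : lambdaMin M * ‖v‖ ^ 2 ≤ ∑ i, ∑ k, v i * M i k * v k := by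
  have h := (posSemidef_sub_lambdaMin hM).dotProduct_mulVec_nonneg v.ofLp
  have h1 : star v.ofLp ⬝ᵥ (M - lambdaMin M • (1 : Matrix (Fin d) (Fin d) ℝ)).mulVec v.ofLp
      = (∑ i, ∑ k, v i * M i k * v k) - lambdaMin M * ‖v‖ ^ 2 := by
    rw [Matrix.sub_mulVec, Matrix.smul_mulVec, Matrix.one_mulVec, dotProduct_sub,
      dotProduct_smul, EuclideanSpace.real_norm_sq_eq]
    simp [dotProduct, Matrix.mulVec, Finset.mul_sum, mul_assoc, sq]
  linarith

/-- The empty infimum has default value `0`, which is incompatible with the regularity condition;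
this is how `d ≥ 1` is recovered. -/
theorem lambdaMin_eq_zero_of_isEmpty (M : Matrix (Fin 0) (Fin 0) ℝ) : lambdaMin M = 0 := by
  have : spectrum ℝ M = ∅ := by
    ext r
    simp
  rw [lambdaMin, this, Real.sInf_empty]

theorem inner_eq_sum {d : ℕ} (v x : Feat d) : inner ℝ v x = ∑ i, v i * x i := by
  simp [PiLp.inner_apply, mul_comm]

theorem abs_apply_le_norm {d : ℕ} (x : Feat d) (i : Fin d) : |x i| ≤ ‖x‖ := by
  simpa using PiLp.norm_apply_le x i

theorem sum_matExp_outer {S : Type*} [MeasurableSpace S] {d : ℕ} {ν : Measure S}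
    [IsFiniteMeasure ν] {f : S → Feat d} (hf : Measurable f) (hb : ∀ᵐ s ∂ν, ‖f s‖ ≤ 1)
    (v : Feat d) :
    ∑ i, ∑ k, v i * matExp ν (fun s => outer (f s)) i k * v k = ∫ s, (inner ℝ v (f s)) ^ 2 ∂ν := by
  have h_integrable : ∀ i k : Fin d, Integrable (fun s => v i * (f s i * f s k) * v k) ν := by
    intro i k
    refine (Integrable.const_mul ?_ _).mul_const _
    refine Integrable.of_bound (C := 1) (by fun_prop) ?_
    filter_upwards [hb] with s hs
    rw [norm_mul]
    have h1 := (abs_apply_le_norm (f s) i).trans hs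
    have h2 := (abs_apply_le_norm (f s) k).trans hs
    exact mul_le_one₀ h1 (norm_nonneg _) h2
  have h1 : ∀ s, (inner ℝ v (f s)) ^ 2 = ∑ i, ∑ k, v i * (f s i * f s k) * v k := by
    intro s
    rw [inner_eq_sum, sq, Finset.sum_mul_sum]
    exact Finset.sum_congr rfl fun i _ => Finset.sum_congr rfl fun k _ => by ring
  simp_rw [h1]
  rw [integral_finsetSum _ fun i _ => integrable_finsetSum _ fun k _ => h_integrable i k]
  refine Finset.sum_congr rfl fun i _ => ?_
  rw [integral_finsetSum _ fun k _ => h_integrable i k]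
  refine Finset.sum_congr rfl fun k _ => ?_
  rw [integral_mul_const, integral_const_mul]
  rfl

theorem isHermitian_matExp {S : Type*} [MeasurableSpace S] {d : ℕ} (ν : Measure S)
    {M : S → Matrix (Fin d) (Fin d) ℝ} (hM : ∀ s, (M s).IsHermitian) :
    (matExp ν M).IsHermitian := by
  ext i k
  simp only [matExp, Matrix.conjTranspose_apply, Matrix.of_apply, star_trivial]
  congr 1
  ext s
  simpa using (hM s).apply i k

theorem isHermitian_outer {d : ℕ} (x : Feat d) : (outer x).IsHermitian := by
  ext i k; simp [outer, mul_comm]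

open scoped MatrixOrder in
/-- A real positive definite matrix is the square of a self-adjoint linear equivalence. -/
theorem exists_symmetric_sqrt {d : ℕ} {M : Matrix (Fin d) (Fin d) ℝ} (hM : M.PosDef) :
    ∃ A : Feat d ≃L[ℝ] Feat d, (∀ u v, inner ℝ (A u) v = inner ℝ u (A v)) ∧
      ∀ v, ‖A v‖ ^ 2 = ∑ i, ∑ k, v i * M i k * v k := by
  have h0 : (0 : Matrix (Fin d) (Fin d) ℝ) ≤ M := Matrix.nonneg_iff_posSemidef.mpr hM.posSemidef
  set S := CFC.sqrt M with hS
  have hSS : S * S = M := CFC.sqrt_mul_sqrt_self M h0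
  have hSh : S.IsHermitian := (Matrix.nonneg_iff_posSemidef.mp (CFC.sqrt_nonneg M)).isHermitian
  have hdet : IsUnit S.det := by
    have := (Matrix.isUnit_iff_isUnit_det _).mp hM.isUnit
    rw [← hSS, Matrix.det_mul] at this
    exact isUnit_of_mul_isUnit_left this
  let F := Matrix.toEuclideanCLM (n := Fin d) (𝕜 := ℝ)
  have hF : ∀ (N : Matrix (Fin d) (Fin d) ℝ) (v : Feat d), (F N v).ofLp = N.mulVec v.ofLp :=
    fun N v => Matrix.ofLp_toEuclideanCLM _ _
  have hsymm : ∀ u v : Feat d, inner ℝ (F S u) v = inner ℝ u (F S v) := by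
    intro u v
    have hT : S.transpose = S := by simpa using hSh.eq
    rw [inner_eq_sum, inner_eq_sum]
    simp only [hF]
    change S.mulVec u.ofLp ⬝ᵥ v.ofLp = u.ofLp ⬝ᵥ S.mulVec v.ofLp
    rw [Matrix.dotProduct_mulVec, ← Matrix.mulVec_transpose, hT]
  refine ⟨ContinuousLinearEquiv.equivOfInverse (F S) (F S⁻¹) (fun v => ?_) (fun v => ?_),
    hsymm, fun v => ?_⟩
  · rw [← mul_apply_eq_comp, ← map_mul, Matrix.nonsing_inv_mul _ hdet, map_one]; rfl
  · rw [← mul_apply_eq_comp, ← map_mul, Matrix.mul_nonsing_inv _ hdet, map_one]; rfl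
  · change ‖F S v‖ ^ 2 = _
    rw [← real_inner_self_eq_norm_sq, hsymm, inner_eq_sum, ← mul_apply_eq_comp,
      ← map_mul, hSS]
    simp only [hF, Matrix.mulVec, dotProduct, Finset.mul_sum, mul_assoc]

theorem measurable_eval_fin {S E : Type*} {mS : MeasurableSpace S} [MeasurableSpace E] {K : ℕ}
    {f : S → Fin K → E} {g : S → Fin K} (hf : Measurable f) (hg : Measurable g) :
    Measurable fun s => f s (g s) := by
  have h : Measurable fun q : (Fin K → E) × Fin K => q.1 q.2 :=
    measurable_from_prod_countable_left fun a => measurable_pi_apply a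
  exact h.comp (hf.prodMk hg)

theorem measurable_feat_apply {d K : ℕ} (a : Fin K) : Measurable fun x : Fin K → Feat d => x a :=
  measurable_pi_apply a

/-! ### Second-moment consequences of the bandit assumptions -/

namespace GLBandit

variable {d K : ℕ} (B : GLBandit d K)

instance : IsProbabilityMeasure B.ν := B.prob

theorem K_pos (B : GLBandit d K) : 0 < K := by
  rcases Nat.eq_zero_or_pos K with rfl | h
  · exact (B.best 0 fun a => a.elim0).elim0
  · exact h

theorem d_pos (B : GLBandit d K) : 0 < d := by
  rcases Nat.eq_zero_or_pos d with rfl | h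
  · have := B.regular
    rw [lambdaMin_eq_zero_of_isEmpty] at this
    nlinarith [B.σ₀_pos]
  · exact h

theorem ae_norm_le (a : Fin K) : ∀ᵐ x ∂B.ν, ‖x a‖ ≤ 1 := by
  filter_upwards [B.norm_le] with x hx using hx a

theorem sum_matExp_uniform (v : Feat d) :
    ∑ i, ∑ k, v i * matExp B.ν (fun x => (K : ℝ)⁻¹ • ∑ a, outer (x a)) i k * v k
      = (K : ℝ)⁻¹ * ∑ a, ∫ x, (inner ℝ v (x a)) ^ 2 ∂B.ν := by
  have h : ∀ i k, matExp B.ν (fun x => (K : ℝ)⁻¹ • ∑ a, outer (x a)) i k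
      = (K : ℝ)⁻¹ * ∑ a, matExp B.ν (fun x => outer (x a)) i k := by
    intro i k
    simp only [matExp, outer, Matrix.of_apply, Matrix.smul_apply, Matrix.sum_apply, smul_eq_mul]
    rw [integral_const_mul, integral_finsetSum]
    intro a _
    refine Integrable.of_bound (C := 1) (by fun_prop) ?_
    filter_upwards [B.ae_norm_le a] with x hx
    rw [norm_mul]
    exact mul_le_one₀ ((abs_apply_le_norm _ i).trans hx) (norm_nonneg _)
      ((abs_apply_le_norm _ k).trans hx)
  have h2 : ∀ a, ∫ x, (inner ℝ v (x a)) ^ 2 ∂B.ν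
      = ∑ i, ∑ k, v i * matExp B.ν (fun x => outer (x a)) i k * v k := fun a =>
    (sum_matExp_outer (f := fun x : Fin K → Feat d => x a) (measurable_pi_apply a)
      (B.ae_norm_le a) v).symm
  simp_rw [h, h2]
  rw [Finset.sum_comm (s := (Finset.univ : Finset (Fin K))), Finset.mul_sum]
  refine Finset.sum_congr rfl fun i _ => ?_
  rw [Finset.sum_comm (s := (Finset.univ : Finset (Fin K))), Finset.mul_sum]
  refine Finset.sum_congr rfl fun k _ => ?_
  simp_rw [Finset.mul_sum, Finset.sum_mul]
  exact Finset.sum_congr rfl fun a _ => by ring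

theorem isHermitian_uniform :
    (matExp B.ν fun x => (K : ℝ)⁻¹ • ∑ a, outer (x a)).IsHermitian := by
  refine isHermitian_matExp _ fun x => ?_
  refine Matrix.IsHermitian.smul ?_ (IsSelfAdjoint.all _)
  ext i k
  simp [Matrix.sum_apply, outer, mul_comm]

theorem σ₀_sq_mul_le (v : Feat d) :
    B.σ₀ ^ 2 * ‖v‖ ^ 2 ≤ (K : ℝ)⁻¹ * ∑ a, ∫ x, (inner ℝ v (x a)) ^ 2 ∂B.ν := by
  rw [← sum_matExp_uniform]
  exact (mul_le_mul_of_nonneg_right B.regular (by positivity)).trans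
    (lambdaMin_mul_norm_sq_le B.isHermitian_uniform v)

/-- Whitening of the feature vector of a uniformly chosen arm. -/
theorem exists_whitening : ∃ A : Feat d ≃L[ℝ] Feat d,
    (∀ u v, inner ℝ (A u) v = inner ℝ u (A v)) ∧
    (∀ v, ‖A v‖ ^ 2 = (K : ℝ)⁻¹ * ∑ a, ∫ x, (inner ℝ v (x a)) ^ 2 ∂B.ν) ∧
    ∀ v, B.σ₀ * ‖v‖ ≤ ‖A v‖ := by
  have hpd : (matExp B.ν fun x => (K : ℝ)⁻¹ • ∑ a, outer (x a)).PosDef := by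
    refine Matrix.PosDef.of_dotProduct_mulVec_pos B.isHermitian_uniform fun x hx => ?_
    have h1 := B.σ₀_sq_mul_le (WithLp.toLp 2 x)
    rw [← sum_matExp_uniform] at h1
    have h2 : 0 < B.σ₀ ^ 2 * ‖WithLp.toLp 2 x‖ ^ 2 := by
      have := B.σ₀_pos
      have : 0 < ‖WithLp.toLp 2 x‖ := norm_pos_iff.mpr fun h => hx (by simpa using h)
      positivity
    refine h2.trans_le (h1.trans_eq ?_)
    simp [dotProduct, Matrix.mulVec, Finset.mul_sum, mul_assoc]
  obtain ⟨A, h1, h2⟩ := exists_symmetric_sqrt hpd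
  refine ⟨A, h1, fun v => by rw [h2, sum_matExp_uniform], fun v => ?_⟩
  refine le_of_sq_le_sq ?_ (norm_nonneg _)
  rw [mul_pow, h2, sum_matExp_uniform]
  exact B.σ₀_sq_mul_le v

theorem isHermitian_best (θ : Feat d) :
    (matExp B.ν fun x => outer (x (B.best θ x))).IsHermitian :=
  isHermitian_matExp _ fun _ => isHermitian_outer _

theorem measurable_best (θ : Feat d) : Measurable fun x : Fin K → Feat d => x (B.best θ x) :=
  measurable_eval_fin measurable_id (B.best_measurable θ)

theorem lambdaMin_best_mul_le (θ v : Feat d) :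
    lambdaMin (matExp B.ν fun x => outer (x (B.best θ x))) * ‖v‖ ^ 2
      ≤ ∫ x, (inner ℝ v (x (B.best θ x))) ^ 2 ∂B.ν := by
  rw [← sum_matExp_outer (B.measurable_best θ)]
  · exact lambdaMin_mul_norm_sq_le (B.isHermitian_best θ) v
  · filter_upwards [B.norm_le] with x hx using hx _

/-- A real `⨅` is below its terms only when the range is bounded below; here positive
semidefiniteness of second moments gives the bound `0`. -/
theorem bddBelow_lambdaMin_best :
    BddBelow (Set.range fun θ => lambdaMin (matExp B.ν fun x => outer (x (B.best θ x)))) := by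
  refine ⟨0, ?_⟩
  rintro _ ⟨θ, rfl⟩
  have hpsd : (matExp B.ν fun x => outer (x (B.best θ x))).PosSemidef := by
    refine Matrix.PosSemidef.of_dotProduct_mulVec_nonneg (B.isHermitian_best θ) fun x => ?_
    have h := sum_matExp_outer (B.measurable_best θ)
      (by filter_upwards [B.norm_le] with x hx using hx _) (WithLp.toLp 2 x)
    calc (0 : ℝ) ≤ _ := integral_nonneg fun _ => sq_nonneg _
      _ = _ := h.symm
      _ = _ := by simp [dotProduct, Matrix.mulVec, Finset.mul_sum, mul_assoc]
  exact Real.sInf_nonneg fun r hr =>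
    (Matrix.posSemidef_iff_isHermitian_and_spectrum_nonneg.mp hpsd).2 hr

theorem lambdaF_mul_le (θ v : Feat d) :
    lambdaF B.ν B.best * ‖v‖ ^ 2 ≤ ∫ x, (inner ℝ v (x (B.best θ x))) ^ 2 ∂B.ν :=
  (mul_le_mul_of_nonneg_right (ciInf_le B.bddBelow_lambdaMin_best θ) (by positivity)).trans
    (B.lambdaMin_best_mul_le θ v)

theorem exists_unit (B : GLBandit d K) : ∃ e : Feat d, ‖e‖ = 1 :=
  ⟨EuclideanSpace.single ⟨0, B.d_pos⟩ 1, by simp⟩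

theorem sq_inner_le_one {e x : Feat d} (he : ‖e‖ ≤ 1) (hx : ‖x‖ ≤ 1) : (inner ℝ e x) ^ 2 ≤ 1 := by
  rw [sq_le_one_iff_abs_le_one]
  exact (abs_real_inner_le_norm _ _).trans (mul_le_one₀ he (norm_nonneg _) hx)

/-- Tested on a unit vector, with features in the unit ball. It allows higher powers of `λ_f` to be
compared with lower ones when the size of `τ` is used. -/
theorem lambdaF_le_one : lambdaF B.ν B.best ≤ 1 := by
  obtain ⟨e, he⟩ := B.exists_unit
  have h := B.lambdaF_mul_le 0 e
  rw [he, one_pow, mul_one] at h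
  refine h.trans ?_
  calc _ ≤ ∫ _, (1 : ℝ) ∂B.ν := by
        refine integral_mono_of_nonneg (ae_of_all _ fun x => sq_nonneg _) (integrable_const _) ?_
        filter_upwards [B.norm_le] with x hx using sq_inner_le_one he.le (hx _)
    _ = 1 := by simp

theorem σ₀_sq_le_one : B.σ₀ ^ 2 ≤ 1 := by
  obtain ⟨e, he⟩ := B.exists_unit
  have h := B.σ₀_sq_mul_le e
  rw [he, one_pow, mul_one] at h
  have hK : (0 : ℝ) < K := by exact_mod_cast B.K_pos
  have h1 : ∀ a : Fin K, ∫ x, (inner ℝ e (x a)) ^ 2 ∂B.ν ≤ 1 := fun a =>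
    calc _ ≤ ∫ _, (1 : ℝ) ∂B.ν := by
          refine integral_mono_of_nonneg (ae_of_all _ fun x => sq_nonneg _) (integrable_const _) ?_
          filter_upwards [B.norm_le] with x hx using sq_inner_le_one he.le (hx _)
      _ = 1 := by simp
  calc B.σ₀ ^ 2 ≤ _ := h
    _ ≤ (K : ℝ)⁻¹ * ∑ a : Fin K, 1 := by gcongr with a; exact h1 a
    _ = 1 := by simp [hK.ne.symm]

/-! ### The link function -/

theorem deriv_nonneg (z : ℝ) : 0 ≤ deriv B.μ z := B.strictMono.monotone.deriv_nonneg

theorem cEta_le_deriv {η : ℝ} {x θ : Feat d} (hx : ‖x‖ ≤ 1) (hθ : ‖θ - B.θstar‖ ≤ η) :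
    cEta B.μ B.θstar η ≤ deriv B.μ (inner ℝ x θ) := by
  refine csInf_le ⟨0, ?_⟩ ⟨x, θ, hx, hθ, rfl⟩
  rintro r ⟨x, θ, -, -, rfl⟩
  exact B.deriv_nonneg _

theorem cEta_three_le_cEta_one : cEta B.μ B.θstar 3 ≤ cEta B.μ B.θstar 1 := by
  refine le_csInf ⟨_, 0, B.θstar, by simp, by simp, rfl⟩ ?_
  rintro r ⟨x, θ, hx, hθ, rfl⟩
  exact B.cEta_le_deriv hx (hθ.trans (by norm_num))

theorem c₁_pos : 0 < cEta B.μ B.θstar 1 := B.c₃_pos.trans_le B.cEta_three_le_cEta_one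

/-- Mean value theorem along the segment from `θstar` to `θ`, which stays in the ball where `μ'` is
at least `c_η`. This is the source of all curvature: with `η = 1` for the likelihood, with `η = 3`
for gradient descent. -/
theorem cEta_mul_sq_le {η : ℝ} {x θ : Feat d} (hx : ‖x‖ ≤ 1) (hθ : ‖θ - B.θstar‖ ≤ η) :
    cEta B.μ B.θstar η * (inner ℝ x (θ - B.θstar)) ^ 2
      ≤ (B.μ (inner ℝ x θ) - B.μ (inner ℝ x B.θstar)) * inner ℝ x (θ - B.θstar) := by
  let g : ℝ → ℝ := fun s => B.μ (inner ℝ x (B.θstar + s • (θ - B.θstar)))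
  have hlin : ∀ s : ℝ, inner ℝ x (B.θstar + s • (θ - B.θstar))
      = inner ℝ x B.θstar + s * inner ℝ x (θ - B.θstar) := fun s => by
    rw [inner_add_right, real_inner_smul_right]
  have hg : ∀ s, HasDerivAt g (deriv B.μ (inner ℝ x (B.θstar + s • (θ - B.θstar)))
      * inner ℝ x (θ - B.θstar)) s := by
    intro s
    have h1 : HasDerivAt (fun s : ℝ => inner ℝ x (B.θstar + s • (θ - B.θstar)))
        (inner ℝ x (θ - B.θstar)) s := by
      simp_rw [hlin]
      simpa using ((hasDerivAt_id s).mul_const (inner ℝ x (θ - B.θstar))).const_add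
        (inner ℝ x B.θstar)
    exact (B.differentiable _).hasDerivAt.comp s h1
  obtain ⟨s, hs, hs'⟩ := exists_hasDerivAt_eq_slope g _ zero_lt_one
    (fun s _ => (hg s).continuousAt.continuousWithinAt) (fun s _ => hg s)
  have h0 : g 0 = B.μ (inner ℝ x B.θstar) := by simp [g]
  have h1 : g 1 = B.μ (inner ℝ x θ) := by simp [g]
  rw [h0, h1, sub_zero, div_one] at hs'
  rw [← hs', mul_assoc, ← sq]
  refine mul_le_mul_of_nonneg_right (B.cEta_le_deriv hx ?_) (sq_nonneg _)
  rw [add_sub_cancel_left, norm_smul, Real.norm_of_nonneg hs.1.le]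
  exact (mul_le_of_le_one_left (norm_nonneg _) hs.2.le).trans hθ

/-- Along a unit vector the link increases by at least `c₃`, yet it takes values in `[0, 1]`. Hence
`c₃` never decides the maximum in `α`. -/
theorem c₃_le_one : cEta B.μ B.θstar 3 ≤ 1 := by
  obtain ⟨e, he⟩ := B.exists_unit
  have h := B.cEta_mul_sq_le (η := 3) (x := e) (θ := B.θstar + e) he.le (by simp [he])
  rw [add_sub_cancel_left, real_inner_self_eq_norm_sq, he] at h
  have h1 := (B.μ_mem (inner ℝ e (B.θstar + e))).2
  have h2 := (B.μ_mem (inner ℝ e B.θstar)).1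
  linarith

theorem sub_le_L_mul {a b : ℝ} (hab : b ≤ a) : B.μ a - B.μ b ≤ B.L * (a - b) := by
  have := Convex.norm_image_sub_le_of_norm_deriv_le (f := B.μ) (C := B.L) (s := Set.univ)
    (fun x _ => B.differentiable x) (fun x _ => B.deriv_le x) convex_univ
    (Set.mem_univ b) (Set.mem_univ a)
  rw [Real.norm_eq_abs, Real.norm_eq_abs, abs_of_nonneg (sub_nonneg.mpr hab)] at this
  exact (le_abs_self _).trans this

theorem continuous_μ : Continuous B.μ := B.differentiable.continuous

end GLBandit

/-! ### Conditional lower integrals bounded by one -/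

/-- `E[e | m] ≤ 1`, phrased with lower integrals so that no integrability is needed. -/
def CondLeOne {Ω : Type*} (m : MeasurableSpace Ω) {m0 : MeasurableSpace Ω} (P : Measure Ω)
    (e : Ω → ℝ≥0∞) : Prop :=
  ∀ W : Ω → ℝ≥0∞, Measurable[m] W → ∫⁻ ω, W ω * e ω ∂P ≤ ∫⁻ ω, W ω ∂P

section CondLeOne

variable {Ω : Type*} {m m0 : MeasurableSpace Ω} {P : Measure Ω}

/-- Indicator weights suffice: sums and monotone limits carry the inequality to all measurable
weights. -/
theorem CondLeOne.of_setLIntegral (hm : m ≤ m0) {e : Ω → ℝ≥0∞} (he : Measurable e)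
    (h : ∀ A, MeasurableSet[m] A → ∫⁻ ω in A, e ω ∂P ≤ P A) : CondLeOne m P e := by
  refine @Measurable.ennreal_induction _ m _ (fun c s hs => ?_) (fun f g _ hf _ hf' hg' => ?_)
    fun f hf hmono ih => ?_
  · have h1 : ∀ ω, s.indicator (fun _ => c) ω * e ω = c * s.indicator e ω := fun ω => by
      by_cases hω : ω ∈ s <;> simp [hω]
    simp_rw [h1]
    rw [lintegral_const_mul _ (he.indicator (hm _ hs)), lintegral_indicator (hm _ hs),
      lintegral_indicator_const (hm _ hs)]
    gcongr
    exact h s hs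
  · simp_rw [Pi.add_apply, add_mul]
    have hf0 := hf.mono hm le_rfl
    rw [lintegral_add_left (f := fun ω => f ω * e ω) (hf0.mul he), lintegral_add_left hf0]
    exact add_le_add hf' hg'
  · simp only [ENNReal.iSup_mul]
    have hf0 := fun n => (hf n).mono hm le_rfl
    rw [lintegral_iSup (f := fun n ω => f n ω * e ω) (fun n => (hf0 n).mul he),
      lintegral_iSup hf0 hmono]
    · exact iSup_mono ih
    · exact fun i j hij ω => mul_le_mul_left (hmono hij ω) _

/-- Peel off the last factor, with the product of the earlier ones as the weight. -/
theorem lintegral_prod_le_one [IsProbabilityMeasure P] {F : ℕ → MeasurableSpace Ω}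
    (hF : Monotone F) {e : ℕ → Ω → ℝ≥0∞} {a b : ℕ}
    (hme : ∀ s, a ≤ s → s < b → Measurable[F (s + 1)] (e s))
    (he : ∀ s, a ≤ s → s < b → CondLeOne (F s) P (e s)) :
    ∫⁻ ω, ∏ s ∈ Finset.Ico a b, e s ω ∂P ≤ 1 := by
  rcases le_or_gt a b with hab | hab
  swap
  · simp [Finset.Ico_eq_empty_of_le hab.le]
  induction b, hab using Nat.le_induction with
  | base => simp
  | succ b hab ih =>
    simp_rw [Finset.prod_Ico_succ_top hab]
    refine (he b hab (Nat.lt_succ_self b) _ ?_).trans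
      (ih (fun s h1 h2 => hme s h1 (h2.trans (Nat.lt_succ_self b)))
        fun s h1 h2 => he s h1 (h2.trans (Nat.lt_succ_self b)))
    refine Finset.measurable_prod _ fun s hs => ?_
    rw [Finset.mem_Ico] at hs
    exact (hme s hs.1 (by omega)).mono (hF (by omega)) le_rfl

/-- Chernoff bound for a sum of increments with conditional exponential moments at most one. -/
theorem measure_lt_sum_le_exp [IsProbabilityMeasure P] {F : ℕ → MeasurableSpace Ω}
    (hF : Monotone F) (hF0 : ∀ s, F s ≤ m0) {y : ℕ → Ω → ℝ} {a b : ℕ}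
    (hme : ∀ s, a ≤ s → s < b → Measurable[F (s + 1)] (y s))
    (he : ∀ s, a ≤ s → s < b → CondLeOne (F s) P fun ω => ENNReal.ofReal (Real.exp (y s ω)))
    (r : ℝ) :
    P {ω | r ≤ ∑ s ∈ Finset.Ico a b, y s ω} ≤ ENNReal.ofReal (Real.exp (-r)) := by
  have hme' : ∀ s, a ≤ s → s < b →
      Measurable[F (s + 1)] fun ω => ENNReal.ofReal (Real.exp (y s ω)) := fun s h1 h2 =>
    ENNReal.measurable_ofReal.comp (Real.measurable_exp.comp (hme s h1 h2))
  have h1 := lintegral_prod_le_one hF hme' he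
  have hprod : ∀ ω, ∏ s ∈ Finset.Ico a b, ENNReal.ofReal (Real.exp (y s ω))
      = ENNReal.ofReal (Real.exp (∑ s ∈ Finset.Ico a b, y s ω)) := fun ω => by
    rw [Real.exp_sum, ENNReal.ofReal_prod_of_nonneg fun _ _ => (Real.exp_pos _).le]
  simp_rw [hprod] at h1
  have hms : Measurable fun ω => ∑ s ∈ Finset.Ico a b, y s ω :=
    Finset.measurable_fun_sum _ fun s hs => by
      rw [Finset.mem_Ico] at hs
      exact (hme s hs.1 hs.2).mono (hF0 _) le_rfl
  have h2 := mul_meas_ge_le_lintegral₀ (μ := P)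
    (f := fun ω => ENNReal.ofReal (Real.exp (∑ s ∈ Finset.Ico a b, y s ω)))
    (ENNReal.measurable_ofReal.comp (Real.measurable_exp.comp hms)).aemeasurable
    (ENNReal.ofReal (Real.exp r))
  have h3 : {ω | r ≤ ∑ s ∈ Finset.Ico a b, y s ω} ⊆ {ω | ENNReal.ofReal (Real.exp r)
      ≤ ENNReal.ofReal (Real.exp (∑ s ∈ Finset.Ico a b, y s ω))} := fun ω hω =>
    ENNReal.ofReal_le_ofReal (Real.exp_le_exp.mpr hω)
  rw [Real.exp_neg, ENNReal.ofReal_inv_of_pos (Real.exp_pos r), ← one_div,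
    ENNReal.le_div_iff_mul_le (by simp [Real.exp_pos]) (by simp), mul_comm]
  exact ((mul_le_mul_right (measure_mono h3) _).trans h2).trans h1

/-- Sub-Gaussian increments stay sub-Gaussian with a predictable multiplier. -/
theorem CondLeOne.exp_mul_sub [IsFiniteMeasure P] (hm : m ≤ m0) {ε : Ω → ℝ} (hε : Measurable ε)
    {c : ℝ}
    (h : ∀ l : ℝ, ∀ A, MeasurableSet[m] A →
      ∫⁻ ω in A, ENNReal.ofReal (Real.exp (l * ε ω - c * l ^ 2)) ∂P ≤ P A)
    {l : Ω → ℝ} (hl : Measurable[m] l) :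
    CondLeOne m P fun ω => ENNReal.ofReal (Real.exp (l ω * ε ω - c * l ω ^ 2)) := by
  have hl0 := hl.mono hm le_rfl
  refine CondLeOne.of_setLIntegral hm (by fun_prop) fun A hA => ?_
  -- The hypothesis covers only deterministic multipliers. Rounding `l` down to multiples of `1 / (n
  -- + 1)` leaves countably many values; the hypothesis applies on each level set, and Fatou's lemma
  -- removes the rounding.
  let q : ℕ → Ω → ℤ := fun n ω => ⌊l ω * (n + 1)⌋
  let ln : ℕ → Ω → ℝ := fun n ω => (q n ω : ℝ) / (n + 1)
  have hq : ∀ n, Measurable[m] (q n) := fun n => Int.measurable_floor.comp (hl.mul_const _)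
  have hq0 : ∀ n, Measurable (q n) := fun n => (hq n).mono hm le_rfl
  have hln0 : ∀ n, Measurable (ln n) := fun n =>
    ((measurable_from_top (f := fun z : ℤ => (z : ℝ))).comp (hq0 n)).div_const _
  have hlim : ∀ ω, Filter.Tendsto (fun n => ln n ω) Filter.atTop (nhds (l ω)) := by
    intro ω
    rw [tendsto_iff_dist_tendsto_zero]
    refine squeeze_zero (fun _ => dist_nonneg) (fun n => ?_)
      (tendsto_one_div_add_atTop_nhds_zero_nat (𝕜 := ℝ))
    have hn : (0 : ℝ) < n + 1 := by positivity
    have h1 := Int.floor_le (l ω * (n + 1))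
    have h2 := Int.lt_floor_add_one (l ω * (n + 1))
    have h3 : ln n ω - l ω = ((q n ω : ℝ) - l ω * (n + 1)) / (n + 1) := by
      simp only [ln]; field_simp
    rw [Real.dist_eq, h3, abs_div, abs_of_pos hn]
    gcongr
    rw [abs_le]
    constructor <;> simp only [q] <;> linarith
  have hstep : ∀ n, ∫⁻ ω in A, ENNReal.ofReal (Real.exp (ln n ω * ε ω - c * ln n ω ^ 2)) ∂P
      ≤ P A := by
    intro n
    have hcover : A = ⋃ z : ℤ, A ∩ q n ⁻¹' {z} := by
      ext ω; simp
    have hmz : ∀ z : ℤ, MeasurableSet[m] (A ∩ q n ⁻¹' {z}) := fun z =>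
      hA.inter (hq n (measurableSet_singleton z))
    have hdisj : Pairwise (Function.onFun Disjoint fun z : ℤ => A ∩ q n ⁻¹' {z}) := by
      intro z z' hne
      rw [Function.onFun, Set.disjoint_left]
      rintro ω ⟨-, h1⟩ ⟨-, h2⟩
      exact hne (h1.symm.trans h2)
    conv_lhs => rw [hcover]
    conv_rhs => rw [hcover]
    rw [lintegral_iUnion (fun z => hm _ (hmz z)) hdisj, measure_iUnion hdisj fun z => hm _ (hmz z)]
    refine ENNReal.tsum_le_tsum fun z => ?_
    refine le_trans (le_of_eq ?_) (h ((z : ℝ) / (n + 1)) _ (hmz z))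
    refine setLIntegral_congr_fun (hm _ (hmz z)) fun ω hω => ?_
    have : q n ω = z := hω.2
    simp only [ln, this]
  have hfatou := lintegral_liminf_le (μ := P.restrict A)
    (u := Filter.atTop) (f := fun n ω => ENNReal.ofReal (Real.exp (ln n ω * ε ω - c * ln n ω ^ 2)))
    (fun n => by have := hln0 n; fun_prop)
  have hlim' : ∀ ω, Filter.liminf (fun n =>
      ENNReal.ofReal (Real.exp (ln n ω * ε ω - c * ln n ω ^ 2))) Filter.atTop
      = ENNReal.ofReal (Real.exp (l ω * ε ω - c * l ω ^ 2)) := by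
    intro ω
    refine Filter.Tendsto.liminf_eq ?_
    have hc : Continuous fun x : ℝ => ENNReal.ofReal (Real.exp (x * ε ω - c * x ^ 2)) :=
      ENNReal.continuous_ofReal.comp (by fun_prop)
    exact (hc.tendsto _).comp (hlim ω)
  simp_rw [hlim'] at hfatou
  refine hfatou.trans ?_
  refine (Filter.liminf_le_liminf (Filter.Eventually.of_forall hstep)).trans ?_
  simp

/-- The linear term vanishes on integrating a centred variable, so for `|ε| ≤ 1` the moment `E exp
(l ε)` is at most `exp (l²)`. The proof uses a second-order estimate for `|x| ≤ 1` and a crude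
comparison otherwise. -/
theorem exp_le_self_add_exp_sq (x : ℝ) : Real.exp x ≤ x + Real.exp (x ^ 2) := by
  have h0 := Real.add_one_le_exp (x ^ 2)
  rcases le_or_gt |x| 1 with h | h
  · have := (abs_le.mp (Real.abs_exp_sub_one_sub_id_le h)).2
    linarith
  · rcases lt_abs.mp h with h | h
    · have : Real.exp x ≤ Real.exp (x ^ 2) := Real.exp_le_exp.mpr (by nlinarith)
      linarith
    · have : Real.exp x ≤ 1 := Real.exp_le_one_iff.mpr (by linarith)
      nlinarith

/-- Bounded centred increments are sub-Gaussian with a predictable multiplier. -/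
theorem CondLeOne.exp_mul_sub_of_centered [IsFiniteMeasure P] (hm : m ≤ m0) {ε : Ω → ℝ}
    (hε : Measurable ε) (hb : ∀ ω, |ε ω| ≤ 1) (hc : P[ε | m] =ᵐ[P] 0)
    {l : Ω → ℝ} (hl : Measurable[m] l) :
    CondLeOne m P fun ω => ENNReal.ofReal (Real.exp (l ω * ε ω - l ω ^ 2)) := by
  have hεint : Integrable ε P := Integrable.of_bound (C := 1) hε.aestronglyMeasurable
    (ae_of_all _ hb)
  have key : ∀ l : ℝ, ∀ A, MeasurableSet[m] A →
      ∫⁻ ω in A, ENNReal.ofReal (Real.exp (l * ε ω - 1 * l ^ 2)) ∂P ≤ P A := by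
    intro l A hA
    have hz : ∫ ω in A, ε ω ∂P = 0 := by
      rw [← setIntegral_condExp hm hεint hA, setIntegral_congr_ae (g := fun _ => (0 : ℝ)) (hm _ hA)]
      · simp
      · filter_upwards [hc] with ω hω _ using hω
    -- The upper bound is affine in `ε` with constant term `1`, so its integral over `A` is `P A`.
    have hpt : ∀ ω, Real.exp (l * ε ω - 1 * l ^ 2) ≤ Real.exp (-l ^ 2) * l * ε ω + 1 := by
      intro ω
      have h1 := exp_le_self_add_exp_sq (l * ε ω)
      have h2 : Real.exp ((l * ε ω) ^ 2) ≤ Real.exp (l ^ 2) := by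
        rw [Real.exp_le_exp, mul_pow]
        exact mul_le_of_le_one_right (sq_nonneg _) ((sq_le_one_iff_abs_le_one _).mpr (hb ω))
      rw [sub_eq_add_neg, Real.exp_add, one_mul]
      have h3 : Real.exp (l ^ 2) * Real.exp (-l ^ 2) = 1 := by rw [← Real.exp_add]; simp
      have h4 := Real.exp_pos (-l ^ 2)
      calc Real.exp (l * ε ω) * Real.exp (-l ^ 2)
          ≤ (l * ε ω + Real.exp (l ^ 2)) * Real.exp (-l ^ 2) := by gcongr; linarith
        _ = _ := by rw [add_mul, h3]; ring
    have h_integrable : Integrable (fun ω => Real.exp (-l ^ 2) * l * ε ω + 1) (P.restrict A) :=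
      ((hεint.const_mul _).add (integrable_const _)).restrict
    calc _ ≤ ∫⁻ ω in A, ENNReal.ofReal (Real.exp (-l ^ 2) * l * ε ω + 1) ∂P :=
          lintegral_mono fun ω => ENNReal.ofReal_le_ofReal (hpt ω)
      _ = ENNReal.ofReal (∫ ω in A, Real.exp (-l ^ 2) * l * ε ω + 1 ∂P) := by
          rw [ofReal_integral_eq_lintegral_ofReal h_integrable]
          exact ae_of_all _ fun ω => (Real.exp_pos _).le.trans (hpt ω)
      _ = P A := by
          rw [integral_add (hεint.const_mul _).restrict (integrable_const _),
            integral_const_mul, hz]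
          simp [Measure.real]
  simpa using CondLeOne.exp_mul_sub hm hε key hl

/-- Integrating out a random variable that is independent of the past. -/
theorem lintegral_mul_comp_of_indep {α β : Type*} [MeasurableSpace α] [MeasurableSpace β]
    [IsProbabilityMeasure P] (hm : m ≤ m0) {U : Ω → α} {V : Ω → β} (hU : Measurable[m] U)
    (hV : Measurable V) (hind : Indep (MeasurableSpace.comap V inferInstance) m P)
    {H : α → β → ℝ≥0∞} (hH : Measurable (Function.uncurry H)) {W : Ω → ℝ≥0∞}
    (hW : Measurable[m] W) :
    ∫⁻ ω, W ω * H (U ω) (V ω) ∂P = ∫⁻ ω, W ω * ∫⁻ y, H (U ω) y ∂(P.map V) ∂P := by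
  have hU0 := hU.mono hm le_rfl
  have hW0 := hW.mono hm le_rfl
  have hi : IndepFun (fun ω => (W ω, U ω)) V P := by
    rw [IndepFun_iff_Indep]
    exact indep_of_indep_of_le_left hind.symm (hW.prodMk hU).comap_le
  have hmap := (indepFun_iff_map_prod_eq_prod_map_map (hW0.prodMk hU0).aemeasurable
    hV.aemeasurable).mp hi
  have : IsProbabilityMeasure (P.map V) := Measure.isProbabilityMeasure_map hV.aemeasurable
  have : IsProbabilityMeasure (P.map fun ω => (W ω, U ω)) :=
    Measure.isProbabilityMeasure_map (hW0.prodMk hU0).aemeasurable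
  have hG : Measurable fun q : (ℝ≥0∞ × α) × β => q.1.1 * H q.1.2 q.2 := by
    have : Measurable fun q : (ℝ≥0∞ × α) × β => H q.1.2 q.2 :=
      hH.comp (by fun_prop : Measurable fun q : (ℝ≥0∞ × α) × β => (q.1.2, q.2))
    exact Measurable.mul (by fun_prop) this
  have hH2 : ∀ u, Measurable (H u) := fun u => hH.of_uncurry_left
  calc _ = ∫⁻ q, q.1.1 * H q.1.2 q.2 ∂(P.map fun ω => ((W ω, U ω), V ω)) := by
        rw [lintegral_map hG ((hW0.prodMk hU0).prodMk hV)]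
    _ = ∫⁻ p, ∫⁻ y, p.1 * H p.2 y ∂(P.map V) ∂(P.map fun ω => (W ω, U ω)) := by
        rw [hmap, lintegral_prod _ hG.aemeasurable]
    _ = ∫⁻ ω, ∫⁻ y, W ω * H (U ω) y ∂(P.map V) ∂P := by
        rw [lintegral_map hG.lintegral_prod_right' (hW0.prodMk hU0)]
    _ = _ := by
        refine lintegral_congr fun ω => ?_
        rw [lintegral_const_mul _ (hH2 _)]

end CondLeOne

/-! ### Lower bounds on empirical second moments -/

/-- In the second-order expansion the quadratic term is at most `z / 512` on `[0, 1]`, and `1/16 -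
1/512 = 31/512`. -/
theorem exp_neg_div_le {z : ℝ} (h0 : 0 ≤ z) (h1 : z ≤ 1) :
    Real.exp (-(1 / 16) * z) ≤ 1 - 31 / 512 * z := by
  have h := Real.quadratic_le_exp_of_nonneg (x := 1 / 16 * z) (by positivity)
  have h2 : Real.exp (-(1 / 16) * z) ≤ 1 - 1 / 16 * z + (1 / 16 * z) ^ 2 / 2 := by
    rw [neg_mul, Real.exp_neg, inv_le_iff_one_le_mul₀ (Real.exp_pos _)]
    have h3 : 0 ≤ 1 - 1 / 16 * z + (1 / 16 * z) ^ 2 / 2 := by nlinarith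
    calc (1 : ℝ) ≤ (1 - 1 / 16 * z + (1 / 16 * z) ^ 2 / 2)
          * (1 + 1 / 16 * z + (1 / 16 * z) ^ 2 / 2) := by
          nlinarith [sq_nonneg ((1 / 16 * z) ^ 2)]
      _ ≤ _ := by gcongr
  nlinarith

/-- The exponential moment of `-(v·X)² / 16` when `X` has second moments at least `lam`. -/
theorem lintegral_exp_neg_sq_le {S : Type*} [MeasurableSpace S] {ν : Measure S}
    [IsProbabilityMeasure ν] {z : S → ℝ} (hz : Measurable z) (h0 : ∀ᵐ s ∂ν, 0 ≤ z s ∧ z s ≤ 1)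
    {r : ℝ} (hr : r ≤ ∫ s, z s ∂ν) :
    ∫⁻ s, ENNReal.ofReal (Real.exp (-(1 / 16) * z s)) ∂ν
      ≤ ENNReal.ofReal (Real.exp (-(31 / 512) * r)) := by
  have hzint : Integrable z ν := Integrable.of_bound (C := 1) hz.aestronglyMeasurable (by
    filter_upwards [h0] with s hs
    rw [Real.norm_of_nonneg hs.1]; exact hs.2)
  calc _ ≤ ∫⁻ s, ENNReal.ofReal (1 - 31 / 512 * z s) ∂ν := by
        refine lintegral_mono_ae ?_
        filter_upwards [h0] with s hs
        exact ENNReal.ofReal_le_ofReal (exp_neg_div_le hs.1 hs.2)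
    _ = ENNReal.ofReal (∫ s, 1 - 31 / 512 * z s ∂ν) := by
        rw [ofReal_integral_eq_lintegral_ofReal
          (f := fun s => 1 - 31 / 512 * z s) ((integrable_const _).sub (hzint.const_mul _))]
        filter_upwards [h0] with s hs
        simp only [Pi.zero_apply]
        linarith [hs.2]
    _ ≤ _ := by
        refine ENNReal.ofReal_le_ofReal ?_
        rw [integral_sub (integrable_const _) (hzint.const_mul _), integral_const_mul]
        simp only [integral_const, probReal_univ, smul_eq_mul, mul_one]
        have := Real.add_one_le_exp (-(31 / 512) * r)
        linarith

theorem five_pow_le_exp (n : ℕ) : (5 : ℝ) ^ n ≤ Real.exp (2 * n) := by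
  have h : (5 : ℝ) ≤ Real.exp 2 := by
    have := Real.exp_one_gt_d9
    rw [show (2 : ℝ) = 1 + 1 by norm_num, Real.exp_add]
    nlinarith
  rw [mul_comm, Real.exp_nat_mul]
  gcongr

theorem sq_inner_sub_le {d : ℕ} {v w x : Feat d} (hv : ‖v‖ ≤ 1) (hw : ‖w‖ ≤ 1) (hx : ‖x‖ ≤ 1) :
    (inner ℝ v x) ^ 2 - 2 * ‖w - v‖ ≤ (inner ℝ w x) ^ 2 := by
  have h1 : |inner ℝ (w - v) x| ≤ ‖w - v‖ :=
    (abs_real_inner_le_norm _ _).trans (mul_le_of_le_one_right (norm_nonneg _) hx)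
  have h2 : |inner ℝ (w + v) x| ≤ 2 :=
    (abs_real_inner_le_norm _ _).trans (by
      have := norm_add_le w v
      nlinarith [norm_nonneg x, norm_nonneg (w + v)])
  have h3 : (inner ℝ w x) ^ 2 - (inner ℝ v x) ^ 2 = inner ℝ (w - v) x * inner ℝ (w + v) x := by
    rw [inner_sub_left, inner_add_left]; ring
  have h4 : |inner ℝ (w - v) x * inner ℝ (w + v) x| ≤ ‖w - v‖ * 2 := by
    rw [abs_mul]; gcongr
  have := (abs_le.mp h4).1
  linarith

/-- With high probability the empirical second moments of an adapted sequence in the unit ball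
are not much smaller than the lower bound `lam` on its conditional second moments. -/
theorem measure_not_second_moment_le {Ω : Type*} {m0 : MeasurableSpace Ω} {P : Measure Ω}
    [IsProbabilityMeasure P] {d : ℕ} {F : ℕ → MeasurableSpace Ω}
    (hF : Monotone F) (hF0 : ∀ s, F s ≤ m0) {X : ℕ → Ω → Feat d} {a b : ℕ} {lam : ℝ}
    (hlam : 0 < lam) (hlam1 : lam ≤ 1)
    (hX : ∀ s, a ≤ s → s < b → Measurable[F (s + 1)] (X s))
    (hX1 : ∀ s, a ≤ s → s < b → ∀ᵐ ω ∂P, ‖X s ω‖ ≤ 1)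
    (hexp : ∀ v : Feat d, ‖v‖ ≤ 1 → ∀ s, a ≤ s → s < b → CondLeOne (F s) P fun ω =>
      ENNReal.ofReal (Real.exp (-(1 / 16) * (inner ℝ v (X s ω)) ^ 2
        + 31 / 512 * (lam * ‖v‖ ^ 2)))) :
    P {ω | ¬ ∀ w : Feat d, 7 / 8 * ((b - a : ℕ) * lam) * ‖w‖ ^ 2
        ≤ ∑ s ∈ Finset.Ico a b, (inner ℝ w (X s ω)) ^ 2}
      ≤ ENNReal.ofReal (Real.exp (402 * d / lam - (b - a : ℕ) * lam / 1024)) := by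
  set n : ℕ := b - a with hn
  -- Since `2 ^ k ≥ k ≥ 200 / lam`, the net has resolution `lam / 100`. Taking `k` linear in `1 /
  -- lam` makes the net as large as `exp (402 d / lam)`, affordable because the block length will be
  -- of order at least `d / lam²`.
  set k : ℕ := ⌈200 / lam⌉₊ with hk
  obtain ⟨N, hNc, hN1, hNcov⟩ := exists_net_in_unit_ball d k
  have hk1 : 200 / lam ≤ k := Nat.le_ceil _
  have hk2 : (k : ℝ) ≤ 201 / lam := by
    have h1 := (Nat.ceil_lt_add_one (a := 200 / lam) (by positivity)).le
    have h2 : 1 ≤ 1 / lam := by rw [le_div_iff₀ hlam]; linarith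
    have h3 : 200 / lam + 1 / lam = 201 / lam := by ring
    linarith
  have hres : 2 * (1 / 2 : ℝ) ^ k ≤ lam / 100 := by
    have h1 : (k : ℝ) ≤ 2 ^ k := by exact_mod_cast (Nat.lt_two_pow_self).le
    have h2 : 200 / lam ≤ 2 ^ k := hk1.trans h1
    rw [div_le_iff₀ hlam] at h2
    rw [one_div, inv_pow, ← div_eq_mul_inv, div_le_iff₀ (by positivity)]
    nlinarith
  let N' := N.filter fun v => 1 / 2 ≤ ‖v‖ ^ 2
  let bad : Feat d → Set Ω := fun v =>
    {ω | n * lam / 1024 ≤ ∑ s ∈ Finset.Ico a b, (-(1 / 16) * (inner ℝ v (X s ω)) ^ 2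
        + 31 / 512 * (lam * ‖v‖ ^ 2))}
  have hbad : ∀ v ∈ N', P (bad v) ≤ ENNReal.ofReal (Real.exp (-(n * lam / 1024))) := by
    intro v hv
    refine measure_lt_sum_le_exp hF hF0 (fun s h1 h2 => ?_)
      (hexp v (hN1 v (Finset.mem_filter.mp hv).1)) _
    have := hX s h1 h2
    exact ((((measurable_const.inner this).pow_const 2).const_mul _).add_const _)
  have hae : ∀ᵐ ω ∂P, ∀ s ∈ Finset.Ico a b, ‖X s ω‖ ≤ 1 := by
    rw [Filter.eventually_all_finset]
    intro s hs
    rw [Finset.mem_Ico] at hs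
    exact hX1 s hs.1 hs.2
  have hsub : {ω | ¬ ∀ w : Feat d, 7 / 8 * (n * lam) * ‖w‖ ^ 2
        ≤ ∑ s ∈ Finset.Ico a b, (inner ℝ w (X s ω)) ^ 2} ≤ᵐ[P] ⋃ v ∈ N', bad v := by
    filter_upwards [hae] with ω hω hnot
    by_contra hgood
    refine hnot fun w => ?_
    rcases eq_or_ne w 0 with rfl | hw
    · simp
    have hw' : 0 < ‖w‖ := norm_pos_iff.mpr hw
    set e : Feat d := ‖w‖⁻¹ • w with he
    have he1 : ‖e‖ = 1 := by rw [he, norm_smul, norm_inv, norm_norm, inv_mul_cancel₀ hw'.ne']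
    have hwe : w = ‖w‖ • e := by rw [he, smul_smul, mul_inv_cancel₀ hw'.ne', one_smul]
    obtain ⟨v, hv, hev⟩ := hNcov e he1.le
    have hev' : ‖e - v‖ ≤ lam / 100 := hev.trans hres
    have hv1 : 1 - lam / 100 ≤ ‖v‖ := by
      have := norm_sub_norm_le e v
      linarith
    have hvsq : 1 - lam / 50 ≤ ‖v‖ ^ 2 := by nlinarith
    have hvN : v ∈ N' := Finset.mem_filter.mpr ⟨hv, by linarith⟩
    have hnb : ω ∉ bad v := fun h => hgood (Set.mem_iUnion₂.mpr ⟨v, hvN, h⟩)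
    have hcard : (Finset.Ico a b).card = n := by simp [hn]
    simp only [bad, Set.mem_ofPred_eq, not_le] at hnb
    rw [Finset.sum_add_distrib, ← Finset.mul_sum, Finset.sum_const, hcard, nsmul_eq_mul] at hnb
    have hsum : ∑ s ∈ Finset.Ico a b, (inner ℝ v (X s ω)) ^ 2 - n * (2 * ‖e - v‖)
        ≤ ∑ s ∈ Finset.Ico a b, (inner ℝ e (X s ω)) ^ 2 := by
      have : ∑ s ∈ Finset.Ico a b, ((inner ℝ v (X s ω)) ^ 2 - 2 * ‖e - v‖)
          ≤ ∑ s ∈ Finset.Ico a b, (inner ℝ e (X s ω)) ^ 2 :=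
        Finset.sum_le_sum fun s hs => sq_inner_sub_le (hN1 v hv) he1.le (hω s hs)
      rw [Finset.sum_sub_distrib, Finset.sum_const, hcard, nsmul_eq_mul] at this
      exact this
    -- Off the bad event the sum at `v` exceeds `n lam (31/32 ‖v‖² - 1/64)`, where `‖v‖² ≥ 1 -
    -- lam/50`. Passing from `v` to `e` costs at most `n lam / 50`, and more than `7/8 n lam`
    -- remains since `lam ≤ 1`.
    have hfin : 7 / 8 * (n * lam) ≤ ∑ s ∈ Finset.Ico a b, (inner ℝ e (X s ω)) ^ 2 := by
      have hn0 : (0 : ℝ) ≤ n := Nat.cast_nonneg n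
      have h1 : (n : ℝ) * (2 * ‖e - v‖) ≤ n * (lam / 50) := by
        gcongr; linarith
      have h2 : (n : ℝ) * lam * (1 - lam / 50) ≤ n * lam * ‖v‖ ^ 2 := by gcongr
      have h3 : (n : ℝ) * lam * lam ≤ n * lam * 1 := by gcongr
      nlinarith
    have hscale : ∑ s ∈ Finset.Ico a b, (inner ℝ w (X s ω)) ^ 2
        = ‖w‖ ^ 2 * ∑ s ∈ Finset.Ico a b, (inner ℝ e (X s ω)) ^ 2 := by
      rw [Finset.mul_sum]
      refine Finset.sum_congr rfl fun s _ => ?_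
      conv_lhs => rw [hwe]
      rw [real_inner_smul_left, mul_pow]
    rw [hscale, mul_comm]
    gcongr
  calc _ ≤ P (⋃ v ∈ N', bad v) := measure_mono_ae hsub
    _ ≤ ∑ v ∈ N', P (bad v) := measure_biUnion_finset_le _ _
    _ ≤ ∑ v ∈ N', ENNReal.ofReal (Real.exp (-(n * lam / 1024))) := Finset.sum_le_sum hbad
    _ = ENNReal.ofReal (N'.card * Real.exp (-(n * lam / 1024))) := by
        rw [Finset.sum_const, nsmul_eq_mul, ENNReal.ofReal_mul (by positivity),
          ENNReal.ofReal_natCast]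
    _ ≤ _ := by
        refine ENNReal.ofReal_le_ofReal ?_
        have h1 : (N'.card : ℝ) ≤ Real.exp (402 * d / lam) := by
          calc (N'.card : ℝ) ≤ (5 : ℝ) ^ (d * k) := by
                exact_mod_cast (Finset.card_filter_le _ _).trans hNc
            _ ≤ Real.exp (2 * (d * k : ℕ)) := five_pow_le_exp _
            _ ≤ _ := by
                rw [Real.exp_le_exp]
                push_cast
                calc 2 * ((d : ℝ) * k) ≤ 2 * (d * (201 / lam)) := by gcongr
                  _ = _ := by ring
        rw [sub_eq_add_neg, Real.exp_add]
        gcongr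

theorem measurable_projBall {S : Type*} {mS : MeasurableSpace S} {d : ℕ} (r : ℝ)
    {c x : S → Feat d} (hc : Measurable c) (hx : Measurable x) :
    Measurable fun s => projBall (c s) r (x s) := by
  have hxc : Measurable fun s => x s - c s := hx.sub hc
  unfold projBall
  exact Measurable.ite (measurableSet_le hxc.norm measurable_const) hx
    (hc.add ((hxc.norm.const_div r).smul hxc))

namespace Play

variable {d K : ℕ} {Ω : Type*} (W : Play d K Ω)

/-! ### The information available to the player -/

theorem hist_mono : Monotone W.hist := fun s t hst =>
  biSup_mono fun i hi => by
    rw [Finset.mem_Icc] at hi ⊢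
    omega

theorem draws_mono (τ : ℕ) : Monotone (W.draws τ) := fun _ _ hst =>
  biSup_mono fun _ hi => ⟨hi.1, hi.2.trans_le hst⟩

theorem pre_mono (τ : ℕ) : Monotone (W.pre τ) := fun _ _ hst =>
  sup_le_sup (W.hist_mono (Nat.sub_le_sub_right hst 1)) (W.draws_mono τ hst)

theorem comap_le_hist {s t : ℕ} (h1 : 1 ≤ s) (h2 : s ≤ t) :
    MeasurableSpace.comap (W.ctx s) inferInstance ⊔ MeasurableSpace.comap (W.arm s) inferInstance
      ⊔ MeasurableSpace.comap (W.Y s) inferInstance ≤ W.hist t :=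
  le_iSup₂_of_le s (Finset.mem_Icc.mpr ⟨h1, h2⟩) le_rfl

theorem measurable_ctx_hist {s t : ℕ} (h1 : 1 ≤ s) (h2 : s ≤ t) : Measurable[W.hist t] (W.ctx s) :=
  Measurable.of_comap_le ((le_sup_left.trans le_sup_left).trans (W.comap_le_hist h1 h2))

theorem measurable_arm_hist {s t : ℕ} (h1 : 1 ≤ s) (h2 : s ≤ t) : Measurable[W.hist t] (W.arm s) :=
  Measurable.of_comap_le ((le_sup_right.trans le_sup_left).trans (W.comap_le_hist h1 h2))

theorem measurable_Y_hist {s t : ℕ} (h1 : 1 ≤ s) (h2 : s ≤ t) : Measurable[W.hist t] (W.Y s) :=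
  Measurable.of_comap_le (le_sup_right.trans (W.comap_le_hist h1 h2))

theorem measurable_X_hist {s t : ℕ} (h1 : 1 ≤ s) (h2 : s ≤ t) : Measurable[W.hist t] (W.X s) :=
  measurable_eval_fin (W.measurable_ctx_hist h1 h2) (W.measurable_arm_hist h1 h2)

theorem measurable_Z_pre {τ i t : ℕ} (h1 : 1 ≤ i) (h2 : i * τ < t) :
    Measurable[W.pre τ t] (W.Z i) :=
  Measurable.of_comap_le (le_trans (le_iSup₂_of_le (f := fun i
    (_ : i ∈ {i : ℕ | 1 ≤ i ∧ i * τ < t}) => MeasurableSpace.comap (W.Z i) inferInstance)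
      i ⟨h1, h2⟩ le_rfl) le_sup_right)

theorem hist_le_pre {τ s t : ℕ} (hst : s < t) : W.hist s ≤ W.pre τ t :=
  (W.hist_mono (by omega)).trans le_sup_left

theorem measurable_ctx_preArm (τ t : ℕ) : Measurable[W.preArm τ t] (W.ctx t) :=
  Measurable.of_comap_le le_sup_right

theorem measurable_ctx_preReward (τ t : ℕ) : Measurable[W.preReward τ t] (W.ctx t) :=
  Measurable.of_comap_le (le_sup_right.trans le_sup_left)

theorem measurable_arm_preReward (τ t : ℕ) : Measurable[W.preReward τ t] (W.arm t) :=
  Measurable.of_comap_le le_sup_right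

theorem measurable_X_preReward (τ t : ℕ) : Measurable[W.preReward τ t] (W.X t) :=
  measurable_eval_fin (W.measurable_ctx_preReward τ t) (W.measurable_arm_preReward τ t)

theorem pre_le_preArm (τ t : ℕ) : W.pre τ t ≤ W.preArm τ t := le_sup_left

theorem pre_le_preReward (τ t : ℕ) : W.pre τ t ≤ W.preReward τ t :=
  (W.pre_le_preArm τ t).trans le_sup_left

/-- The noise `ε_t = Y_t - μ(X_tᵀ θ*)`. -/
def noise (B : GLBandit d K) (t : ℕ) (ω : Ω) : ℝ := W.Y t ω - B.μ (inner ℝ (W.X t ω) B.θstar)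

theorem measurable_noise_hist (B : GLBandit d K) {s t : ℕ} (h1 : 1 ≤ s) (h2 : s ≤ t) :
    Measurable[W.hist t] (W.noise B s) :=
  (W.measurable_Y_hist h1 h2).sub (B.continuous_μ.measurable.comp
    ((W.measurable_X_hist h1 h2).inner measurable_const))

theorem measurable_gradLoss (B : GLBandit d K) {j n : ℕ} (hjn : j * τ ≤ n)
    {θ : Ω → Feat d} (hθ : Measurable[W.hist n] θ) :
    Measurable[W.hist n] fun ω => W.gradLoss B.μ τ j ω (θ ω) := by
  unfold Play.gradLoss
  refine Finset.measurable_fun_sum _ fun s hs => ?_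
  rw [Finset.mem_Icc] at hs
  have hX := W.measurable_X_hist (s := s) (t := n) (by omega) (by omega)
  have hY := W.measurable_Y_hist (s := s) (t := n) (by omega) (by omega)
  exact ((hY.smul hX).neg).add ((B.continuous_μ.measurable.comp (hX.inner hθ)).smul hX)

end Play

/-! ### The law of a uniformly chosen feature -/

namespace GLBandit

variable {d K : ℕ} (B : GLBandit d K)

/-- The law of the feature vector of a uniformly chosen arm. -/
def unif : Measure (Feat d) := (K : ℝ≥0∞)⁻¹ • ∑ a : Fin K, B.ν.map fun x => x a

theorem lintegral_unif {f : Feat d → ℝ≥0∞} (hf : Measurable f) :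
    ∫⁻ y, f y ∂B.unif = (K : ℝ≥0∞)⁻¹ * ∑ a : Fin K, ∫⁻ x, f (x a) ∂B.ν := by
  rw [unif, lintegral_smul_measure, lintegral_finsetSum_measure, smul_eq_mul]
  congr 1
  exact Finset.sum_congr rfl fun a _ => lintegral_map hf (measurable_feat_apply a)

instance : IsProbabilityMeasure B.unif := by
  constructor
  have hK : (K : ℝ≥0∞) ≠ 0 := by exact_mod_cast B.K_pos.ne'
  rw [← lintegral_one, B.lintegral_unif measurable_const]
  simp [ENNReal.inv_mul_cancel hK]

theorem ae_unif_norm_le : ∀ᵐ y ∂B.unif, ‖y‖ ≤ 1 := by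
  refine Measure.ae_smul_measure ?_ _
  rw [← Measure.sum_fintype, Measure.ae_sum_iff]
  intro a
  rw [ae_map_iff (measurable_feat_apply a).aemeasurable
    (measurableSet_le (by fun_prop) measurable_const)]
  exact B.ae_norm_le a

theorem integral_unif_sq (v : Feat d) :
    ∫ y, (inner ℝ v y) ^ 2 ∂B.unif = (K : ℝ)⁻¹ * ∑ a, ∫ x, (inner ℝ v (x a)) ^ 2 ∂B.ν := by
  rw [unif, integral_smul_measure, integral_finsetSum_measure]
  · simp only [ENNReal.toReal_inv, ENNReal.toReal_natCast, smul_eq_mul]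
    congr 1
    refine Finset.sum_congr rfl fun a _ => ?_
    rw [integral_map (measurable_feat_apply a).aemeasurable (by fun_prop)]
  · intro a _
    rw [integrable_map_measure (by fun_prop) (measurable_feat_apply a).aemeasurable]
    refine Integrable.of_bound (C := ‖v‖ ^ 2) (Measurable.aestronglyMeasurable ?_) ?_
    · exact ((measurable_const.inner measurable_id).pow_const 2).comp (measurable_feat_apply a)
    filter_upwards [B.ae_norm_le a] with x hx
    simp only [Function.comp, norm_pow, Real.norm_eq_abs]
    gcongr
    exact (abs_real_inner_le_norm _ _).trans (mul_le_of_le_one_right (norm_nonneg _) hx)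

end GLBandit

/-! ### Conditional laws of the noise and of the first-block features -/

namespace Play.IsSGDTS

variable {d K T τ : ℕ} {α : ℝ} {Ω : Type*} [mΩ : MeasurableSpace Ω] {W : Play d K Ω}
  {B : GLBandit d K} {P : Measure Ω}

theorem measurable_X (h : W.IsSGDTS B T τ α P) (t : ℕ) : Measurable (W.X t) :=
  measurable_eval_fin (h.ctx_measurable t) (h.arm_measurable t)

theorem measurable_Y (h : W.IsSGDTS B T τ α P) (t : ℕ) : Measurable (W.Y t) :=
  measurable_eval_fin (f := fun ω a => W.rew t a ω)
    (measurable_pi_lambda _ fun a => h.rew_measurable t a) (h.arm_measurable t)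

theorem hist_le (h : W.IsSGDTS B T τ α P) (t : ℕ) : W.hist t ≤ mΩ :=
  iSup₂_le fun s _ => sup_le (sup_le (h.ctx_measurable s).comap_le (h.arm_measurable s).comap_le)
    (h.measurable_Y s).comap_le

theorem draws_le (h : W.IsSGDTS B T τ α P) (t : ℕ) : W.draws τ t ≤ mΩ :=
  iSup₂_le fun i _ => (h.Z_measurable i).comap_le

theorem pre_le (h : W.IsSGDTS B T τ α P) (t : ℕ) : W.pre τ t ≤ mΩ :=
  sup_le (h.hist_le _) (h.draws_le t)

theorem preArm_le (h : W.IsSGDTS B T τ α P) (t : ℕ) : W.preArm τ t ≤ mΩ :=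
  sup_le (h.pre_le t) (h.ctx_measurable t).comap_le

theorem preReward_le (h : W.IsSGDTS B T τ α P) (t : ℕ) : W.preReward τ t ≤ mΩ :=
  sup_le (h.preArm_le t) (h.arm_measurable t).comap_le

theorem measurable_noise (h : W.IsSGDTS B T τ α P) (t : ℕ) : Measurable (W.noise B t) :=
  (h.measurable_Y t).sub (B.continuous_μ.measurable.comp
    ((h.measurable_X t).inner measurable_const))

theorem ae_ctx_norm_le (h : W.IsSGDTS B T τ α P) {t : ℕ} (h1 : 1 ≤ t) (h2 : t ≤ T) :
    ∀ᵐ ω ∂P, ∀ a, ‖W.ctx t ω a‖ ≤ 1 := by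
  have := B.norm_le
  rw [← h.ctx_law t h1 h2] at this
  exact ae_of_ae_map (h.ctx_measurable t).aemeasurable this

theorem ae_X_norm_le (h : W.IsSGDTS B T τ α P) {t : ℕ} (h1 : 1 ≤ t) (h2 : t ≤ T) :
    ∀ᵐ ω ∂P, ‖W.X t ω‖ ≤ 1 := by
  filter_upwards [h.ae_ctx_norm_le h1 h2] with ω hω using hω _

theorem abs_noise_le (h : W.IsSGDTS B T τ α P) {t : ℕ} (h1 : 1 ≤ t) (h2 : t ≤ T) (ω : Ω) :
    |W.noise B t ω| ≤ 1 := by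
  have hy := h.rew_mem t h1 h2 (W.arm t ω) ω
  have hμ := B.μ_mem (inner ℝ (W.X t ω) B.θstar)
  rw [abs_le]
  constructor <;> simp only [Play.noise, Play.Y] <;> linarith [hy.1, hy.2, hμ.1, hμ.2]

/-- Split the noise according to the pulled arm: the event that arm `a` is pulled belongs to the
conditioning σ-algebra, so its indicator comes out and the mean assumption applies to each fixed
arm. -/
theorem condExp_noise [IsProbabilityMeasure P] (h : W.IsSGDTS B T τ α P) {t : ℕ} (h1 : 1 ≤ t)
    (h2 : t ≤ T) : P[W.noise B t | W.preReward τ t] =ᵐ[P] 0 := by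
  let f : Fin K → Ω → ℝ := fun a ω => W.rew t a ω - B.μ (inner ℝ (W.ctx t ω a) B.θstar)
  have hm := h.preReward_le t
  have hμm : ∀ a, Measurable[W.preReward τ t] fun ω => B.μ (inner ℝ (W.ctx t ω a) B.θstar) :=
    fun a => B.continuous_μ.measurable.comp
      (((measurable_feat_apply a).comp (W.measurable_ctx_preReward τ t)).inner measurable_const)
  have hr : ∀ a, Integrable (W.rew t a) P := fun a =>
    Integrable.of_bound (C := 1) (h.rew_measurable t a).aestronglyMeasurable
      (ae_of_all _ fun ω => by
      have := h.rew_mem t h1 h2 a ω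
      rw [Real.norm_of_nonneg this.1]; exact this.2)
  have hμi : ∀ a, Integrable (fun ω => B.μ (inner ℝ (W.ctx t ω a) B.θstar)) P := fun a =>
    Integrable.of_bound (C := 1) ((hμm a).mono hm le_rfl).aestronglyMeasurable
      (ae_of_all _ fun ω => by
        have := B.μ_mem (inner ℝ (W.ctx t ω a) B.θstar)
        rw [Real.norm_of_nonneg this.1]; exact this.2)
  have hfi : ∀ a, Integrable (f a) P := fun a => (hr a).sub (hμi a)
  have hA : ∀ a, MeasurableSet[W.preReward τ t] (W.arm t ⁻¹' {a}) := fun a =>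
    W.measurable_arm_preReward τ t (measurableSet_singleton a)
  have hsum : W.noise B t = ∑ a, (W.arm t ⁻¹' {a}).indicator (f a) := by
    ext ω
    rw [Finset.sum_apply, Finset.sum_eq_single (W.arm t ω)]
    · simp [f, Play.noise, Play.Y, Play.X]
    · intro a _ ha
      exact Set.indicator_of_notMem (fun hmem => ha hmem.symm) _
    · simp
  have hzero : ∀ a, P[(W.arm t ⁻¹' {a}).indicator (f a) | W.preReward τ t] =ᵐ[P] 0 := by
    intro a
    have e1 := condExp_indicator (m := W.preReward τ t) (hfi a) (hA a)
    have e2 := condExp_sub (hr a) (hμi a) (W.preReward τ t)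
    have e3 := h.rew_mean t h1 h2 a
    have e4 := condExp_of_stronglyMeasurable hm (hμm a).stronglyMeasurable (hμi a)
    filter_upwards [e1, e2, e3] with ω w1 w2 w3
    rw [w1]
    by_cases hω : ω ∈ W.arm t ⁻¹' {a}
    · rw [Set.indicator_of_mem hω]
      have : (P[f a | W.preReward τ t]) ω = _ := w2
      rw [this, Pi.sub_apply, w3, e4]
      simp
    · rw [Set.indicator_of_notMem hω]; rfl
  rw [hsum]
  have e := condExp_finsetSum (s := Finset.univ) (m := W.preReward τ t)
    (f := fun a => (W.arm t ⁻¹' {a}).indicator (f a))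
    (fun a _ => (hfi a).indicator (hm _ (hA a)))
  refine e.trans ?_
  have : ∀ᵐ ω ∂P, ∀ a, P[(W.arm t ⁻¹' {a}).indicator (f a) | W.preReward τ t] ω = 0 := by
    rw [ae_all_iff]; exact hzero
  filter_upwards [this] with ω hω
  simp [Finset.sum_apply, hω]

/-- Exponential moments of the noise with a predictable multiplier, from boundedness. -/
theorem condLeOne_noise_bounded [IsProbabilityMeasure P] (h : W.IsSGDTS B T τ α P) {t : ℕ}
    (h1 : 1 ≤ t) (h2 : t ≤ T) {l : Ω → ℝ} (hl : Measurable[W.preReward τ t] l) :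
    CondLeOne (W.preReward τ t) P fun ω =>
      ENNReal.ofReal (Real.exp (l ω * W.noise B t ω - l ω ^ 2)) :=
  CondLeOne.exp_mul_sub_of_centered (h.preReward_le t) (h.measurable_noise t)
    (h.abs_noise_le h1 h2) (h.condExp_noise h1 h2) hl

/-- Exponential moments of the noise with a predictable multiplier, from sub-Gaussianity. -/
theorem condLeOne_noise_subG [IsProbabilityMeasure P] (h : W.IsSGDTS B T τ α P) {t : ℕ}
    (h1 : 1 ≤ t) (h2 : t ≤ T) {l : Ω → ℝ} (hl : Measurable[W.preReward τ t] l) :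
    CondLeOne (W.preReward τ t) P fun ω =>
      ENNReal.ofReal (Real.exp (l ω * W.noise B t ω - B.R ^ 2 / 2 * l ω ^ 2)) := by
  have hm := h.preReward_le t
  refine CondLeOne.exp_mul_sub hm (h.measurable_noise t) (fun l A hA => ?_) hl
  have hε := h.measurable_noise t
  have h_integrable : Integrable (fun ω => Real.exp (l * W.noise B t ω)) P :=
    Integrable.of_bound (C := Real.exp |l|) (by fun_prop) (ae_of_all _ fun ω => by
      rw [Real.norm_of_nonneg (Real.exp_pos _).le, Real.exp_le_exp]
      calc l * W.noise B t ω ≤ |l * W.noise B t ω| := le_abs_self _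
        _ = |l| * |W.noise B t ω| := abs_mul _ _
        _ ≤ |l| := mul_le_of_le_one_right (abs_nonneg _) (h.abs_noise_le h1 h2 ω))
  have hle : ∫ ω in A, Real.exp (l * W.noise B t ω) ∂P
      ≤ ∫ _ in A, Real.exp (l ^ 2 * B.R ^ 2 / 2) ∂P := by
    rw [← setIntegral_condExp hm h_integrable hA]
    exact setIntegral_mono_ae integrable_condExp.integrableOn
      (integrable_const _).integrableOn (h.noise_subG t h1 h2 l)
  have hsplit : ∀ ω, Real.exp (l * W.noise B t ω - B.R ^ 2 / 2 * l ^ 2)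
      = Real.exp (-(l ^ 2 * B.R ^ 2 / 2)) * Real.exp (l * W.noise B t ω) := fun ω => by
    rw [← Real.exp_add]; ring_nf
  simp_rw [hsplit]
  rw [← ofReal_integral_eq_lintegral_ofReal (h_integrable.const_mul _).integrableOn
    (ae_of_all _ fun ω => by positivity), integral_const_mul]
  calc _ ≤ ENNReal.ofReal (Real.exp (-(l ^ 2 * B.R ^ 2 / 2))
        * ∫ _ in A, Real.exp (l ^ 2 * B.R ^ 2 / 2) ∂P) :=
        ENNReal.ofReal_le_ofReal (by gcongr)
    _ = P A := by
        rw [setIntegral_const, smul_eq_mul, mul_left_comm, ← Real.exp_add]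
        simp [Measure.real]

/-- In the first block the feature vector of the pulled arm is independent of the past. -/
theorem lintegral_mul_X_first_block [IsProbabilityMeasure P] (h : W.IsSGDTS B T τ α P) {t : ℕ}
    (h1 : 1 ≤ t) (h2 : t ≤ T) (h3 : t ≤ τ) {f : Feat d → ℝ≥0∞} (hf : Measurable f)
    {V : Ω → ℝ≥0∞} (hV : Measurable[W.pre τ t] V) :
    ∫⁻ ω, V ω * f (W.X t ω) ∂P = ∫⁻ ω, V ω * ∫⁻ y, f y ∂B.unif ∂P := by
  have hK : (K : ℝ≥0∞) ≠ 0 := by exact_mod_cast B.K_pos.ne'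
  have hsum : ∀ ω, V ω * f (W.X t ω)
      = ∑ a, (V ω * f (W.ctx t ω a)) * (W.arm t ⁻¹' {a}).indicator 1 ω := by
    intro ω
    rw [Finset.sum_eq_single (W.arm t ω)]
    · simp [Play.X]
    · intro a _ ha
      rw [Set.indicator_of_notMem (fun hmem => ha hmem.symm), mul_zero]
    · simp
  have hV0 := hV.mono (h.pre_le t) le_rfl
  have hfc : ∀ a, Measurable fun ω => f (W.ctx t ω a) := fun a =>
    hf.comp ((measurable_feat_apply a).comp (h.ctx_measurable t))
  have harm : ∀ a, MeasurableSet (W.arm t ⁻¹' {a}) := fun a =>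
    h.arm_measurable t (measurableSet_singleton a)
  -- Two factorizations: the arm is independent of the past together with the context, and the
  -- context is independent of the past.
  have hterm : ∀ a, ∫⁻ ω, (V ω * f (W.ctx t ω a)) * (W.arm t ⁻¹' {a}).indicator 1 ω ∂P
      = (∫⁻ ω, V ω ∂P) * ((K : ℝ≥0∞)⁻¹ * ∫⁻ x, f (x a) ∂B.ν) := by
    intro a
    rw [lintegral_mul_eq_lintegral_mul_lintegral_of_independent_measurableSpace
      (h.preArm_le t) (h.arm_measurable t).comap_le (h.arm_indep t h1 h2 h3).symm
      (f := fun ω => V ω * f (W.ctx t ω a)) (g := (W.arm t ⁻¹' {a}).indicator 1)]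
    · rw [lintegral_mul_eq_lintegral_mul_lintegral_of_independent_measurableSpace
        (h.pre_le t) (h.ctx_measurable t).comap_le (h.ctx_indep t h1 h2).symm
        (f := V) (g := fun ω => f (W.ctx t ω a)) hV]
      · have hfa : Measurable fun x : Fin K → Feat d => f (x a) :=
          hf.comp (measurable_feat_apply a)
        have e1 : ∫⁻ ω, f (W.ctx t ω a) ∂P = ∫⁻ x, f (x a) ∂B.ν := by
          rw [← h.ctx_law t h1 h2, lintegral_map hfa (h.ctx_measurable t)]
        have e2 : ∫⁻ ω, (W.arm t ⁻¹' {a}).indicator 1 ω ∂P = (K : ℝ≥0∞)⁻¹ := by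
          rw [lintegral_indicator_one (harm a)]
          have := h.arm_uniform t h1 h2 h3 a
          rw [← ofReal_measureReal, this, one_div, ENNReal.ofReal_inv_of_pos
            (by exact_mod_cast B.K_pos), ENNReal.ofReal_natCast]
        rw [e1, e2]; ring
      · exact hf.comp ((measurable_feat_apply a).comp (comap_measurable _))
    · exact (hV.mono (W.pre_le_preArm τ t) le_rfl).mul
        (hf.comp ((measurable_feat_apply a).comp (W.measurable_ctx_preArm τ t)))
    · exact measurable_const.indicator ⟨{a}, measurableSet_singleton a, rfl⟩
  simp_rw [hsum]
  rw [lintegral_finsetSum]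
  · simp_rw [hterm]
    rw [lintegral_mul_const _ hV0, B.lintegral_unif hf, ← Finset.mul_sum, ← Finset.mul_sum]
  · exact fun a _ => (hV0.mul (hfc a)).mul (measurable_const.indicator (harm a))

/-- Iterate `j` uses blocks `1` to `j`, but also the estimate at the centre of the projection ball,
so `τ ≤ n` is needed even for `j = 0`. -/
theorem measurable_sgd (h : W.IsSGDTS B T τ α P) (hτ : τ ≤ T) {n : ℕ} (hn : τ ≤ n) (j : ℕ)
    (hjn : j * τ ≤ n) : Measurable[W.hist n] (W.sgd B.μ τ α j) := by
  have hmle : Measurable[W.hist n] W.mle := (h.mle_measurable hτ).mono (W.hist_mono hn) le_rfl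
  induction j with
  | zero => exact hmle
  | succ j ih =>
    have ih' := ih (le_trans (by gcongr; omega) hjn)
    have hg := W.measurable_gradLoss B hjn ih'
    have hs : Measurable[W.hist n] fun ω => (1 / (α * ((j + 1 : ℕ) : ℝ)))
        • W.gradLoss B.μ τ (j + 1) ω (W.sgd B.μ τ α j ω) :=
      hg.fun_const_smul (1 / (α * ((j + 1 : ℕ) : ℝ)))
    exact measurable_projBall 2 hmle (ih'.sub hs)

theorem measurable_sgdAvg (h : W.IsSGDTS B T τ α P) (hτ : τ ≤ T) {n : ℕ} (hn : τ ≤ n) (j : ℕ)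
    (hjn : j * τ ≤ n) : Measurable[W.hist n] (W.sgdAvg B.μ τ α j) := by
  unfold Play.sgdAvg
  refine (Finset.measurable_fun_sum _ fun q hq => ?_).const_smul (1 / (j : ℝ))
  rw [Finset.mem_Icc] at hq
  exact h.measurable_sgd hτ hn q (le_trans (by gcongr; omega) hjn)

end Play.IsSGDTS

/-! ### Linear images of the standard Gaussian vector -/

theorem stdGaussian_map_inner {d : ℕ} (w : Feat d) :
    (stdGaussian (Feat d)).map (fun z => inner ℝ w z) = gaussianReal 0 (‖w‖ ^ 2).toNNReal := by
  have h := IsGaussian.map_eq_gaussianReal (μ := stdGaussian (Feat d)) (innerSL ℝ w)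
  rw [integral_strongDual_stdGaussian, variance_dual_stdGaussian, innerSL_apply_norm] at h
  exact h

theorem stdGaussian_inner_eq {d : ℕ} {w : Feat d} (hw : w ≠ 0) (c : ℝ) :
    stdGaussian (Feat d) {z | inner ℝ w z = c} = 0 := by
  have hv : (‖w‖ ^ 2).toNNReal ≠ 0 := by
    have : 0 < ‖w‖ := norm_pos_iff.mpr hw
    rw [Ne, Real.toNNReal_eq_zero, not_le]; positivity
  have := nullSingletonClass_gaussianReal (μ := 0) hv
  have h0 : gaussianReal 0 (‖w‖ ^ 2).toNNReal {c} = 0 := measure_singleton c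
  rw [← stdGaussian_map_inner, Measure.map_apply (by fun_prop) (measurableSet_singleton c)] at h0
  exact h0

theorem stdGaussian_inner_ge_le {d : ℕ} {w : Feat d} (hw : ‖w‖ ≤ 1) {u : ℝ} (hu : 0 ≤ u) :
    stdGaussian (Feat d) {z | u ≤ inner ℝ w z} ≤ ENNReal.ofReal (Real.exp (-u ^ 2 / 2)) := by
  have h1 := measure_ge_le_exp_mul_mgf (μ := gaussianReal 0 (‖w‖ ^ 2).toNNReal) (X := id) (t := u)
    u hu (integrable_exp_mul_gaussianReal u)
  rw [mgf_id_gaussianReal] at h1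
  have h2 : stdGaussian (Feat d) {z | u ≤ inner ℝ w z}
      = gaussianReal 0 (‖w‖ ^ 2).toNNReal {x | u ≤ id x} := by
    rw [← stdGaussian_map_inner, Measure.map_apply (by fun_prop)
      (measurableSet_le measurable_const measurable_id)]
    rfl
  rw [h2, ← ofReal_measureReal]
  refine ENNReal.ofReal_le_ofReal (h1.trans ?_)
  rw [← Real.exp_add, Real.exp_le_exp, Real.coe_toNNReal _ (by positivity)]
  have : ‖w‖ ^ 2 ≤ 1 := pow_le_one₀ (norm_nonneg _) hw
  nlinarith [sq_nonneg u]

/-- Two arms with different features have the same score under `θ`. -/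
def tieSet (d K : ℕ) : Set (Feat d × (Fin K → Feat d)) :=
  {q | ∃ a b, q.2 a ≠ q.2 b ∧ inner ℝ (q.2 a - q.2 b) q.1 = 0}

theorem measurableSet_tieSet (d K : ℕ) : MeasurableSet (tieSet d K) := by
  have : tieSet d K = ⋃ a, ⋃ b, {q : Feat d × (Fin K → Feat d) | q.2 a = q.2 b}ᶜ
      ∩ {q | inner ℝ (q.2 a - q.2 b) q.1 = 0} := by
    ext q; simp [tieSet]
  rw [this]
  have hm : ∀ a, Measurable fun q : Feat d × (Fin K → Feat d) => q.2 a := fun a =>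
    (measurable_feat_apply a).comp measurable_snd
  refine MeasurableSet.iUnion fun a => MeasurableSet.iUnion fun b => MeasurableSet.inter ?_ ?_
  · exact (measurableSet_eq_fun (hm a) (hm b)).compl
  · exact measurableSet_eq_fun (((hm a).sub (hm b)).inner measurable_fst) measurable_const

theorem measurable_measure_tie {d K : ℕ} (ν : Measure (Fin K → Feat d)) [IsProbabilityMeasure ν]
    (s : ℝ) : Measurable (Function.uncurry fun (c z : Feat d) =>
      ν {x | (c + s • z, x) ∈ tieSet d K}) := by
  have hT : MeasurableSet {q : (Feat d × Feat d) × (Fin K → Feat d) |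
      (q.1.1 + s • q.1.2, q.2) ∈ tieSet d K} := (measurableSet_tieSet d K).preimage (by fun_prop)
  exact measurable_measure_prodMk_left hT

/-- For a fixed context the tied `z` lie in finitely many affine hyperplanes, each null for the
Gaussian; Tonelli exchanges the two integrals. -/
theorem lintegral_tie_eq_zero {d K : ℕ} (ν : Measure (Fin K → Feat d)) [IsProbabilityMeasure ν]
    (c : Feat d) {s : ℝ} (hs : s ≠ 0) :
    ∫⁻ z, ν {x | (c + s • z, x) ∈ tieSet d K} ∂(stdGaussian (Feat d)) = 0 := by
  have hT : MeasurableSet {q : Feat d × (Fin K → Feat d) | (c + s • q.1, q.2) ∈ tieSet d K} :=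
    (measurableSet_tieSet d K).preimage (by fun_prop)
  have h1 := Measure.prod_apply (μ := stdGaussian (Feat d)) (ν := ν) hT
  have h2 := Measure.prod_apply_symm (μ := stdGaussian (Feat d)) (ν := ν) hT
  have h3 : ∀ x, stdGaussian (Feat d) ((fun z => (z, x)) ⁻¹'
      {q : Feat d × (Fin K → Feat d) | (c + s • q.1, q.2) ∈ tieSet d K}) = 0 := by
    intro x
    have hsub : (fun z => (z, x)) ⁻¹' {q : Feat d × (Fin K → Feat d) |
        (c + s • q.1, q.2) ∈ tieSet d K} ⊆ ⋃ a, ⋃ b, {z | x a ≠ x b ∧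
          inner ℝ (x a - x b) z = -(inner ℝ (x a - x b) c) / s} := by
      rintro z ⟨a, b, hab, hz⟩
      refine Set.mem_iUnion₂.mpr ⟨a, b, hab, ?_⟩
      simp only [inner_add_right, real_inner_smul_right] at hz
      rw [eq_div_iff hs]; linarith
    refine measure_mono_null hsub (measure_iUnion_null fun a => measure_iUnion_null fun b => ?_)
    by_cases hab : x a = x b
    · simp [hab]
    · exact measure_mono_null (fun z hz => hz.2) (stdGaussian_inner_eq (sub_ne_zero.mpr hab) _)
  rw [h2] at h1
  simp_rw [h3, lintegral_zero] at h1
  exact h1.symm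

/-! ### Exponential moments of the features of optimal arms -/

namespace GLBandit

variable {d K : ℕ} (B : GLBandit d K)

/-- The contexts in which arm `a` is optimal for `θ`. -/
def optSet (θ : Feat d) (a : Fin K) : Set (Fin K → Feat d) :=
  {y | ∀ b, inner ℝ (y b) θ ≤ inner ℝ (y a) θ}

/-- The largest value of `exp (-(vᵀx_a)² / 16)` over the arms `a` that are optimal for `θ`. -/
def worstExp (v θ : Feat d) (x : Fin K → Feat d) : ℝ≥0∞ :=
  ⨆ a, (optSet θ a).indicator
    (fun y => ENNReal.ofReal (Real.exp (-(1 / 16) * (inner ℝ v (y a)) ^ 2))) x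

theorem measurable_worstExp (v : Feat d) :
    Measurable (Function.uncurry (worstExp (d := d) (K := K) v)) := by
  have hm : ∀ a, Measurable fun q : Feat d × (Fin K → Feat d) => q.2 a := fun a =>
    (measurable_feat_apply a).comp measurable_snd
  refine Measurable.iSup fun a => ?_
  have hA : MeasurableSet {q : Feat d × (Fin K → Feat d) |
      ∀ b, inner ℝ (q.2 b) q.1 ≤ inner ℝ (q.2 a) q.1} := by
    simp only [Set.ofPred_forall]
    exact MeasurableSet.iInter fun b =>
      measurableSet_le ((hm b).inner measurable_fst) ((hm a).inner measurable_fst)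
  have hf : Measurable fun q : Feat d × (Fin K → Feat d) =>
      ENNReal.ofReal (Real.exp (-(1 / 16) * (inner ℝ v (q.2 a)) ^ 2)) :=
    ENNReal.measurable_ofReal.comp (Real.measurable_exp.comp
      (((measurable_const.inner (hm a)).pow_const 2).const_mul _))
  exact hf.indicator hA

/-- Among several maximizers the player may choose in any way, so the pulled arm need not be a
function of `(θ, x)`; the supremum `worstExp` is one. Without ties all optimal arms carry the same
feature as `best θ x`, and the supremum reduces to the quantity controlled by `λ_f`. -/
theorem lintegral_worstExp_le {v θ : Feat d} (hv : ‖v‖ ≤ 1)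
    (hθ : B.ν {x | (θ, x) ∈ tieSet d K} = 0) :
    ∫⁻ x, worstExp v θ x ∂B.ν
      ≤ ENNReal.ofReal (Real.exp (-(31 / 512) * (lambdaF B.ν B.best * ‖v‖ ^ 2))) := by
  have hθ' : ∀ᵐ x ∂B.ν, (θ, x) ∉ tieSet d K := by
    rw [ae_iff]; simpa using hθ
  calc _ ≤ ∫⁻ x, ENNReal.ofReal (Real.exp (-(1 / 16) * (inner ℝ v (x (B.best θ x))) ^ 2)) ∂B.ν := by
        refine lintegral_mono_ae ?_
        filter_upwards [hθ'] with x hx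
        refine iSup_le fun a => ?_
        by_cases ha : x ∈ optSet θ a
        · rw [Set.indicator_of_mem ha]
          have hEq : x a = x (B.best θ x) := by
            by_contra hne
            refine hx ⟨a, B.best θ x, hne, ?_⟩
            have h1 := ha (B.best θ x)
            have h2 := B.best_max θ x a
            rw [real_inner_comm, real_inner_comm (x (B.best θ x))] at h2
            simp only [inner_sub_left]
            linarith
          rw [hEq]
        · rw [Set.indicator_of_notMem ha]; exact zero_le
    _ ≤ _ := by
        have hz : Measurable fun x : Fin K → Feat d => (inner ℝ v (x (B.best θ x))) ^ 2 :=
          (measurable_const.inner (B.measurable_best θ)).pow_const 2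
        have hle := B.lambdaF_mul_le θ v
        refine lintegral_exp_neg_sq_le hz ?_ hle
        filter_upwards [B.norm_le] with x hx
        exact ⟨sq_nonneg _, sq_inner_le_one hv (hx _)⟩

end GLBandit

/-! ### Conditional second moments along a play -/

namespace Play.IsSGDTS

variable {d K T τ : ℕ} {α : ℝ} {Ω : Type*} [mΩ : MeasurableSpace Ω] {W : Play d K Ω}
  {B : GLBandit d K} {P : Measure Ω}

theorem block_index {t : ℕ} (hτ : 0 < τ) (ht : τ < t) :
    1 ≤ (t - 1) / τ ∧ (t - 1) / τ * τ < t ∧ τ ≤ (t - 1) / τ * τ := by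
  have h1 : 1 ≤ (t - 1) / τ := (Nat.one_le_div_iff hτ).mpr (by omega)
  have h2 := Nat.div_mul_le_self (t - 1) τ
  exact ⟨h1, by omega, Nat.le_mul_of_pos_left τ h1⟩

theorem measurable_thetaTS_pre (h : W.IsSGDTS B T τ α P) (hτ0 : 0 < τ) (hτ : τ ≤ T) {t : ℕ}
    (ht : τ < t) : Measurable[W.pre τ t] (W.thetaTS B T τ α ((t - 1) / τ)) := by
  obtain ⟨h1, h2, h3⟩ := block_index hτ0 ht
  exact ((h.measurable_sgdAvg hτ h3 _ le_rfl).mono (W.hist_le_pre h2) le_rfl).add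
    ((W.measurable_Z_pre h1 h2).fun_const_smul _)

/-- The Gaussian vector is independent of the averaged iterate and enters with nonzero scale, so it
can be integrated out with the average frozen. -/
theorem ae_no_tie [IsProbabilityMeasure P] (h : W.IsSGDTS B T τ α P) (hτ : τ ≤ T) {j : ℕ}
    (hj : 1 ≤ j)
    (hjT : j * τ < T) (hv : 0 < B.params.tsVar T τ α j) :
    ∀ᵐ ω ∂P, B.ν {x | (W.thetaTS B T τ α j ω, x) ∈ tieSet d K} = 0 := by
  have hs0 : √(B.params.tsVar T τ α j) ≠ 0 := (Real.sqrt_pos.mpr hv).ne'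
  have hTS : ∀ ω, W.thetaTS B T τ α j ω
      = W.sgdAvg B.μ τ α j ω + √(B.params.tsVar T τ α j) • W.Z j ω := fun ω => rfl
  simp_rw [hTS]
  generalize √(B.params.tsVar T τ α j) = s at hs0
  have hmm : W.hist (j * τ) ⊔ W.draws τ (j * τ) ≤ mΩ := sup_le (h.hist_le _) (h.draws_le _)
  have hAvg : Measurable[W.hist (j * τ) ⊔ W.draws τ (j * τ)] (W.sgdAvg B.μ τ α j) :=
    (h.measurable_sgdAvg hτ (Nat.le_mul_of_pos_left τ hj) j le_rfl).mono le_sup_left le_rfl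
  generalize W.sgdAvg B.μ τ α j = A at hAvg
  have hH := measurable_measure_tie B.ν s
  have key := lintegral_mul_comp_of_indep hmm hAvg (h.Z_measurable j) (h.Z_indep j hj hjT) hH
    (W := fun _ => 1) measurable_const
  simp only [one_mul, h.Z_law j hj hjT, lintegral_tie_eq_zero B.ν _ hs0, lintegral_zero] at key
  have hmeas := hH.comp ((hAvg.mono hmm le_rfl).prodMk (h.Z_measurable j))
  exact (lintegral_eq_zero_iff hmeas).mp key

theorem inner_le_of_arm_max (h : W.IsSGDTS B T τ α P) {t : ℕ} (h1 : τ < t) (h2 : t ≤ T) (ω : Ω)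
    (a : Fin K) : inner ℝ (W.ctx t ω a) (W.thetaTS B T τ α ((t - 1) / τ) ω)
      ≤ inner ℝ (W.X t ω) (W.thetaTS B T τ α ((t - 1) / τ) ω) :=
  B.strictMono.le_iff_le.mp (h.arm_max t h1 h2 ω a)

/-- After the first block the conditional second moments of the feature vectors of the pulled arms
are at least `λ_f`. -/
theorem condLeOne_exp_neg_sq [IsProbabilityMeasure P] (h : W.IsSGDTS B T τ α P) (hτ0 : 0 < τ)
    (hτ : τ ≤ T)
    (hv : ∀ j, 1 ≤ j → 0 < B.params.tsVar T τ α j) {t : ℕ}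
    (ht : τ < t) (htT : t ≤ T) {v : Feat d} (hv1 : ‖v‖ ≤ 1) :
    CondLeOne (W.pre τ t) P fun ω => ENNReal.ofReal (Real.exp (-(1 / 16) *
      (inner ℝ v (W.X t ω)) ^ 2 + 31 / 512 * (lambdaF B.ν B.best * ‖v‖ ^ 2))) := by
  intro V hV
  obtain ⟨h1, h2, h3⟩ := block_index hτ0 ht
  set r := 31 / 512 * (lambdaF B.ν B.best * ‖v‖ ^ 2) with hr
  have hV0 := hV.mono (h.pre_le t) le_rfl
  have hθ := h.measurable_thetaTS_pre hτ0 hτ ht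
  have key := lintegral_mul_comp_of_indep (h.pre_le t) hθ (h.ctx_measurable t)
    (h.ctx_indep t (by omega) htT) (GLBandit.measurable_worstExp (K := K) v)
    (hV.mul_const (ENNReal.ofReal (Real.exp r)))
  rw [h.ctx_law t (by omega) htT] at key
  calc _ ≤ ∫⁻ ω, V ω * ENNReal.ofReal (Real.exp r)
        * GLBandit.worstExp v (W.thetaTS B T τ α ((t - 1) / τ) ω) (W.ctx t ω) ∂P := by
        refine lintegral_mono fun ω => ?_
        rw [mul_assoc]
        gcongr
        change ENNReal.ofReal (Real.exp (-(1 / 16) * (inner ℝ v (W.X t ω)) ^ 2 + r)) ≤ _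
        rw [add_comm, Real.exp_add, ENNReal.ofReal_mul (Real.exp_pos _).le]
        gcongr
        refine le_trans ?_ (le_iSup _ (W.arm t ω))
        have hmem : W.ctx t ω ∈ GLBandit.optSet (W.thetaTS B T τ α ((t - 1) / τ) ω) (W.arm t ω) :=
          fun b => h.inner_le_of_arm_max ht htT ω b
        rw [Set.indicator_of_mem hmem]
        exact le_rfl
    _ = _ := key
    _ ≤ ∫⁻ ω, V ω ∂P := by
        refine lintegral_mono_ae ?_
        filter_upwards [h.ae_no_tie hτ h1 (h2.trans_le htT) (hv _ h1)] with ω hω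
        have hle := B.lintegral_worstExp_le hv1 hω
        calc _ ≤ V ω * ENNReal.ofReal (Real.exp r)
              * ENNReal.ofReal (Real.exp (-(31 / 512) * (lambdaF B.ν B.best * ‖v‖ ^ 2))) := by
              gcongr
          _ = V ω := by
              rw [mul_assoc, ← ENNReal.ofReal_mul (Real.exp_pos _).le, ← Real.exp_add, hr]
              simp

/-- In the first block, the same for a linear image of the feature vectors. -/
theorem condLeOne_exp_neg_sq_first_block [IsProbabilityMeasure P] (h : W.IsSGDTS B T τ α P)
    {t : ℕ} (h1 : 1 ≤ t)
    (h2 : t ≤ T) (h3 : t ≤ τ) {v : Feat d} {r : ℝ} (hv1 : ‖v‖ ≤ 1)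
    (hr : r ≤ ∫ y, (inner ℝ v y) ^ 2 ∂B.unif) :
    CondLeOne (W.pre τ t) P fun ω => ENNReal.ofReal (Real.exp (-(1 / 16) *
      (inner ℝ v (W.X t ω)) ^ 2 + 31 / 512 * r)) := by
  intro V hV
  have hf : Measurable fun y : Feat d => ENNReal.ofReal (Real.exp (-(1 / 16) *
      (inner ℝ v y) ^ 2 + 31 / 512 * r)) := by fun_prop
  have key := h.lintegral_mul_X_first_block h1 h2 h3 hf hV
  rw [key]
  refine lintegral_mono fun ω => mul_le_of_le_one_right zero_le ?_
  have hz : Measurable fun y : Feat d => (inner ℝ v y) ^ 2 := by fun_prop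
  have hle := lintegral_exp_neg_sq_le hz (ν := B.unif) (by
    filter_upwards [B.ae_unif_norm_le] with y hy
    exact ⟨sq_nonneg _, GLBandit.sq_inner_le_one hv1 hy⟩) hr
  simp_rw [Real.exp_add, ENNReal.ofReal_mul (Real.exp_pos _).le]
  rw [lintegral_mul_const _ (by fun_prop)]
  calc _ ≤ ENNReal.ofReal (Real.exp (-(31 / 512) * r))
          * ENNReal.ofReal (Real.exp (31 / 512 * r)) := by
        gcongr
    _ = 1 := by rw [← ENNReal.ofReal_mul (Real.exp_pos _).le, ← Real.exp_add]; simp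

end Play.IsSGDTS

theorem CondLeOne.mono {Ω : Type*} {m m' : MeasurableSpace Ω} {_ : MeasurableSpace Ω}
    {P : Measure Ω} {e : Ω → ℝ≥0∞} (h : CondLeOne m' P e) (hle : m ≤ m') : CondLeOne m P e :=
  fun W hW => h W (hW.mono hle le_rfl)

theorem Finset.sum_Ico_blocks {M : Type*} [AddCommMonoid M] (f : ℕ → M) (τ : ℕ) {j : ℕ}
    (hj : 1 ≤ j) : ∑ s ∈ Finset.Ico (τ + 1) (j * τ + 1), f s
      = ∑ q ∈ Finset.Icc 2 j, ∑ s ∈ Finset.Icc ((q - 1) * τ + 1) (q * τ), f s := by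
  induction j, hj using Nat.le_induction with
  | base => simp
  | succ j hj ih =>
    rw [← Finset.sum_Ico_consecutive f (n := j * τ + 1)
      (by have := Nat.le_mul_of_pos_left τ hj; omega) (by gcongr; omega), ih,
      Finset.sum_Icc_succ_top (by omega), Nat.add_sub_cancel,
      Finset.Ico_add_one_right_eq_Icc (j * τ + 1)]

theorem inner_symm_comm {d : ℕ} {A : Feat d ≃L[ℝ] Feat d}
    (hA : ∀ u v, inner ℝ (A u) v = inner ℝ u (A v)) (u v : Feat d) :
    inner ℝ (A.symm u) v = inner ℝ u (A.symm v) := by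
  have := hA (A.symm u) (A.symm v)
  simpa using this.symm

namespace Play

variable {d K : ℕ} {Ω : Type*} (W : Play d K Ω)

theorem measurable_X_pre {τ s : ℕ} (h1 : 1 ≤ s) :
    Measurable[W.pre τ (s + 1)] (W.X s) :=
  (W.measurable_X_hist h1 le_rfl).mono (W.hist_le_pre (Nat.lt_succ_self s)) le_rfl

theorem measurable_noise_pre (B : GLBandit d K) {τ s : ℕ} (h1 : 1 ≤ s) :
    Measurable[W.pre τ (s + 1)] (W.noise B s) :=
  (W.measurable_noise_hist B h1 le_rfl).mono (W.hist_le_pre (Nat.lt_succ_self s)) le_rfl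

end Play

namespace Play.IsSGDTS

variable {d K T τ : ℕ} {α : ℝ} {Ω : Type*} [mΩ : MeasurableSpace Ω] {W : Play d K Ω}
  {B : GLBandit d K} {P : Measure Ω}

/-! ### High-probability events -/

theorem measure_not_block_moment_le [IsProbabilityMeasure P] (h : W.IsSGDTS B T τ α P)
    (hτ0 : 0 < τ) (hτ : τ ≤ T) (hv : ∀ j, 1 ≤ j → 0 < B.params.tsVar T τ α j) {q : ℕ}
    (hq : 2 ≤ q) (hqT : q * τ ≤ T) :
    P {ω | ¬ ∀ w : Feat d, 7 / 8 * (τ * lambdaF B.ν B.best) * ‖w‖ ^ 2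
        ≤ ∑ s ∈ Finset.Icc ((q - 1) * τ + 1) (q * τ), (inner ℝ w (W.X s ω)) ^ 2}
      ≤ ENNReal.ofReal (Real.exp (402 * d / lambdaF B.ν B.best
          - τ * lambdaF B.ν B.best / 1024)) := by
  obtain ⟨q, rfl⟩ : ∃ r, q = r + 1 := ⟨q - 1, by omega⟩
  have hqτ : τ ≤ q * τ := Nat.le_mul_of_pos_left τ (by omega)
  have hmul : (q + 1) * τ = q * τ + τ := by ring
  have hmain := measure_not_second_moment_le (P := P) (F := W.pre τ) (X := W.X)
    (a := q * τ + 1) (b := (q + 1) * τ + 1) (W.pre_mono τ) h.pre_le B.lambdaF_pos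
    B.lambdaF_le_one (fun s h1 _ => W.measurable_X_pre (by omega))
    (fun s h1 h2 => h.ae_X_norm_le (by omega) (by omega))
    (fun v hv1 s h1 h2 => h.condLeOne_exp_neg_sq hτ0 hτ hv (by omega) (by omega) hv1)
  have hn : (q + 1) * τ + 1 - (q * τ + 1) = τ := by omega
  rw [hn, Finset.Ico_add_one_right_eq_Icc] at hmain
  exact hmain

/-- The general bound is applied to `σ₀ A⁻¹ X`: this map is a contraction, so the vectors stay in
the unit ball, and their second moment is `σ₀²` times the identity. Evaluating at `A w` compares
empirical and true second moments in every direction, in the norm that also controls the noise. -/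
theorem measure_not_first_block_moment_le [IsProbabilityMeasure P] (h : W.IsSGDTS B T τ α P)
    (hτ : τ ≤ T) {A : Feat d ≃L[ℝ] Feat d}
    (hA : ∀ u v, inner ℝ (A u) v = inner ℝ u (A v))
    (hA2 : ∀ v, ‖A v‖ ^ 2 = ∫ y, (inner ℝ v y) ^ 2 ∂B.unif)
    (hA3 : ∀ v, B.σ₀ * ‖v‖ ≤ ‖A v‖) :
    P {ω | ¬ ∀ w : Feat d, 7 / 8 * τ * ‖A w‖ ^ 2
        ≤ ∑ s ∈ Finset.Icc 1 τ, (inner ℝ w (W.X s ω)) ^ 2}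
      ≤ ENNReal.ofReal (Real.exp (402 * d / B.σ₀ ^ 2 - τ * B.σ₀ ^ 2 / 1024)) := by
  have hσ := B.σ₀_pos
  have hsymm := inner_symm_comm hA
  have hnorm : ∀ x : Feat d, ‖B.σ₀ • A.symm x‖ ≤ ‖x‖ := fun x => by
    have := hA3 (A.symm x)
    rw [norm_smul, Real.norm_of_nonneg hσ.le]
    simpa using this
  have hinner : ∀ v x : Feat d, inner ℝ v (B.σ₀ • A.symm x) = inner ℝ (B.σ₀ • A.symm v) x :=
    fun v x => by rw [real_inner_smul_left, real_inner_smul_right, hsymm]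
  have hmain := measure_not_second_moment_le (P := P) (F := W.pre τ)
    (X := fun s ω => B.σ₀ • A.symm (W.X s ω)) (a := 1) (b := τ + 1) (lam := B.σ₀ ^ 2)
    (W.pre_mono τ) h.pre_le (by positivity) B.σ₀_sq_le_one
    (fun s h1 _ => (A.symm.continuous.measurable.comp
      (W.measurable_X_pre h1)).fun_const_smul B.σ₀)
    (fun s h1 h2 => by
      filter_upwards [h.ae_X_norm_le h1 (by omega)] with ω hω using (hnorm _).trans hω)
    (fun v hv1 s h1 h2 => by
      simp_rw [hinner]
      refine h.condLeOne_exp_neg_sq_first_block h1 (by omega) (by omega)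
        ((hnorm v).trans hv1) ?_
      rw [← hA2, map_smul, norm_smul, mul_pow, Real.norm_of_nonneg hσ.le]
      simp)
  rw [Nat.add_sub_cancel, Finset.Ico_add_one_right_eq_Icc] at hmain
  refine (measure_mono fun ω hω => ?_).trans hmain
  refine fun hall => hω fun w => ?_
  have := hall (A w)
  have hterm : ∀ s, (inner ℝ (A w) (B.σ₀ • A.symm (W.X s ω))) ^ 2
      = B.σ₀ ^ 2 * (inner ℝ w (W.X s ω)) ^ 2 := fun s => by
    rw [real_inner_smul_right, hA, A.apply_symm_apply, mul_pow]
  simp_rw [hterm, ← Finset.mul_sum] at this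
  have hσ2 : 0 < B.σ₀ ^ 2 := by positivity
  refine le_of_mul_le_mul_left ?_ hσ2
  linarith

/-- Exponential moments of the noise in the first block. -/
theorem condLeOne_noise_first_block [IsProbabilityMeasure P] (h : W.IsSGDTS B T τ α P) {t : ℕ}
    (h1 : 1 ≤ t) (h2 : t ≤ T) (h3 : t ≤ τ) {R l : ℝ} (hR : B.R ≤ R) {w : Feat d}
    (hw : ∫ y, (inner ℝ w y) ^ 2 ∂B.unif ≤ 1) (hl : R ^ 2 * l ^ 2 * ‖w‖ ^ 2 ≤ 1 / 2) :
    CondLeOne (W.pre τ t) P fun ω => ENNReal.ofReal (Real.exp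
      (l * inner ℝ w (W.X t ω) * W.noise B t ω - 5 / 8 * (R ^ 2 * l ^ 2))) := by
  intro V hV
  have hR0 := B.R_pos
  let f : Feat d → ℝ := fun y => R ^ 2 * l ^ 2 / 2 * (inner ℝ w y) ^ 2
  have hf : Measurable f := by fun_prop
  set c := 5 / 8 * (R ^ 2 * l ^ 2) with hc
  have hmX := W.measurable_X_preReward τ t
  have hlX : Measurable[W.preReward τ t] fun ω => l * inner ℝ w (W.X t ω) :=
    (measurable_const.inner hmX).const_mul l
  have hfX : Measurable[W.preReward τ t] fun ω => f (W.X t ω) := hf.comp hmX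
  have hVf : Measurable[W.preReward τ t] fun ω =>
      V ω * ENNReal.ofReal (Real.exp (f (W.X t ω) - c)) :=
    (hV.mono (W.pre_le_preReward τ t) le_rfl).mul
      (ENNReal.measurable_ofReal.comp (Real.measurable_exp.comp (hfX.sub_const c)))
  -- Two layers of conditioning: given the feature, sub-Gaussianity costs `exp (f X)`; averaging
  -- over the feature, which is independent of the past, costs at most `exp c`.
  have hsub := h.condLeOne_noise_subG h1 h2 hlX _ hVf
  have hg : Measurable fun y : Feat d => ENNReal.ofReal (Real.exp (f y - c)) := by fun_prop
  have hfirst := h.lintegral_mul_X_first_block h1 h2 h3 hg hV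
  have hfint : Integrable f B.unif := by
    refine Integrable.of_bound (C := R ^ 2 * l ^ 2 / 2 * ‖w‖ ^ 2) hf.aestronglyMeasurable ?_
    filter_upwards [B.ae_unif_norm_le] with y hy
    simp only [f, norm_mul, norm_pow, Real.norm_eq_abs]
    rw [abs_of_nonneg (by positivity : (0 : ℝ) ≤ R ^ 2 * l ^ 2 / 2)]
    gcongr
    exact (abs_real_inner_le_norm _ _).trans (mul_le_of_le_one_right (norm_nonneg _) hy)
  have hone : ∫⁻ y, ENNReal.ofReal (Real.exp (f y - c)) ∂B.unif ≤ 1 := by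
    -- As `f ≤ 1/4`, `exp f ≤ 1 + f + f² ≤ 1 + 5/4 f`; the mean of `f` is at most `R² l² / 2`,
    -- whence the `5/8` in `c`.
    have hb : ∀ᵐ y ∂B.unif, Real.exp (f y - c) ≤ Real.exp (-c) * (1 + 5 / 4 * f y) := by
      filter_upwards [B.ae_unif_norm_le] with y hy
      have hy2 : (inner ℝ w y) ^ 2 ≤ ‖w‖ ^ 2 := by
        rw [← sq_abs]
        gcongr
        exact (abs_real_inner_le_norm _ _).trans (mul_le_of_le_one_right (norm_nonneg _) hy)
      have hf0 : 0 ≤ f y := by positivity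
      have hf1 : f y ≤ 1 / 4 := by
        calc f y ≤ R ^ 2 * l ^ 2 / 2 * ‖w‖ ^ 2 := by simp only [f]; gcongr
          _ ≤ 1 / 4 := by linarith
      have := (abs_le.mp (Real.abs_exp_sub_one_sub_id_le
        (x := f y) (by rw [abs_of_nonneg hf0]; linarith))).2
      rw [sub_eq_neg_add, Real.exp_add]
      gcongr
      nlinarith
    have h_integrable : Integrable (fun y => Real.exp (-c) * (1 + 5 / 4 * f y)) B.unif :=
      ((integrable_const _).add (hfint.const_mul _)).const_mul _
    calc _ ≤ ∫⁻ y, ENNReal.ofReal (Real.exp (-c) * (1 + 5 / 4 * f y)) ∂B.unif := by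
          refine lintegral_mono_ae ?_
          filter_upwards [hb] with y hy using ENNReal.ofReal_le_ofReal hy
      _ = ENNReal.ofReal (∫ y, Real.exp (-c) * (1 + 5 / 4 * f y) ∂B.unif) := by
          rw [ofReal_integral_eq_lintegral_ofReal h_integrable]
          exact ae_of_all _ fun y => by simp only [Pi.zero_apply]; positivity
      _ ≤ 1 := by
          rw [ENNReal.ofReal_le_one, integral_const_mul, integral_add (integrable_const _)
            (hfint.const_mul _), integral_const_mul]
          simp only [f, integral_const_mul, integral_const, probReal_univ, smul_eq_mul, mul_one]
          have h4 := Real.add_one_le_exp c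
          have h5 : Real.exp (-c) * Real.exp c = 1 := by rw [← Real.exp_add]; simp
          rw [← h5]
          gcongr
          refine le_trans ?_ h4
          have h6 : R ^ 2 * l ^ 2 / 2 * ∫ y, (inner ℝ w y) ^ 2 ∂B.unif ≤ R ^ 2 * l ^ 2 / 2 * 1 := by
            gcongr
          rw [hc]; linarith
  calc _ ≤ ∫⁻ ω, V ω * ENNReal.ofReal (Real.exp (f (W.X t ω) - c)) * ENNReal.ofReal (Real.exp
        (l * inner ℝ w (W.X t ω) * W.noise B t ω
          - B.R ^ 2 / 2 * (l * inner ℝ w (W.X t ω)) ^ 2)) ∂P := by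
        refine lintegral_mono fun ω => ?_
        rw [mul_assoc]
        gcongr
        rw [← ENNReal.ofReal_mul (Real.exp_pos _).le, ← Real.exp_add]
        refine ENNReal.ofReal_le_ofReal (Real.exp_le_exp.mpr ?_)
        have : B.R ^ 2 / 2 * (l * inner ℝ w (W.X t ω)) ^ 2
            ≤ R ^ 2 / 2 * (l * inner ℝ w (W.X t ω)) ^ 2 := by gcongr
        simp only [f]
        nlinarith
    _ ≤ _ := hsub
    _ = _ := hfirst
    _ ≤ ∫⁻ ω, V ω ∂P := lintegral_mono fun ω => mul_le_of_le_one_right zero_le hone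

/-- Writing `⟨w, Z⟩ = ⟨A w, A⁻¹ Z⟩` for the noise vector `Z`, a half net bounds `‖A⁻¹ Z‖`. Measuring
noise in this norm requires a block length of order `σ₀⁻²` instead of `σ₀⁻⁴`, matching the noise
term of `τ₁`. The parameter `R` may exceed that of the bandit, so that `c / 2 ≤ R` can be imposed
and the exponents stay small. -/
theorem measure_not_first_block_noise_le [IsProbabilityMeasure P] (h : W.IsSGDTS B T τ α P)
    (hτ : τ ≤ T) {A : Feat d ≃L[ℝ] Feat d}
    (hA : ∀ u v, inner ℝ (A u) v = inner ℝ u (A v))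
    (hA2 : ∀ v, ‖A v‖ ^ 2 = ∫ y, (inner ℝ v y) ^ 2 ∂B.unif)
    (hA3 : ∀ v, B.σ₀ * ‖v‖ ≤ ‖A v‖) {R c : ℝ} (hR : B.R ≤ R) (hc : 0 < c) (hRc : c / 2 ≤ R) :
    P {ω | ¬ ∀ w : Feat d, inner ℝ w (∑ s ∈ Finset.Icc 1 τ, W.noise B s ω • W.X s ω)
        ≤ ‖A w‖ * (4 / 5 * c * τ * B.σ₀)}
      ≤ ENNReal.ofReal (Real.exp (2 * d - 8 / 125 * (τ * c ^ 2 * B.σ₀ ^ 2 / R ^ 2))) := by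
  have hσ := B.σ₀_pos
  have hsymm := inner_symm_comm hA
  have hR0 : 0 < R := B.R_pos.trans_le hR
  obtain ⟨N, hNc, hN1, hNcov⟩ := exists_half_net d
  -- This `l` maximizes `l (2/5 c τ σ₀) - 5/8 τ R² l²`, and `r` is the maximum. The half net doubles
  -- `2/5` to `4/5`, still below the `7/8` of the moment bound.
  set l : ℝ := 8 / 25 * c * B.σ₀ / R ^ 2 with hl
  set r : ℝ := 8 / 125 * (τ * c ^ 2 * B.σ₀ ^ 2 / R ^ 2) with hr
  let bad : Feat d → Set Ω := fun v => {ω | r ≤ ∑ s ∈ Finset.Ico 1 (τ + 1),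
    (l * inner ℝ (A.symm v) (W.X s ω) * W.noise B s ω - 5 / 8 * (R ^ 2 * l ^ 2))}
  have hbad : ∀ v ∈ N, P (bad v) ≤ ENNReal.ofReal (Real.exp (-r)) := by
    intro v hv
    have hAv : ‖A (A.symm v)‖ ≤ 1 := by simpa using hN1 v hv
    refine measure_lt_sum_le_exp (W.pre_mono τ) h.pre_le (fun s h1 _ => ?_) (fun s h1 h2 => ?_) r
    · exact (((measurable_const.inner (W.measurable_X_pre h1)).const_mul l).mul
        (W.measurable_noise_pre B h1)).sub_const _
    · refine h.condLeOne_noise_first_block h1 (by omega) (by omega) hR ?_ ?_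
      · rw [← hA2]; exact pow_le_one₀ (norm_nonneg _) hAv
      · have h3 : B.σ₀ * ‖A.symm v‖ ≤ 1 := (hA3 _).trans hAv
        have h4 : (B.σ₀ * ‖A.symm v‖) ^ 2 ≤ 1 := pow_le_one₀ (by positivity) h3
        have h5 : c ^ 2 ≤ 4 * R ^ 2 := by nlinarith
        have h6 : R ^ 2 * l ^ 2 * ‖A.symm v‖ ^ 2
            = 64 / 625 * (c ^ 2 / R ^ 2) * (B.σ₀ * ‖A.symm v‖) ^ 2 := by
          rw [hl]; field_simp; ring
        have h7 : c ^ 2 / R ^ 2 ≤ 4 := by rw [div_le_iff₀ (by positivity)]; exact h5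
        rw [h6]
        calc 64 / 625 * (c ^ 2 / R ^ 2) * (B.σ₀ * ‖A.symm v‖) ^ 2 ≤ 64 / 625 * 4 * 1 := by gcongr
          _ ≤ 1 / 2 := by norm_num
  have hsub : {ω | ¬ ∀ w : Feat d, inner ℝ w (∑ s ∈ Finset.Icc 1 τ, W.noise B s ω • W.X s ω)
        ≤ ‖A w‖ * (4 / 5 * c * τ * B.σ₀)} ⊆ ⋃ v ∈ N, bad v := by
    intro ω hnot
    by_contra hgood
    refine hnot fun w => ?_
    set Z := ∑ s ∈ Finset.Icc 1 τ, W.noise B s ω • W.X s ω with hZ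
    have hζ : ‖A.symm Z‖ ≤ 2 * (2 / 5 * c * τ * B.σ₀) := by
      refine norm_le_two_mul_of_half_net hNcov (by positivity) fun v hv => ?_
      have hnb : ω ∉ bad v := fun hb => hgood (Set.mem_iUnion₂.mpr ⟨v, hv, hb⟩)
      simp only [bad, Set.mem_ofPred_eq, not_le] at hnb
      rw [Finset.sum_sub_distrib, Finset.sum_const, Nat.card_Ico, Nat.add_sub_cancel,
        nsmul_eq_mul, Finset.Ico_add_one_right_eq_Icc] at hnb
      have hin : inner ℝ v (A.symm Z)
          = ∑ s ∈ Finset.Icc 1 τ, inner ℝ (A.symm v) (W.X s ω) * W.noise B s ω := by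
        rw [← hsymm, hZ, inner_sum]
        exact Finset.sum_congr rfl fun s _ => by rw [real_inner_smul_right, mul_comm]
      have hin2 : ∑ s ∈ Finset.Icc 1 τ, l * inner ℝ (A.symm v) (W.X s ω) * W.noise B s ω
          = l * inner ℝ v (A.symm Z) := by
        rw [hin, Finset.mul_sum]
        exact Finset.sum_congr rfl fun s _ => by ring
      rw [hin2] at hnb
      have hl0 : 0 < l := by positivity
      refine le_of_mul_le_mul_left ?_ hl0
      have hval : l * (2 / 5 * c * τ * B.σ₀) = r + τ * (5 / 8 * (R ^ 2 * l ^ 2)) := by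
        rw [hr, hl]; field_simp; ring
      linarith
    have hw : inner ℝ w Z = inner ℝ (A w) (A.symm Z) := by rw [hA, A.apply_symm_apply]
    rw [hw]
    refine (real_inner_le_norm _ _).trans ?_
    gcongr
    linarith
  calc _ ≤ P (⋃ v ∈ N, bad v) := measure_mono hsub
    _ ≤ ∑ v ∈ N, P (bad v) := measure_biUnion_finset_le _ _
    _ ≤ ∑ v ∈ N, ENNReal.ofReal (Real.exp (-r)) := Finset.sum_le_sum hbad
    _ = ENNReal.ofReal (N.card * Real.exp (-r)) := by
        rw [Finset.sum_const, nsmul_eq_mul, ENNReal.ofReal_mul (by positivity),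
          ENNReal.ofReal_natCast]
    _ ≤ _ := by
        refine ENNReal.ofReal_le_ofReal ?_
        have h1 : (N.card : ℝ) ≤ Real.exp (2 * d) :=
          calc (N.card : ℝ) ≤ (5 : ℝ) ^ d := by exact_mod_cast hNc
            _ ≤ _ := five_pow_le_exp _
        rw [sub_eq_add_neg, Real.exp_add]
        gcongr

/-- The martingale part of the stochastic gradient descent. -/
theorem measure_sgd_noise_le [IsProbabilityMeasure P] (h : W.IsSGDTS B T τ α P)
    (hτ0 : 0 < τ) (hτ : τ ≤ T) {j : ℕ} (hj : 1 ≤ j) (hjT : j * τ ≤ T) (l r : ℝ) :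
    P {ω | r ≤ ∑ q ∈ Finset.Icc 2 j, ∑ s ∈ Finset.Icc ((q - 1) * τ + 1) (q * τ),
      ((l * q ^ 2 * inner ℝ (W.X s ω) (W.sgd B.μ τ α (q - 1) ω - B.θstar)) * W.noise B s ω
        - (l * q ^ 2 * inner ℝ (W.X s ω) (W.sgd B.μ τ α (q - 1) ω - B.θstar)) ^ 2)}
      ≤ ENNReal.ofReal (Real.exp (-r)) := by
  -- The block containing round `s` is `(s - 1) / τ + 1`; its multiplier uses the iterate of the
  -- preceding block, so it is known before the reward. Boundedness of the noise gives a variance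
  -- proxy free of `R`.
  let g : ℕ → Ω → ℝ := fun s ω => l * (((s - 1) / τ + 1 : ℕ) : ℝ) ^ 2
    * inner ℝ (W.X s ω) (W.sgd B.μ τ α ((s - 1) / τ) ω - B.θstar)
  have hth : ∀ s, τ < s → Measurable[W.pre τ s] (W.sgd B.μ τ α ((s - 1) / τ)) := fun s hs => by
    obtain ⟨h1, h2, h3⟩ := block_index hτ0 hs
    exact (h.measurable_sgd hτ h3 _ le_rfl).mono (W.hist_le_pre h2) le_rfl
  have hg : ∀ s (m : MeasurableSpace Ω), τ < s → W.pre τ s ≤ m → Measurable[m] (W.X s) →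
      Measurable[m] (g s) := fun s m hs hm hX =>
    (hX.inner (((hth s hs).mono hm le_rfl).sub_const _)).const_mul _
  have key := measure_lt_sum_le_exp (P := P) (W.pre_mono τ) h.pre_le
    (y := fun s ω => g s ω * W.noise B s ω - g s ω ^ 2) (a := τ + 1) (b := j * τ + 1)
    (fun s h1 h2 => by
      have hgs := hg s (W.pre τ (s + 1)) (by omega) (W.pre_mono τ (Nat.le_succ s))
        (W.measurable_X_pre (by omega))
      exact (hgs.mul (W.measurable_noise_pre B (by omega))).sub (hgs.pow_const 2))
    (fun s h1 h2 => (h.condLeOne_noise_bounded (by omega) (by omega)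
      (hg s _ (by omega) (W.pre_le_preReward τ s) (W.measurable_X_preReward τ s))).mono
        (W.pre_le_preReward τ s)) r
  refine le_trans (le_of_eq ?_) key
  congr 1
  ext ω
  simp only [Set.mem_ofPred_eq]
  rw [Finset.sum_Ico_blocks _ τ hj]
  refine iff_of_eq (congrArg (r ≤ ·) (Finset.sum_congr rfl fun q hq =>
    Finset.sum_congr rfl fun s hs => ?_))
  rw [Finset.mem_Icc] at hq hs
  obtain ⟨q, rfl⟩ : ∃ p, q = p + 1 := ⟨q - 1, by omega⟩
  rw [Nat.add_sub_cancel] at hs ⊢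
  have hdiv : (s - 1) / τ = q := by
    have : (q + 1) * τ = q * τ + τ := by ring
    exact Nat.div_eq_of_lt_le (by omega) (by omega)
  simp only [g, hdiv]

end Play.IsSGDTS

namespace GLBandit

variable {d K : ℕ} (B : GLBandit d K)

/-! ### The likelihood equation -/

/-- The score function of a sample. -/
def score {ι : Type*} (s : Finset ι) (X : ι → Feat d) (Y : ι → ℝ) (θ : Feat d) : Feat d :=
  ∑ t ∈ s, (Y t - B.μ (inner ℝ (X t) θ)) • X t

variable {ι : Type*} {s : Finset ι} {X : ι → Feat d} {Y : ι → ℝ}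

theorem inner_score (w θ : Feat d) :
    inner ℝ w (B.score s X Y θ) = ∑ t ∈ s, (Y t - B.μ (inner ℝ (X t) θ)) * inner ℝ (X t) w := by
  rw [score, inner_sum]
  exact Finset.sum_congr rfl fun t _ => by
    rw [real_inner_smul_right, real_inner_comm w]

/-- Moving from `θstar` by a unit vector `w` lowers the score in direction `w` by at least `c₁ ∑ ⟨w,
X⟩²`, more than its value at `θstar`. -/
theorem inner_score_neg (hX : ∀ t ∈ s, ‖X t‖ ≤ 1)
    (hw : ∀ w : Feat d, ‖w‖ = 1 → inner ℝ w (B.score s X Y B.θstar)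
      < cEta B.μ B.θstar 1 * ∑ t ∈ s, (inner ℝ w (X t)) ^ 2) {w : Feat d} (h1 : ‖w‖ = 1) :
    inner ℝ w (B.score s X Y (B.θstar + w)) < 0 := by
  have h2 := hw w h1
  rw [inner_score] at h2 ⊢
  have h3 : ∀ t ∈ s, (Y t - B.μ (inner ℝ (X t) (B.θstar + w))) * inner ℝ (X t) w
      ≤ (Y t - B.μ (inner ℝ (X t) B.θstar)) * inner ℝ (X t) w
        - cEta B.μ B.θstar 1 * (inner ℝ w (X t)) ^ 2 := by
    intro t ht
    have := B.cEta_mul_sq_le (η := 1) (θ := B.θstar + w) (hX t ht) (by simp [h1])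
    rw [add_sub_cancel_left] at this
    rw [real_inner_comm (X t) w]
    linarith
  have h4 := Finset.sum_le_sum h3
  rw [Finset.sum_sub_distrib, ← Finset.mul_sum] at h4
  linarith

/-- Along a ray from `θstar` the radial component of the score is nonincreasing, because `μ` is
increasing; being negative at radius one, it cannot vanish farther out. -/
theorem norm_sub_le_one_of_score_eq_zero (hX : ∀ t ∈ s, ‖X t‖ ≤ 1)
    (hw : ∀ w : Feat d, ‖w‖ = 1 → inner ℝ w (B.score s X Y B.θstar)
      < cEta B.μ B.θstar 1 * ∑ t ∈ s, (inner ℝ w (X t)) ^ 2) {θ : Feat d}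
    (hθ : B.score s X Y θ = 0) : ‖θ - B.θstar‖ ≤ 1 := by
  by_contra! hlt
  set ρ := ‖θ - B.θstar‖ with hρ
  have hρ0 : 0 < ρ := by linarith
  set w : Feat d := ρ⁻¹ • (θ - B.θstar) with hwdef
  have h1 : ‖w‖ = 1 := by
    rw [hwdef, norm_smul, norm_inv, Real.norm_of_nonneg hρ0.le, ← hρ, inv_mul_cancel₀ hρ0.ne']
  have h2 := B.inner_score_neg hX hw h1
  have hθw : θ = B.θstar + w + (ρ - 1) • w := by
    have : ρ • w = θ - B.θstar := by rw [hwdef, smul_smul, mul_inv_cancel₀ hρ0.ne', one_smul]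
    rw [sub_smul, this, one_smul]; abel
  have h3 : inner ℝ w (B.score s X Y θ) = 0 := by rw [hθ, inner_zero_right]
  rw [inner_score] at h2 h3
  have h4 : ∀ t ∈ s, (Y t - B.μ (inner ℝ (X t) θ)) * inner ℝ (X t) w
      ≤ (Y t - B.μ (inner ℝ (X t) (B.θstar + w))) * inner ℝ (X t) w := by
    intro t _
    have hin : inner ℝ (X t) θ = inner ℝ (X t) (B.θstar + w) + (ρ - 1) * inner ℝ (X t) w := by
      conv_lhs => rw [hθw]
      rw [inner_add_right, real_inner_smul_right]
    rcases le_total 0 (inner ℝ (X t) w) with hp | hp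
    · refine mul_le_mul_of_nonneg_right ?_ hp
      have : B.μ (inner ℝ (X t) (B.θstar + w)) ≤ B.μ (inner ℝ (X t) θ) :=
        B.strictMono.monotone (by rw [hin]; nlinarith)
      linarith
    · refine mul_le_mul_of_nonpos_right ?_ hp
      have : B.μ (inner ℝ (X t) θ) ≤ B.μ (inner ℝ (X t) (B.θstar + w)) :=
        B.strictMono.monotone (by rw [hin]; nlinarith)
      linarith
  linarith [Finset.sum_le_sum h4]

/-- The score is minus the gradient of a sum of antiderivatives of `μ`, which has a minimizer on the
closed unit ball around `θstar`. At an interior minimizer the score vanishes; at a boundary one,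
testing towards the centre contradicts `inner_score_neg`. Existence matters because the estimate is
otherwise arbitrary. -/
theorem exists_score_eq_zero (hX : ∀ t ∈ s, ‖X t‖ ≤ 1)
    (hw : ∀ w : Feat d, ‖w‖ = 1 → inner ℝ w (B.score s X Y B.θstar)
      < cEta B.μ B.θstar 1 * ∑ t ∈ s, (inner ℝ w (X t)) ^ 2) :
    ∃ θ, B.score s X Y θ = 0 := by
  let m : ℝ → ℝ := fun z => ∫ x in (0 : ℝ)..z, B.μ x
  have hm : ∀ z, HasDerivAt m (B.μ z) z := fun z =>
    intervalIntegral.integral_hasDerivAt_right (B.continuous_μ.intervalIntegrable _ _)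
      (B.continuous_μ.stronglyMeasurableAtFilter _ _) B.continuous_μ.continuousAt
  let Φ : Feat d → ℝ := fun θ => ∑ t ∈ s, (m (inner ℝ (X t) θ) - Y t * inner ℝ (X t) θ)
  have hΦ : ∀ θ, HasFDerivAt Φ (-(innerSL ℝ (B.score s X Y θ))) θ := by
    intro θ
    have hlin : ∀ t, HasFDerivAt (fun θ : Feat d => inner ℝ (X t) θ) (innerSL ℝ (X t)) θ :=
      fun t => (innerSL ℝ (X t)).hasFDerivAt
    have hterm : ∀ t ∈ s, HasFDerivAt (fun θ => m (inner ℝ (X t) θ) - Y t * inner ℝ (X t) θ)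
        (B.μ (inner ℝ (X t) θ) • innerSL ℝ (X t) - Y t • innerSL ℝ (X t)) θ := fun t _ =>
      ((hm _).comp_hasFDerivAt θ (hlin t)).sub ((hlin t).const_mul (Y t))
    have := HasFDerivAt.fun_sum hterm
    refine this.congr_fderiv (ContinuousLinearMap.ext fun w => ?_)
    rw [neg_apply, innerSL_apply_apply, real_inner_comm, inner_score,
      sum_apply, ← Finset.sum_neg_distrib]
    refine Finset.sum_congr rfl fun t _ => ?_
    simp only [sub_apply, smul_apply, innerSL_apply_apply, smul_eq_mul]
    ring
  obtain ⟨θ₀, hθ₀, hmin⟩ := (isCompact_closedBall B.θstar 1).exists_isMinOn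
    (Metric.nonempty_closedBall.mpr zero_le_one)
    (fun θ _ => (hΦ θ).continuousAt.continuousWithinAt)
  have hvar : ∀ z ∈ Metric.closedBall B.θstar 1, inner ℝ (B.score s X Y θ₀) (z - θ₀) ≤ 0 := by
    intro z hz
    have hseg : segment ℝ θ₀ (θ₀ + (z - θ₀)) ⊆ Metric.closedBall B.θstar 1 := by
      rw [add_sub_cancel]
      exact (convex_closedBall B.θstar 1).segment_subset hθ₀ hz
    have := hmin.localize.hasFDerivWithinAt_nonneg (hΦ θ₀).hasFDerivWithinAt
      (mem_posTangentConeAt_of_segment_subset hseg)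
    simpa using this
  refine ⟨θ₀, ?_⟩
  rw [mem_closedBall_iff_norm] at hθ₀
  rcases hθ₀.lt_or_eq with hlt | heq
  · set g := B.score s X Y θ₀ with hg
    by_contra hne
    have hg0 : 0 < ‖g‖ := norm_pos_iff.mpr hne
    set k := (1 - ‖θ₀ - B.θstar‖) / ‖g‖ with hk
    have hk0 : 0 < k := by have := sub_pos.mpr hlt; positivity
    have := hvar (θ₀ + k • g) (by
      rw [mem_closedBall_iff_norm, add_sub_right_comm]
      refine (norm_add_le _ _).trans ?_
      rw [norm_smul, Real.norm_of_nonneg hk0.le, hk, div_mul_cancel₀ _ hg0.ne']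
      linarith)
    rw [add_sub_cancel_left, real_inner_smul_right, real_inner_self_eq_norm_sq] at this
    have : 0 < k * ‖g‖ ^ 2 := by positivity
    linarith
  · exfalso
    have h1 := hvar B.θstar (by simp)
    have h2 := B.inner_score_neg hX hw heq
    rw [add_sub_cancel, real_inner_comm, inner_sub_right] at h2
    rw [inner_sub_right] at h1
    linarith

end GLBandit

/-! ### Projected stochastic gradient descent -/

/-- The vectors from `x` to its projection and from the projection to a point of the ball have
nonnegative inner product with the outward direction reversed in both; expanding the square gives
the contraction. -/
theorem norm_projBall_sub_le {d : ℕ} {c y : Feat d} {r : ℝ} (hr : 0 ≤ r) (x : Feat d)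
    (hy : ‖y - c‖ ≤ r) : ‖projBall c r x - y‖ ≤ ‖x - y‖ := by
  unfold projBall
  split_ifs with h
  · exact le_rfl
  have hlt := not_le.mp h
  have hx : 0 < ‖x - c‖ := lt_of_le_of_lt hr hlt
  set k := r / ‖x - c‖ with hk
  have hk1 : k ≤ 1 := by rw [hk, div_le_one hx]; exact hlt.le
  set p := c + k • (x - c) with hp
  have h1 : x - p = (1 - k) • (x - c) := by rw [hp, sub_smul, one_smul]; abel
  have h2 : inner ℝ (x - c) (p - y) = k * ‖x - c‖ ^ 2 - inner ℝ (x - c) (y - c) := by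
    have : p - y = k • (x - c) - (y - c) := by rw [hp]; abel
    rw [this, inner_sub_right, real_inner_smul_right, real_inner_self_eq_norm_sq]
  have h3 : k * ‖x - c‖ ^ 2 = r * ‖x - c‖ := by rw [hk]; field_simp
  have h4 : inner ℝ (x - c) (y - c) ≤ ‖x - c‖ * r :=
    (real_inner_le_norm _ _).trans (by gcongr)
  have h5 : 0 ≤ inner ℝ (x - p) (p - y) := by
    rw [h1, real_inner_smul_left]
    exact mul_nonneg (by linarith) (by rw [h2, h3]; linarith)
  have h6 : ‖x - y‖ ^ 2 = ‖x - p‖ ^ 2 + 2 * inner ℝ (x - p) (p - y) + ‖p - y‖ ^ 2 := by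
    rw [← norm_add_sq_real]; congr 2; abel
  refine le_of_sq_le_sq ?_ (norm_nonneg _)
  nlinarith [sq_nonneg ‖x - p‖]

/-- Summation of the weighted descent recursion. -/
theorem descent_recursion {D ξ Q : ℕ → ℝ} {α τ L : ℝ} (hα : 0 < α) (hτ : 0 < τ) (hατ : α ≤ τ)
    (hD0 : ∀ q, 0 ≤ D q) (hD1 : D 1 ≤ 1) {j : ℕ} (hj : 1 ≤ j)
    (hrec : ∀ q, 2 ≤ q → q ≤ j →
      D q ≤ D (q - 1) - 7 / 2 / q * D (q - 1) + 2 / (α * q) * ξ q + τ ^ 2 / (α * q) ^ 2)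
    (hQ : ∀ q, 2 ≤ q → q ≤ j → Q q ≤ τ * D (q - 1))
    (hnoise : ∑ q ∈ Finset.Icc 2 j, (α / (4 * j ^ 2 * τ) * q ^ 2 * ξ q
      - (α / (4 * j ^ 2 * τ) * q ^ 2) ^ 2 * Q q) ≤ L)
    (hL : 32 * L ≤ τ) : D j ≤ (τ / α) ^ 2 / j := by
  rcases hj.eq_or_lt with rfl | hj2
  · simp only [Nat.cast_one, div_one]
    refine hD1.trans (one_le_pow₀ ?_)
    rw [one_le_div hα]; exact hατ
  have hjpos : (0 : ℝ) < j := by positivity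
  set l := α / (4 * j ^ 2 * τ) with hl
  have hl0 : 0 < l := by positivity
  -- The weight `q³` makes the recursion telescope, since `q³ - 7/2 q² ≤ (q - 1)³ - q²/2`; the term
  -- `-q²/2` is kept in reserve against the martingale.
  have hstep : ∀ n, 1 ≤ n → n ≤ j → (n : ℝ) ^ 3 * D n ≤ 1
      + ∑ q ∈ Finset.Icc 2 n, (τ ^ 2 / α ^ 2 * q + 2 / α * (q ^ 2 * ξ q)
        - 1 / 2 * (q ^ 2 * D (q - 1)))
      := by
    intro n hn
    induction n, hn using Nat.le_induction with
    | base => intro _; simpa using hD1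
    | succ n hn ih =>
      intro hnj
      have ih' := ih (by omega)
      rw [Finset.sum_Icc_succ_top (by omega), Nat.add_sub_cancel]
      have hr := hrec (n + 1) (by omega) hnj
      rw [Nat.add_sub_cancel] at hr
      set m : ℝ := ((n + 1 : ℕ) : ℝ) with hm
      have hmn : (n : ℝ) = m - 1 := by rw [hm]; push_cast; ring
      have hm2 : 2 ≤ m := by rw [hm]; exact_mod_cast (by omega : 2 ≤ n + 1)
      have hm0 : 0 < m := by linarith
      have h1 : m ^ 3 * D (n + 1) ≤ m ^ 3 * D n - 7 / 2 * m ^ 2 * D n + 2 / α * (m ^ 2 * ξ (n + 1))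
          + τ ^ 2 / α ^ 2 * m := by
        calc m ^ 3 * D (n + 1) ≤ m ^ 3 * (D n - 7 / 2 / m * D n + 2 / (α * m) * ξ (n + 1)
              + τ ^ 2 / (α * m) ^ 2) := by gcongr
          _ = _ := by field_simp
      have h2 : m ^ 3 * D n - 7 / 2 * m ^ 2 * D n ≤ (n : ℝ) ^ 3 * D n - 1 / 2 * (m ^ 2 * D n) := by
        rw [hmn]
        have : 0 ≤ (3 * m - 1) * D n := mul_nonneg (by linarith) (hD0 n)
        nlinarith
      linarith
  have hmain := hstep j hj le_rfl
  rw [Finset.sum_sub_distrib, Finset.sum_add_distrib, ← Finset.mul_sum, ← Finset.mul_sum,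
    ← Finset.mul_sum] at hmain
  have hgauss : ∑ q ∈ Finset.Icc 2 j, (q : ℝ) = j * (j + 1) / 2 - 1 := by
    have : ∀ n : ℕ, 1 ≤ n → ∑ q ∈ Finset.Icc 2 n, (q : ℝ) = n * (n + 1) / 2 - 1 := by
      intro n hn
      induction n, hn using Nat.le_induction with
      | base => norm_num
      | succ n hn ih => rw [Finset.sum_Icc_succ_top (by omega), ih]; push_cast; ring
    exact this j hj
  have hξ : l * ∑ q ∈ Finset.Icc 2 j, ((q : ℝ) ^ 2 * ξ q)
      ≤ L + l ^ 2 * j ^ 2 * τ * ∑ q ∈ Finset.Icc 2 j, ((q : ℝ) ^ 2 * D (q - 1)) := by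
    have h1 : ∑ q ∈ Finset.Icc 2 j, (l * (q : ℝ) ^ 2) ^ 2 * Q q
        ≤ l ^ 2 * j ^ 2 * τ * ∑ q ∈ Finset.Icc 2 j, ((q : ℝ) ^ 2 * D (q - 1)) := by
      rw [Finset.mul_sum]
      refine Finset.sum_le_sum fun q hq => ?_
      rw [Finset.mem_Icc] at hq
      have hqj : (q : ℝ) ≤ j := by exact_mod_cast hq.2
      calc (l * (q : ℝ) ^ 2) ^ 2 * Q q ≤ (l * (q : ℝ) ^ 2) ^ 2 * (τ * D (q - 1)) := by
            gcongr; exact hQ q hq.1 hq.2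
        _ = l ^ 2 * (q : ℝ) ^ 2 * τ * ((q : ℝ) ^ 2 * D (q - 1)) := by ring
        _ ≤ _ := by
            have := hD0 (q - 1)
            gcongr
    rw [Finset.sum_sub_distrib] at hnoise
    rw [Finset.mul_sum]
    simp_rw [← mul_assoc]
    linarith
  set S1 := ∑ q ∈ Finset.Icc 2 j, ((q : ℝ) ^ 2 * ξ q)
  set S2 := ∑ q ∈ Finset.Icc 2 j, ((q : ℝ) ^ 2 * D (q - 1))
  -- The value of `l` is chosen so that the quadratic variation enters with coefficient exactly
  -- `1/2`, cancelling the reserved term.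
  have hξ2 : 2 / α * S1 ≤ 8 * j ^ 2 * τ / α ^ 2 * L + 1 / 2 * S2 := by
    have hmul : 2 / α * S1 = 2 / (α * l) * (l * S1) := by field_simp
    rw [hmul]
    calc _ ≤ 2 / (α * l) * (L + l ^ 2 * j ^ 2 * τ * S2) := by gcongr
      _ = _ := by rw [hl]; field_simp; ring
  rw [hgauss] at hmain
  set ρ := τ ^ 2 / α ^ 2 with hρ
  have hρ1 : 1 ≤ ρ := by
    rw [hρ, ← div_pow]; refine one_le_pow₀ ?_; rw [one_le_div hα]; exact hατ
  have hLρ : 8 * j ^ 2 * τ / α ^ 2 * L ≤ ρ * (j ^ 2 / 4) := by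
    calc 8 * j ^ 2 * τ / α ^ 2 * L = j ^ 2 * τ / α ^ 2 / 4 * (32 * L) := by ring
      _ ≤ j ^ 2 * τ / α ^ 2 / 4 * τ := by gcongr
      _ = _ := by rw [hρ]; ring
  have hj2' : (2 : ℝ) ≤ j := by exact_mod_cast hj2
  -- In units of `ρ j²` the gradient norms contribute at most `3/4` (as `j ≥ 2`) and the martingale
  -- level at most `1/4`; the initial `1` is absorbed by the `-1` in the sum of the `q`, because `ρ
  -- ≥ 1`.
  have hfin : (j : ℝ) ^ 3 * D j ≤ ρ * j ^ 2 := by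
    have : ρ * (j * (j + 1) / 2) ≤ ρ * (3 / 4 * j ^ 2) := by gcongr; nlinarith
    nlinarith
  rw [div_pow, ← hρ, le_div_iff₀ hjpos]
  refine le_of_mul_le_mul_left ?_ (by positivity : (0 : ℝ) < j ^ 2)
  calc (j : ℝ) ^ 2 * (D j * j) = j ^ 3 * D j := by ring
    _ ≤ ρ * j ^ 2 := hfin
    _ = _ := by ring

theorem sum_Icc_inv_le_one_add_log (j : ℕ) :
    ∑ q ∈ Finset.Icc 1 j, (1 : ℝ) / q ≤ 1 + Real.log j := by
  have := harmonic_le_one_add_log j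
  rw [harmonic_eq_sum_Icc] at this
  push_cast at this
  simpa [one_div] using this

/-! ### The iterates along a good run -/

namespace Play

variable {d K : ℕ} {Ω : Type*} (W : Play d K Ω) (B : GLBandit d K)

theorem norm_sgd_sub_mle_le (τ : ℕ) (α : ℝ) (q : ℕ) (ω : Ω) :
    ‖W.sgd B.μ τ α q ω - W.mle ω‖ ≤ 2 := by
  cases q with
  | zero => simp [Play.sgd]
  | succ q => exact projBall_mem _ (by norm_num) _

variable {W B} {τ : ℕ} {α : ℝ} {ω : Ω}

/-- Radius `2` of the projection ball plus error `1` of its centre: this is why `c₃` governs the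
curvature. -/
theorem norm_sgd_sub_le (hmle : ‖W.mle ω - B.θstar‖ ≤ 1) (q : ℕ) :
    ‖W.sgd B.μ τ α q ω - B.θstar‖ ≤ 3 := by
  have h1 := W.norm_sgd_sub_mle_le B τ α q ω
  have h2 := norm_sub_le_norm_sub_add_norm_sub (W.sgd B.μ τ α q ω) (W.mle ω) B.θstar
  linarith

theorem card_block {q : ℕ} (hq : 1 ≤ q) (τ : ℕ) :
    (Finset.Icc ((q - 1) * τ + 1) (q * τ)).card = τ := by
  obtain ⟨q, rfl⟩ : ∃ r, q = r + 1 := ⟨q - 1, by omega⟩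
  have : (q + 1) * τ = q * τ + τ := by ring
  rw [Nat.card_Icc, Nat.add_sub_cancel]
  omega

/-- One step of projected stochastic gradient descent. -/
theorem sgd_step (hα : 0 < α) (hmle : ‖W.mle ω - B.θstar‖ ≤ 1) {lam : ℝ}
    (hlam : 2 * α ≤ cEta B.μ B.θstar 3 * (τ * lam)) {q : ℕ} (hq : 1 ≤ q)
    (hX : ∀ s ∈ Finset.Icc ((q - 1) * τ + 1) (q * τ), ‖W.X s ω‖ ≤ 1)
    (hY : ∀ s ∈ Finset.Icc ((q - 1) * τ + 1) (q * τ), W.Y s ω ∈ Set.Icc (0 : ℝ) 1)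
    (hmom : ∀ w : Feat d, 7 / 8 * (τ * lam) * ‖w‖ ^ 2
      ≤ ∑ s ∈ Finset.Icc ((q - 1) * τ + 1) (q * τ), (inner ℝ w (W.X s ω)) ^ 2) :
    ‖W.sgd B.μ τ α q ω - B.θstar‖ ^ 2 ≤ ‖W.sgd B.μ τ α (q - 1) ω - B.θstar‖ ^ 2
      - 7 / 2 / q * ‖W.sgd B.μ τ α (q - 1) ω - B.θstar‖ ^ 2
      + 2 / (α * q) * (∑ s ∈ Finset.Icc ((q - 1) * τ + 1) (q * τ),
          inner ℝ (W.X s ω) (W.sgd B.μ τ α (q - 1) ω - B.θstar) * W.noise B s ω)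
      + (τ : ℝ) ^ 2 / (α * q) ^ 2 := by
  have hcard := card_block hq τ
  set I := Finset.Icc ((q - 1) * τ + 1) (q * τ) with hI
  set θ := W.sgd B.μ τ α (q - 1) ω with hθ
  set δ := θ - B.θstar with hδ
  set g := W.gradLoss B.μ τ q ω θ with hg
  have hq0 : (0 : ℝ) < q := by exact_mod_cast hq
  have hc3 := B.c₃_pos
  have hsgd : W.sgd B.μ τ α q ω = projBall (W.mle ω) 2 (θ - (1 / (α * q)) • g) := by
    obtain ⟨r, rfl⟩ : ∃ r, q = r + 1 := ⟨q - 1, by omega⟩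
    rfl
  -- The point `θstar` lies in the projection ball, so projecting cannot increase the distance to
  -- it.
  have hproj : ‖W.sgd B.μ τ α q ω - B.θstar‖ ^ 2 ≤ ‖δ - (1 / (α * q)) • g‖ ^ 2 := by
    rw [hsgd]
    have := norm_projBall_sub_le (c := W.mle ω) (y := B.θstar) (r := 2) (by norm_num)
      (θ - (1 / (α * q)) • g) (by rw [norm_sub_rev]; linarith)
    have he : θ - (1 / (α * q)) • g - B.θstar = δ - (1 / (α * q)) • g := by rw [hδ]; abel
    rw [he] at this
    gcongr
  have hgsum : g = ∑ s ∈ I, (B.μ (inner ℝ (W.X s ω) θ) - W.Y s ω) • W.X s ω :=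
    Finset.sum_congr rfl fun s _ => by rw [sub_smul]; abel
  have hgn : ‖g‖ ≤ τ := by
    rw [hgsum]
    refine (norm_sum_le _ _).trans ?_
    calc _ ≤ ∑ s ∈ I, (1 : ℝ) := Finset.sum_le_sum fun s hs => by
          rw [norm_smul]
          refine mul_le_one₀ ?_ (norm_nonneg _) (hX s hs)
          have h1 := B.μ_mem (inner ℝ (W.X s ω) θ)
          have h2 := hY s hs
          rw [Real.norm_eq_abs, abs_le]
          constructor <;> linarith [h1.1, h1.2, h2.1, h2.2]
      _ = τ := by simp [hcard]
  set ξ := ∑ s ∈ I, inner ℝ (W.X s ω) δ * W.noise B s ω with hξ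
  -- Curvature times block moment is at least `7/8 c₃ τ lam ≥ 7/8 · 2α`; with step `1/(α q)` this
  -- becomes the contraction `7/(2q)`.
  have hinner : 7 / 4 * α * ‖δ‖ ^ 2 - ξ ≤ inner ℝ δ g := by
    have h1 : inner ℝ δ g
        = ∑ s ∈ I, (B.μ (inner ℝ (W.X s ω) θ) - W.Y s ω) * inner ℝ (W.X s ω) δ := by
      rw [hgsum, inner_sum]
      exact Finset.sum_congr rfl fun s _ => by rw [real_inner_smul_right, real_inner_comm δ]
    have h2 : ∀ s ∈ I, cEta B.μ B.θstar 3 * (inner ℝ δ (W.X s ω)) ^ 2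
        - inner ℝ (W.X s ω) δ * W.noise B s ω
        ≤ (B.μ (inner ℝ (W.X s ω) θ) - W.Y s ω) * inner ℝ (W.X s ω) δ := by
      intro s hs
      have := B.cEta_mul_sq_le (η := 3) (x := W.X s ω) (θ := θ) (hX s hs) (norm_sgd_sub_le hmle _)
      rw [← hδ] at this
      rw [real_inner_comm (W.X s ω) δ]
      simp only [Play.noise]
      linarith
    have h3 := Finset.sum_le_sum h2
    rw [Finset.sum_sub_distrib, ← Finset.mul_sum, ← h1, ← hξ] at h3
    have h4 := mul_le_mul_of_nonneg_left (hmom δ) hc3.le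
    have h5 : 7 / 8 * (2 * α) * ‖δ‖ ^ 2 ≤ 7 / 8 * (cEta B.μ B.θstar 3 * (τ * lam)) * ‖δ‖ ^ 2 := by
      gcongr
    linarith
  have hexp : ‖δ - (1 / (α * q)) • g‖ ^ 2
      = ‖δ‖ ^ 2 - 2 / (α * q) * inner ℝ δ g + ‖g‖ ^ 2 / (α * q) ^ 2 := by
    rw [norm_sub_sq_real, real_inner_smul_right, norm_smul, mul_pow,
      Real.norm_of_nonneg (by positivity)]
    ring
  rw [hexp] at hproj
  have h6 : ‖g‖ ^ 2 / (α * q) ^ 2 ≤ (τ : ℝ) ^ 2 / (α * q) ^ 2 := by gcongr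
  have h7 : 2 / (α * q) * (7 / 4 * α * ‖δ‖ ^ 2 - ξ) ≤ 2 / (α * q) * inner ℝ δ g := by gcongr
  have h8 : 2 / (α * q) * (7 / 4 * α * ‖δ‖ ^ 2 - ξ)
      = 7 / 2 / q * ‖δ‖ ^ 2 - 2 / (α * q) * ξ := by field_simp; ring
  linarith

/-- The event on which stochastic gradient descent converges: the likelihood estimate is good,
the blocks have large second moments and the martingale terms are small. -/
structure GoodRun (W : Play d K Ω) (B : GLBandit d K) (τ : ℕ) (α lam L : ℝ) (J : ℕ) (ω : Ω) :
    Prop where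
  mle : ‖W.mle ω - B.θstar‖ ≤ 1
  score : ∑ t ∈ Finset.Icc 1 τ,
    (W.Y t ω - B.μ (inner ℝ (W.X t ω) (W.mle ω))) • W.X t ω = 0
  X_le : ∀ s, 1 ≤ s → s ≤ J * τ → ‖W.X s ω‖ ≤ 1
  Y_mem : ∀ s, 1 ≤ s → s ≤ J * τ → W.Y s ω ∈ Set.Icc (0 : ℝ) 1
  moment : ∀ q, 2 ≤ q → q ≤ J → ∀ w : Feat d, 7 / 8 * (τ * lam) * ‖w‖ ^ 2
    ≤ ∑ s ∈ Finset.Icc ((q - 1) * τ + 1) (q * τ), (inner ℝ w (W.X s ω)) ^ 2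
  martingale : ∀ j, 1 ≤ j → j ≤ J →
    ∑ q ∈ Finset.Icc 2 j, ∑ s ∈ Finset.Icc ((q - 1) * τ + 1) (q * τ),
      ((α / (4 * (j : ℝ) ^ 2 * τ) * q ^ 2
          * inner ℝ (W.X s ω) (W.sgd B.μ τ α (q - 1) ω - B.θstar)) * W.noise B s ω
        - (α / (4 * (j : ℝ) ^ 2 * τ) * q ^ 2
          * inner ℝ (W.X s ω) (W.sgd B.μ τ α (q - 1) ω - B.θstar)) ^ 2) ≤ L

variable {lam L : ℝ} {J : ℕ}

/-- The likelihood equation makes the first block's gradient vanish, so the first step stays put.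
The recursion can start at block `2`, and no martingale argument reuses first-block data, on which
the estimate depends. -/
theorem GoodRun.sgd_one (h : W.GoodRun B τ α lam L J ω) : W.sgd B.μ τ α 1 ω = W.mle ω := by
  have hg : W.gradLoss B.μ τ 1 ω (W.mle ω) = 0 := by
    rw [← neg_eq_zero, ← h.score, Play.gradLoss, ← Finset.sum_neg_distrib]
    simp only [Nat.sub_self, zero_mul, zero_add, one_mul]
    exact Finset.sum_congr rfl fun s _ => by rw [sub_smul]; abel
  have : W.sgd B.μ τ α 1 ω = projBall (W.mle ω) 2
      (W.mle ω - (1 / (α * ((0 + 1 : ℕ) : ℝ))) • W.gradLoss B.μ τ 1 ω (W.mle ω)) := rfl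
  rw [this, hg, smul_zero, sub_zero, projBall, if_pos (by simp)]

theorem GoodRun.norm_sgd_sub_sq_le (h : W.GoodRun B τ α lam L J ω) (hα : 0 < α) (hτ : 0 < τ)
    (hατ : α ≤ τ) (hlam : 2 * α ≤ cEta B.μ B.θstar 3 * (τ * lam)) (hL : 32 * L ≤ τ) {j : ℕ}
    (hj : 1 ≤ j) (hjJ : j ≤ J) :
    ‖W.sgd B.μ τ α j ω - B.θstar‖ ^ 2 ≤ ((τ : ℝ) / α) ^ 2 / j := by
  have hmem : ∀ q, 2 ≤ q → q ≤ j → ∀ s ∈ Finset.Icc ((q - 1) * τ + 1) (q * τ),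
      1 ≤ s ∧ s ≤ J * τ := by
    intro q _ hqj s hs
    rw [Finset.mem_Icc] at hs
    have : q * τ ≤ J * τ := by gcongr; omega
    omega
  refine descent_recursion (D := fun q => ‖W.sgd B.μ τ α q ω - B.θstar‖ ^ 2)
    (ξ := fun q => ∑ s ∈ Finset.Icc ((q - 1) * τ + 1) (q * τ),
      inner ℝ (W.X s ω) (W.sgd B.μ τ α (q - 1) ω - B.θstar) * W.noise B s ω)
    (Q := fun q => ∑ s ∈ Finset.Icc ((q - 1) * τ + 1) (q * τ),
      (inner ℝ (W.X s ω) (W.sgd B.μ τ α (q - 1) ω - B.θstar)) ^ 2)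
    hα (by exact_mod_cast hτ) hατ (fun q => sq_nonneg _) ?_ hj ?_ ?_ ?_ hL
  · simp only [h.sgd_one]
    exact pow_le_one₀ (norm_nonneg _) h.mle
  · intro q hq hqj
    exact sgd_step hα h.mle hlam (by omega)
      (fun s hs => h.X_le s (hmem q hq hqj s hs).1 (hmem q hq hqj s hs).2)
      (fun s hs => h.Y_mem s (hmem q hq hqj s hs).1 (hmem q hq hqj s hs).2)
      (h.moment q hq (by omega))
  · intro q hq hqj
    calc _ ≤ ∑ s ∈ Finset.Icc ((q - 1) * τ + 1) (q * τ),
          ‖W.sgd B.μ τ α (q - 1) ω - B.θstar‖ ^ 2 := Finset.sum_le_sum fun s hs => by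
            rw [← sq_abs]
            gcongr
            refine (abs_real_inner_le_norm _ _).trans (mul_le_of_le_one_left (norm_nonneg _) ?_)
            exact h.X_le s (hmem q hq hqj s hs).1 (hmem q hq hqj s hs).2
      _ = _ := by rw [Finset.sum_const, card_block (by omega), nsmul_eq_mul]
  · refine le_trans (le_of_eq (Finset.sum_congr rfl fun q _ => ?_)) (h.martingale j hj hjJ)
    rw [Finset.sum_sub_distrib, Finset.mul_sum, Finset.mul_sum]
    congr 1
    · exact Finset.sum_congr rfl fun s _ => by ring
    · exact Finset.sum_congr rfl fun s _ => by ring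

/-- Cauchy–Schwarz turns the squared errors of order `1/q` into a harmonic sum, the origin of `√(1 +
log j)` in `g₂`. -/
theorem GoodRun.norm_sgdAvg_sub_le (h : W.GoodRun B τ α lam L J ω) (hα : 0 < α) (hτ : 0 < τ)
    (hατ : α ≤ τ) (hlam : 2 * α ≤ cEta B.μ B.θstar 3 * (τ * lam)) (hL : 32 * L ≤ τ) {j : ℕ}
    (hj : 1 ≤ j) (hjJ : j ≤ J) :
    ‖W.sgdAvg B.μ τ α j ω - B.θstar‖ ≤ GLBParams.g₂ τ α j / √j := by
  have hj0 : (0 : ℝ) < j := by exact_mod_cast hj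
  have hlog : 0 ≤ Real.log j := Real.log_natCast_nonneg j
  have havg : W.sgdAvg B.μ τ α j ω - B.θstar
      = (1 / (j : ℝ)) • ∑ q ∈ Finset.Icc 1 j, (W.sgd B.μ τ α q ω - B.θstar) := by
    rw [Play.sgdAvg, Finset.sum_sub_distrib, smul_sub, Finset.sum_const, Nat.card_Icc,
      Nat.add_sub_cancel, ← Nat.cast_smul_eq_nsmul ℝ, smul_smul, one_div,
      inv_mul_cancel₀ hj0.ne', one_smul]
  have hsq : ‖W.sgdAvg B.μ τ α j ω - B.θstar‖ ^ 2 ≤ ((τ : ℝ) / α) ^ 2 * (1 + Real.log j) / j := by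
    rw [havg, norm_smul, mul_pow, Real.norm_of_nonneg (by positivity)]
    have h1 : ‖∑ q ∈ Finset.Icc 1 j, (W.sgd B.μ τ α q ω - B.θstar)‖ ^ 2
        ≤ j * (((τ : ℝ) / α) ^ 2 * (1 + Real.log j)) := by
      calc _ ≤ (∑ q ∈ Finset.Icc 1 j, ‖W.sgd B.μ τ α q ω - B.θstar‖) ^ 2 := by
            gcongr; exact norm_sum_le _ _
        _ ≤ (Finset.Icc 1 j).card * ∑ q ∈ Finset.Icc 1 j, ‖W.sgd B.μ τ α q ω - B.θstar‖ ^ 2 :=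
            sq_sum_le_card_mul_sum_sq
        _ ≤ j * ∑ q ∈ Finset.Icc 1 j, ((τ : ℝ) / α) ^ 2 * (1 / q) := by
            rw [Nat.card_Icc, Nat.add_sub_cancel]
            gcongr with q hq
            rw [Finset.mem_Icc] at hq
            rw [mul_one_div]
            exact h.norm_sgd_sub_sq_le hα hτ hατ hlam hL hq.1 (hq.2.trans hjJ)
        _ ≤ _ := by
            rw [← Finset.mul_sum]
            gcongr
            exact sum_Icc_inv_le_one_add_log j
    calc (1 / (j : ℝ)) ^ 2 * _
        ≤ (1 / (j : ℝ)) ^ 2 * (j * (((τ : ℝ) / α) ^ 2 * (1 + Real.log j))) := by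
          gcongr
      _ = _ := by field_simp
  rw [GLBParams.g₂]
  refine le_of_sq_le_sq (hsq.trans_eq ?_) (by positivity)
  rw [div_pow _ (√(j : ℝ)), mul_pow, Real.sq_sqrt (by linarith), Real.sq_sqrt hj0.le]

end Play

namespace GLBandit

variable {d K : ℕ} (B : GLBandit d K)

/-! ### Size of the parameters -/

theorem alpha_mul_lambdaF (T : ℕ) :
    B.params.alpha T * lambdaF B.ν B.best = max (d : ℝ) (Real.log T) := by
  have h : max (cEta B.μ B.θstar 3) (d : ℝ) = d :=
    max_eq_right (B.c₃_le_one.trans (by exact_mod_cast B.d_pos))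
  show max (max (cEta B.μ B.θstar 3) (d : ℝ)) (Real.log T) / lambdaF B.ν B.best * _ = _
  rw [h, div_mul_cancel₀ _ B.lambdaF_pos.ne']

theorem one_le_d (B : GLBandit d K) : (1 : ℝ) ≤ d := by exact_mod_cast B.d_pos

theorem alpha_pos (T : ℕ) : 0 < B.params.alpha T := by
  have h := B.alpha_mul_lambdaF T
  have h1 : 0 < max (d : ℝ) (Real.log T) :=
    lt_of_lt_of_le (by linarith [B.one_le_d]) (le_max_left _ _)
  exact pos_of_mul_pos_left (h ▸ h1) B.lambdaF_pos.le

theorem le_tau (C₁ C₂ : ℝ) (T : ℕ) :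
    B.params.tau₁ C₁ C₂ T ≤ B.params.tau C₁ C₂ T
      ∧ B.params.tau₂ C₁ C₂ T (B.params.alpha T) ≤ B.params.tau C₁ C₂ T :=
  ⟨(le_max_left _ _).trans (Nat.le_ceil _), (le_max_right _ _).trans (Nat.le_ceil _)⟩

theorem sq_add_le_sq_sqrt {C a b : ℝ} (ha : 0 ≤ a) (hb : 0 ≤ b) :
    C ^ 2 * (a + b) ≤ (C * √a + C * √b) ^ 2 := by
  have h1 := Real.sq_sqrt ha
  have h2 := Real.sq_sqrt hb
  have h3 : 0 ≤ C ^ 2 * (√a * √b) := by positivity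
  calc C ^ 2 * (a + b) = C ^ 2 * (√a ^ 2 + √b ^ 2) := by rw [h1, h2]
    _ ≤ C ^ 2 * (√a ^ 2 + √b ^ 2) + 2 * (C ^ 2 * (√a * √b)) := by linarith
    _ = _ := by ring

variable (T : ℕ)

/-- With both universal constants equal to `1000`, dropping the cross term in the square leaves the
factor `10 ^ 6`, generous enough for every use below. -/
theorem first_le_tau_mul : 10 ^ 6 * (d + 2 * Real.log T)
    ≤ B.params.tau 1000 1000 T * (B.σ₀ ^ 2) ^ 2 := by
  have hlog : 0 ≤ Real.log T := Real.log_natCast_nonneg T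
  have h := (B.le_tau 1000 1000 T).1
  have hσ := B.σ₀_pos
  have h1 : ((1000 * √(d : ℝ) + 1000 * √(2 * Real.log T)) / B.σ₀ ^ 2) ^ 2
      ≤ B.params.tau 1000 1000 T := by
    refine le_trans ?_ h
    have : 0 ≤ 32 * B.R ^ 2 * ((d : ℝ) + 2 * Real.log T)
      / (cEta B.μ B.θstar 1 ^ 2 * B.σ₀ ^ 2) := by positivity
    exact le_add_of_nonneg_right this
  rw [div_pow, div_le_iff₀ (by positivity)] at h1
  refine le_trans ?_ h1
  have := sq_add_le_sq_sqrt (C := 1000) (a := d) (b := 2 * Real.log T) (by positivity)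
    (by positivity)
  linarith

theorem noise_le_tau_mul : 32 * B.R ^ 2 * (d + 2 * Real.log T)
    ≤ B.params.tau 1000 1000 T * (cEta B.μ B.θstar 1 ^ 2 * B.σ₀ ^ 2) := by
  have h := (B.le_tau 1000 1000 T).1
  have hσ := B.σ₀_pos
  have hc := B.c₁_pos
  have h1 : 32 * B.R ^ 2 * ((d : ℝ) + 2 * Real.log T) / (cEta B.μ B.θstar 1 ^ 2 * B.σ₀ ^ 2)
      ≤ B.params.tau 1000 1000 T :=
    le_trans (le_add_of_nonneg_left (sq_nonneg _)) h
  rwa [div_le_iff₀ (by positivity)] at h1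

theorem block_le_tau_mul : 10 ^ 6 * (d + 3 * Real.log T)
    ≤ B.params.tau 1000 1000 T * lambdaF B.ν B.best ^ 2 := by
  have hlog : 0 ≤ Real.log T := Real.log_natCast_nonneg T
  have h := (B.le_tau 1000 1000 T).2
  have hl := B.lambdaF_pos
  have hα := B.alpha_pos T
  have hc := B.c₃_pos
  have h1 : ((1000 * √(d : ℝ) + 1000 * √(3 * Real.log T)) / lambdaF B.ν B.best) ^ 2
      ≤ B.params.tau 1000 1000 T := by
    refine le_trans ?_ h
    have : 0 ≤ 2 * B.params.alpha T / (cEta B.μ B.θstar 3 * lambdaF B.ν B.best) := by positivity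
    exact le_add_of_nonneg_right this
  rw [div_pow, div_le_iff₀ (by positivity)] at h1
  refine le_trans ?_ h1
  have := sq_add_le_sq_sqrt (C := 1000) (a := d) (b := 3 * Real.log T) (by positivity)
    (by positivity)
  linarith

theorem two_alpha_le : 2 * B.params.alpha T
    ≤ cEta B.μ B.θstar 3 * (B.params.tau 1000 1000 T * lambdaF B.ν B.best) := by
  have h := (B.le_tau 1000 1000 T).2
  have hl := B.lambdaF_pos
  have hc := B.c₃_pos
  have h1 : 2 * B.params.alpha T / (cEta B.μ B.θstar 3 * lambdaF B.ν B.best)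
      ≤ B.params.tau 1000 1000 T :=
    le_trans (le_add_of_nonneg_left (sq_nonneg _)) h
  rw [div_le_iff₀ (by positivity)] at h1
  linarith

theorem le_tau_of_le {x : ℝ} (hx : x ≤ 10 ^ 6 * (d + 3 * Real.log T)) :
    x ≤ B.params.tau 1000 1000 T := by
  refine hx.trans ((B.block_le_tau_mul T).trans (mul_le_of_le_one_right (by positivity) ?_))
  exact pow_le_one₀ B.lambdaF_pos.le B.lambdaF_le_one

theorem million_le_tau : (10 : ℝ) ^ 6 ≤ B.params.tau 1000 1000 T := by
  refine B.le_tau_of_le T ?_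
  have hlog : 0 ≤ Real.log T := Real.log_natCast_nonneg T
  linarith [B.one_le_d]

theorem tau_pos : 0 < B.params.tau 1000 1000 T := by
  have h := B.million_le_tau T
  have : (0 : ℝ) < B.params.tau 1000 1000 T := by linarith
  exact_mod_cast this

theorem alpha_le_tau : B.params.alpha T ≤ B.params.tau 1000 1000 T := by
  have hlog : 0 ≤ Real.log T := Real.log_natCast_nonneg T
  have h := B.block_le_tau_mul T
  have h1 := B.alpha_mul_lambdaF T
  have h2 : max (d : ℝ) (Real.log T) ≤ 10 ^ 6 * (d + 3 * Real.log T) :=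
    max_le (by linarith [B.one_le_d]) (by linarith [B.one_le_d])
  have hl := B.lambdaF_pos
  refine le_of_mul_le_mul_right ?_ hl
  rw [h1]
  refine (h2.trans h).trans ?_
  rw [sq, ← mul_assoc]
  exact mul_le_of_le_one_right (by positivity) B.lambdaF_le_one

theorem tsVar_pos {α : ℝ} {τ j : ℕ} (hα : 0 < α) (hτ : 0 < τ) (hj : 1 ≤ j) :
    0 < B.params.tsVar T τ α j := by
  have hc : 0 < B.params.c₃ := B.c₃_pos
  have hj' : (0 : ℝ) < j := by exact_mod_cast hj
  have hτ' : (0 : ℝ) < τ := by exact_mod_cast hτ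
  have hlog : 0 ≤ Real.log j := Real.log_natCast_nonneg j
  have h2 : 0 < GLBParams.g₂ τ α j := by
    unfold GLBParams.g₂
    have : 0 < √(1 + Real.log j) := Real.sqrt_pos.mpr (by linarith)
    positivity
  unfold GLBParams.tsVar
  positivity

theorem exp_neg_mul_log {T : ℕ} (hT : 0 < T) (k : ℕ) :
    Real.exp (-(k * Real.log T)) = 1 / (T : ℝ) ^ k := by
  rw [Real.exp_neg, ← Real.log_pow, Real.exp_log (by positivity), one_div]

/-- After multiplication by `σ₀²`, the negative term is at least `10⁶/1024 (d + 2 log T)`, which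
beats `402 d` and the required `2 log T`. -/
theorem first_moment_exp_le {T : ℕ} (hT : 0 < T) :
    Real.exp (402 * d / B.σ₀ ^ 2 - B.params.tau 1000 1000 T * B.σ₀ ^ 2 / 1024)
      ≤ 1 / (T : ℝ) ^ 2 := by
  rw [← exp_neg_mul_log hT 2]
  refine Real.exp_le_exp.mpr ?_
  have h := B.first_le_tau_mul T
  have hσ : 0 < B.σ₀ ^ 2 := by have := B.σ₀_pos; positivity
  have hlog : 0 ≤ Real.log T := Real.log_natCast_nonneg T
  have hs1 := B.σ₀_sq_le_one
  refine le_of_mul_le_mul_right ?_ hσ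
  rw [sub_mul, div_mul_cancel₀ _ hσ.ne']
  have h2 : Real.log T * B.σ₀ ^ 2 ≤ Real.log T := mul_le_of_le_one_right hlog hs1
  push_cast
  have := B.one_le_d
  nlinarith

/-- The third power of `T` leaves room for a union over the blocks. -/
theorem block_moment_exp_le {T : ℕ} (hT : 0 < T) :
    Real.exp (402 * d / lambdaF B.ν B.best
      - B.params.tau 1000 1000 T * lambdaF B.ν B.best / 1024) ≤ 1 / (T : ℝ) ^ 3 := by
  rw [← exp_neg_mul_log hT 3]
  refine Real.exp_le_exp.mpr ?_
  have h := B.block_le_tau_mul T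
  have hl := B.lambdaF_pos
  have hlog : 0 ≤ Real.log T := Real.log_natCast_nonneg T
  have hs1 := B.lambdaF_le_one
  refine le_of_mul_le_mul_right ?_ hl
  rw [sub_mul, div_mul_cancel₀ _ hl.ne']
  have h2 : Real.log T * lambdaF B.ν B.best ≤ Real.log T := mul_le_of_le_one_right hlog hs1
  push_cast
  have := B.one_le_d
  nlinarith

/-- If the maximum is `R`, the noise term of `τ₁` gives the factor `32`; if it is `c₁ / 2`, the
first term of `τ₁` does. Then `8/125 · 32 > 2` beats the entropy `2 d` of the net. -/
theorem first_noise_exp_le {T : ℕ} (hT : 0 < T) :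
    Real.exp (2 * d - 8 / 125 * (B.params.tau 1000 1000 T * cEta B.μ B.θstar 1 ^ 2 * B.σ₀ ^ 2
      / max B.R (cEta B.μ B.θstar 1 / 2) ^ 2)) ≤ 1 / (T : ℝ) ^ 2 := by
  rw [← exp_neg_mul_log hT 2]
  refine Real.exp_le_exp.mpr ?_
  have hlog : 0 ≤ Real.log T := Real.log_natCast_nonneg T
  have hd := B.one_le_d
  have hc := B.c₁_pos
  have hR := B.R_pos
  have key : 32 * (d + 2 * Real.log T) ≤ B.params.tau 1000 1000 T * cEta B.μ B.θstar 1 ^ 2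
      * B.σ₀ ^ 2 / max B.R (cEta B.μ B.θstar 1 / 2) ^ 2 := by
    rcases max_choice B.R (cEta B.μ B.θstar 1 / 2) with hm | hm <;> rw [hm]
    · rw [le_div_iff₀ (by positivity)]
      have := B.noise_le_tau_mul T
      linarith
    · rw [le_div_iff₀ (by positivity)]
      have h1 := B.first_le_tau_mul T
      have hs1 := B.σ₀_sq_le_one
      have h2 : (B.params.tau 1000 1000 T : ℝ) * (B.σ₀ ^ 2) ^ 2
          ≤ B.params.tau 1000 1000 T * B.σ₀ ^ 2 := by
        refine mul_le_mul_of_nonneg_left ?_ (by positivity)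
        rw [sq (B.σ₀ ^ 2)]
        exact mul_le_of_le_one_right (sq_nonneg _) hs1
      have h3 : 8 * (d + 2 * Real.log T) ≤ B.params.tau 1000 1000 T * B.σ₀ ^ 2 := by linarith
      have h4 := mul_le_mul_of_nonneg_right h3 (sq_nonneg (cEta B.μ B.θstar 1))
      linarith
  push_cast
  linarith

end GLBandit

namespace Play.IsSGDTS

variable {d K T : ℕ} {Ω : Type*} [mΩ : MeasurableSpace Ω] {W : Play d K Ω}
  {B : GLBandit d K} {P : Measure Ω}

/-! ### The run is good with high probability -/

theorem goodRun_of_events {τ : ℕ} {α lam L : ℝ} {J : ℕ} (h : W.IsSGDTS B T τ α P)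
    (hτ0 : 0 < τ) (hτ : τ ≤ T) (hJ : J * τ ≤ T) {A : Feat d ≃L[ℝ] Feat d}
    (hA3 : ∀ v, B.σ₀ * ‖v‖ ≤ ‖A v‖)
    {ω : Ω} (hX : ∀ t ∈ Finset.Icc 1 T, ‖W.X t ω‖ ≤ 1)
    (hmom : ∀ w : Feat d, 7 / 8 * τ * ‖A w‖ ^ 2
        ≤ ∑ s ∈ Finset.Icc 1 τ, (inner ℝ w (W.X s ω)) ^ 2)
    (hnoise : ∀ w : Feat d, inner ℝ w (∑ s ∈ Finset.Icc 1 τ, W.noise B s ω • W.X s ω)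
        ≤ ‖A w‖ * (4 / 5 * cEta B.μ B.θstar 1 * τ * B.σ₀))
    (hblock : ∀ q, 2 ≤ q → q ≤ J → ∀ w : Feat d, 7 / 8 * (τ * lam) * ‖w‖ ^ 2
      ≤ ∑ s ∈ Finset.Icc ((q - 1) * τ + 1) (q * τ), (inner ℝ w (W.X s ω)) ^ 2)
    (hmart : ∀ j, 1 ≤ j → j ≤ J →
      ∑ q ∈ Finset.Icc 2 j, ∑ s ∈ Finset.Icc ((q - 1) * τ + 1) (q * τ),
      ((α / (4 * (j : ℝ) ^ 2 * τ) * q ^ 2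
          * inner ℝ (W.X s ω) (W.sgd B.μ τ α (q - 1) ω - B.θstar)) * W.noise B s ω
        - (α / (4 * (j : ℝ) ^ 2 * τ) * q ^ 2
          * inner ℝ (W.X s ω) (W.sgd B.μ τ α (q - 1) ω - B.θstar)) ^ 2) ≤ L) :
    W.GoodRun B τ α lam L J ω := by
  have hX1 : ∀ t ∈ Finset.Icc 1 τ, ‖W.X t ω‖ ≤ 1 := fun t ht => by
    rw [Finset.mem_Icc] at ht
    exact hX t (Finset.mem_Icc.mpr ⟨ht.1, ht.2.trans hτ⟩)
  -- Both sides are in the whitened norm: `4/5 c₁ τ σ₀ ‖A w‖` is below `7/8 c₁ τ ‖A w‖²` because `σ₀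
  -- ≤ ‖A w‖`.
  have hw : ∀ w : Feat d, ‖w‖ = 1 → inner ℝ w (B.score (Finset.Icc 1 τ) (fun t => W.X t ω)
      (fun t => W.Y t ω) B.θstar)
      < cEta B.μ B.θstar 1 * ∑ t ∈ Finset.Icc 1 τ, (inner ℝ w (W.X t ω)) ^ 2 := by
    intro w h1
    have hc := B.c₁_pos
    have hσ := B.σ₀_pos
    have hτ' : (0 : ℝ) < τ := by exact_mod_cast hτ0
    have h2 : B.σ₀ ≤ ‖A w‖ := by simpa [h1] using hA3 w
    have h3 : 0 < ‖A w‖ := hσ.trans_le h2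
    refine lt_of_le_of_lt (hnoise w) (lt_of_lt_of_le ?_ (mul_le_mul_of_nonneg_left (hmom w) hc.le))
    calc ‖A w‖ * (4 / 5 * cEta B.μ B.θstar 1 * τ * B.σ₀)
        ≤ ‖A w‖ * (4 / 5 * cEta B.μ B.θstar 1 * τ * ‖A w‖) := by gcongr
      _ = 4 / 5 * (cEta B.μ B.θstar 1 * τ * ‖A w‖ ^ 2) := by ring
      _ < 7 / 8 * (cEta B.μ B.θstar 1 * τ * ‖A w‖ ^ 2) :=
          mul_lt_mul_of_pos_right (by norm_num) (by positivity)
      _ = _ := by ring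
  have hsol := h.mle_solves hτ ω (B.exists_score_eq_zero hX1 hw)
  exact
    { mle := B.norm_sub_le_one_of_score_eq_zero hX1 hw hsol
      score := hsol
      X_le := fun s h1 h2 => hX s (Finset.mem_Icc.mpr ⟨h1, h2.trans hJ⟩)
      Y_mem := fun s h1 h2 => h.rew_mem s h1 (h2.trans hJ) _ ω
      moment := hblock
      martingale := hmart }

/-- The two first-block events cost `T⁻²` each. There are at most `T` block moments and at most `T`
martingale sums, each failing with probability `T⁻³`. The norm bounds fail only on a null set. -/
theorem measure_not_goodRun_le [IsProbabilityMeasure P]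
    (h : W.IsSGDTS B T (B.params.tau 1000 1000 T) (B.params.alpha T) P)
    (hτ : B.params.tau 1000 1000 T ≤ T) {J : ℕ} (hJ : J * B.params.tau 1000 1000 T ≤ T) :
    P {ω | ¬ W.GoodRun B (B.params.tau 1000 1000 T) (B.params.alpha T) (lambdaF B.ν B.best)
      (3 * Real.log T) J ω} ≤ ENNReal.ofReal (4 / (T : ℝ) ^ 2) := by
  have hτ0 := B.tau_pos T
  have hα := B.alpha_pos T
  have hT : 0 < T := hτ0.trans_le hτ
  have e1 := B.first_moment_exp_le hT
  have e2 := B.first_noise_exp_le hT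
  have e3 := B.block_moment_exp_le hT
  have hJT : J ≤ T := (Nat.le_mul_of_pos_right J hτ0).trans hJ
  have hv : ∀ j, 1 ≤ j → 0 < B.params.tsVar T (B.params.tau 1000 1000 T) (B.params.alpha T) j :=
    fun j hj => B.tsVar_pos T hα hτ0 hj
  generalize B.params.tau 1000 1000 T = τ at *
  generalize B.params.alpha T = α at *
  obtain ⟨A, hA, hA2, hA3⟩ := B.exists_whitening
  simp_rw [← B.integral_unif_sq] at hA2
  have m1 := (h.measure_not_first_block_moment_le hτ hA hA2 hA3).trans
    (ENNReal.ofReal_le_ofReal e1)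
  have m2 := (h.measure_not_first_block_noise_le hτ hA hA2 hA3 (le_max_left B.R _) B.c₁_pos
    (le_max_right _ _)).trans (ENNReal.ofReal_le_ofReal e2)
  set E1 : Set Ω := {ω | ¬ ∀ w : Feat d, 7 / 8 * τ * ‖A w‖ ^ 2
        ≤ ∑ s ∈ Finset.Icc 1 τ, (inner ℝ w (W.X s ω)) ^ 2} with hE1
  set E2 : Set Ω := {ω | ¬ ∀ w : Feat d, inner ℝ w (∑ s ∈ Finset.Icc 1 τ, W.noise B s ω • W.X s ω)
        ≤ ‖A w‖ * (4 / 5 * cEta B.μ B.θstar 1 * τ * B.σ₀)} with hE2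
  let E3 : ℕ → Set Ω := fun q => {ω | ¬ ∀ w : Feat d, 7 / 8 * (τ * lambdaF B.ν B.best) * ‖w‖ ^ 2
      ≤ ∑ s ∈ Finset.Icc ((q - 1) * τ + 1) (q * τ), (inner ℝ w (W.X s ω)) ^ 2}
  let E4 : ℕ → Set Ω := fun j => {ω | 3 * Real.log T ≤
    ∑ q ∈ Finset.Icc 2 j, ∑ s ∈ Finset.Icc ((q - 1) * τ + 1) (q * τ),
      ((α / (4 * (j : ℝ) ^ 2 * τ) * q ^ 2
          * inner ℝ (W.X s ω) (W.sgd B.μ τ α (q - 1) ω - B.θstar)) * W.noise B s ω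
        - (α / (4 * (j : ℝ) ^ 2 * τ) * q ^ 2
          * inner ℝ (W.X s ω) (W.sgd B.μ τ α (q - 1) ω - B.θstar)) ^ 2)}
  let E0 : Set Ω := {ω | ¬ ∀ t ∈ Finset.Icc 1 T, ‖W.X t ω‖ ≤ 1}
  have m0 : P E0 = 0 := by
    have : ∀ᵐ ω ∂P, ∀ t ∈ Finset.Icc 1 T, ‖W.X t ω‖ ≤ 1 := by
      rw [Finset.eventually_all]
      intro t ht
      rw [Finset.mem_Icc] at ht
      exact h.ae_X_norm_le ht.1 ht.2
    exact this
  have hqT : ∀ q, q ≤ J → q * τ ≤ T := fun q hq => le_trans (by gcongr) hJ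
  have m3 : ∀ q ∈ Finset.Icc 2 J, P (E3 q) ≤ ENNReal.ofReal (1 / (T : ℝ) ^ 3) := fun q hq => by
    rw [Finset.mem_Icc] at hq
    exact (h.measure_not_block_moment_le hτ0 hτ hv hq.1 (hqT q hq.2)).trans
      (ENNReal.ofReal_le_ofReal e3)
  have m4 : ∀ j ∈ Finset.Icc 1 J, P (E4 j) ≤ ENNReal.ofReal (1 / (T : ℝ) ^ 3) := fun j hj => by
    rw [Finset.mem_Icc] at hj
    refine (h.measure_sgd_noise_le hτ0 hτ hj.1 (hqT j hj.2) _ _).trans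
      (ENNReal.ofReal_le_ofReal ?_)
    exact (GLBandit.exp_neg_mul_log hT 3).le
  have hsub : {ω | ¬ W.GoodRun B τ α (lambdaF B.ν B.best) (3 * Real.log T) J ω}
      ⊆ E0 ∪ (E1 ∪ (E2 ∪ ((⋃ q ∈ Finset.Icc 2 J, E3 q) ∪ ⋃ j ∈ Finset.Icc 1 J, E4 j))) := by
    intro ω hω
    by_contra hcon
    simp only [Set.mem_union, not_or, Set.mem_iUnion, not_exists, Finset.mem_Icc] at hcon
    obtain ⟨c0, c1, c2, c3, c4⟩ := hcon
    refine hω (h.goodRun_of_events hτ0 hτ hJ hA3 (not_not.mp c0) (not_not.mp c1) (not_not.mp c2)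
      (fun q h1 h2 => not_not.mp (c3 q ⟨h1, h2⟩)) fun j h1 h2 => ?_)
    exact (not_le.mp (c4 j ⟨h1, h2⟩)).le
  have hsum : ∀ (a : ℕ) (E : ℕ → Set Ω), 1 ≤ a →
      (∀ q ∈ Finset.Icc a J, P (E q) ≤ ENNReal.ofReal (1 / (T : ℝ) ^ 3)) →
      P (⋃ q ∈ Finset.Icc a J, E q) ≤ ENNReal.ofReal (1 / (T : ℝ) ^ 2) := by
    intro a E ha hE
    calc _ ≤ ∑ q ∈ Finset.Icc a J, P (E q) := measure_biUnion_finset_le _ _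
      _ ≤ ∑ q ∈ Finset.Icc a J, ENNReal.ofReal (1 / (T : ℝ) ^ 3) := Finset.sum_le_sum hE
      _ = ENNReal.ofReal ((Finset.Icc a J).card * (1 / (T : ℝ) ^ 3)) := by
          rw [Finset.sum_const, nsmul_eq_mul, ENNReal.ofReal_mul (by positivity),
            ENNReal.ofReal_natCast]
      _ ≤ _ := by
          refine ENNReal.ofReal_le_ofReal ?_
          have hcard : ((Finset.Icc a J).card : ℝ) ≤ T := by
            rw [Nat.card_Icc]; exact_mod_cast (by omega)
          calc _ ≤ (T : ℝ) * (1 / (T : ℝ) ^ 3) := by gcongr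
            _ = _ := by field_simp
  calc _ ≤ _ := measure_mono hsub
    _ ≤ P E0 + (P E1 + (P E2 + (P (⋃ q ∈ Finset.Icc 2 J, E3 q)
        + P (⋃ j ∈ Finset.Icc 1 J, E4 j)))) := by
        refine (measure_union_le _ _).trans (add_le_add le_rfl ?_)
        refine (measure_union_le _ _).trans (add_le_add le_rfl ?_)
        exact (measure_union_le _ _).trans (add_le_add le_rfl (measure_union_le _ _))
    _ ≤ 0 + (ENNReal.ofReal (1 / (T : ℝ) ^ 2) + (ENNReal.ofReal (1 / (T : ℝ) ^ 2)
        + (ENNReal.ofReal (1 / (T : ℝ) ^ 2) + ENNReal.ofReal (1 / (T : ℝ) ^ 2)))) :=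
        add_le_add m0.le (add_le_add m1 (add_le_add m2 (add_le_add (hsum 2 E3 (by norm_num) m3)
          (hsum 1 E4 le_rfl m4))))
    _ = _ := by
        rw [zero_add, ← ENNReal.ofReal_add (by positivity) (by positivity),
          ← ENNReal.ofReal_add (by positivity) (by positivity),
          ← ENNReal.ofReal_add (by positivity) (by positivity)]
        congr 1; ring

/-! ### The Thompson draws -/

/-- The draw precedes the context and is independent of it. For a fixed context each inner product
is a centred Gaussian of variance at most one; the factor `2 K` counts signs and arms. -/
theorem measure_draw_tail_le {τ : ℕ} {α : ℝ} [IsProbabilityMeasure P] (h : W.IsSGDTS B T τ α P)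
    {j t : ℕ} (hj : 1 ≤ j) (hjt : j * τ < t) (htT : t ≤ T) {u : ℝ} (hu : 0 ≤ u) :
    P {ω | ∃ a, u ≤ |inner ℝ (W.ctx t ω a) (W.Z j ω)|}
      ≤ ENNReal.ofReal (2 * K * Real.exp (-u ^ 2 / 2)) := by
  have hind : IndepFun (W.ctx t) (W.Z j) P := by
    rw [IndepFun_iff_Indep]
    exact indep_of_indep_of_le_right (h.ctx_indep t (by omega) htT)
      (W.measurable_Z_pre hj hjt).comap_le
  have hmap := (indepFun_iff_map_prod_eq_prod_map_map (h.ctx_measurable t).aemeasurable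
    (h.Z_measurable j).aemeasurable).mp hind
  rw [h.ctx_law t (by omega) htT, h.Z_law j hj (by omega)] at hmap
  have hone : ∀ (a : Fin K) (c : ℝ), |c| = 1 → P {ω | u ≤ inner ℝ (c • W.ctx t ω a) (W.Z j ω)}
      ≤ ENNReal.ofReal (Real.exp (-u ^ 2 / 2)) := by
    intro a c hc
    have hS : MeasurableSet {q : (Fin K → Feat d) × Feat d | u ≤ inner ℝ (c • q.1 a) q.2} :=
      measurableSet_le measurable_const
        ((((measurable_feat_apply a).comp measurable_fst).fun_const_smul c).inner measurable_snd)
    have h1 : P {ω | u ≤ inner ℝ (c • W.ctx t ω a) (W.Z j ω)}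
        = (B.ν.prod (stdGaussian (Feat d))) {q | u ≤ inner ℝ (c • q.1 a) q.2} := by
      rw [← hmap, Measure.map_apply ((h.ctx_measurable t).prodMk (h.Z_measurable j)) hS]
      rfl
    rw [h1, Measure.prod_apply hS]
    calc _ ≤ ∫⁻ _, ENNReal.ofReal (Real.exp (-u ^ 2 / 2)) ∂B.ν := by
          refine lintegral_mono_ae ?_
          filter_upwards [B.norm_le] with x hx
          refine stdGaussian_inner_ge_le (w := c • x a) ?_ hu
          rw [norm_smul, Real.norm_eq_abs, hc, one_mul]
          exact hx a
      _ = _ := by simp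
  calc _ ≤ P (⋃ a : Fin K, ({ω | u ≤ inner ℝ ((1 : ℝ) • W.ctx t ω a) (W.Z j ω)}
        ∪ {ω | u ≤ inner ℝ ((-1 : ℝ) • W.ctx t ω a) (W.Z j ω)})) := by
        refine measure_mono fun ω hω => ?_
        obtain ⟨a, ha⟩ := hω
        rw [Set.mem_iUnion]
        refine ⟨a, ?_⟩
        rcases le_abs.mp ha with h1 | h1
        · left; simpa using h1
        · right; simpa using h1
    _ ≤ ∑ a : Fin K, (ENNReal.ofReal (Real.exp (-u ^ 2 / 2))
        + ENNReal.ofReal (Real.exp (-u ^ 2 / 2))) := by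
        refine (measure_iUnion_fintype_le _ _).trans (Finset.sum_le_sum fun a _ => ?_)
        exact (measure_union_le _ _).trans
          (add_le_add (hone a 1 (by simp)) (hone a (-1) (by simp)))
    _ = _ := by
        rw [← ENNReal.ofReal_add (by positivity) (by positivity), Finset.sum_const,
          Finset.card_univ, Fintype.card_fin, nsmul_eq_mul, ← ENNReal.ofReal_natCast,
          ← ENNReal.ofReal_mul (by positivity)]
        congr 1; ring

end Play.IsSGDTS

/-! ### Expectations and sums over blocks -/

theorem integral_le_add_of_measure_lt_le {Ω : Type*} [MeasurableSpace Ω] {P : Measure Ω}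
    [IsProbabilityMeasure P] {f : Ω → ℝ} (hf : Measurable f) (h0 : ∀ ω, 0 ≤ f ω)
    (h1 : ∀ ω, f ω ≤ 1) {c ε : ℝ} (hc : 0 ≤ c) (hε : 0 ≤ ε)
    (hP : P {ω | c < f ω} ≤ ENNReal.ofReal ε) : ∫ ω, f ω ∂P ≤ c + ε := by
  have hS : MeasurableSet {ω | c < f ω} := measurableSet_lt measurable_const hf
  have h_integrable : Integrable f P := Integrable.of_bound hf.aestronglyMeasurable 1
    (ae_of_all _ fun ω => by rw [Real.norm_of_nonneg (h0 ω)]; exact h1 ω)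
  have hind : Integrable ({ω | c < f ω}.indicator fun _ => (1 : ℝ)) P :=
    (integrable_const 1).indicator hS
  calc ∫ ω, f ω ∂P ≤ ∫ ω, (c + {ω | c < f ω}.indicator (fun _ => (1 : ℝ)) ω) ∂P := by
        refine integral_mono h_integrable ((integrable_const c).add hind) fun ω => ?_
        by_cases hω : c < f ω
        · rw [Set.indicator_of_mem (by exact hω)]; linarith [h1 ω]
        · rw [Set.indicator_of_notMem (by exact hω)]; linarith [not_lt.mp hω]
    _ = c + P.real {ω | c < f ω} := by
        rw [integral_add (integrable_const c) hind, integral_indicator hS]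
        simp
    _ ≤ c + ε := by
        gcongr
        exact ENNReal.toReal_le_of_le_ofReal hε hP

theorem sum_Icc_inv_sqrt_le (J : ℕ) : ∑ j ∈ Finset.Icc 1 J, 1 / √(j : ℝ) ≤ 2 * √(J : ℝ) := by
  induction J with
  | zero => simp
  | succ n ih =>
    rw [Finset.sum_Icc_succ_top (by omega)]
    have h1 : 0 < √((n + 1 : ℕ) : ℝ) := Real.sqrt_pos.mpr (by positivity)
    have h2 : √((n + 1 : ℕ) : ℝ) ^ 2 = √(n : ℝ) ^ 2 + 1 := by
      rw [Real.sq_sqrt (by positivity), Real.sq_sqrt (by positivity)]; push_cast; ring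
    have h3 : 1 / √((n + 1 : ℕ) : ℝ) ≤ 2 * √((n + 1 : ℕ) : ℝ) - 2 * √(n : ℝ) := by
      rw [div_le_iff₀ h1]
      nlinarith [sq_nonneg (√((n + 1 : ℕ) : ℝ) - √(n : ℝ))]
    linarith

/-- Cauchy–Schwarz against the harmonic sum. The leading factor is `1` instead of the `2` of
`sum_Icc_inv_sqrt_le`, so that `p ≥ 2` suffices for the perturbation term. -/
theorem sum_Icc_inv_sqrt_le_sqrt_log (J : ℕ) :
    ∑ j ∈ Finset.Icc 1 J, 1 / √(j : ℝ) ≤ √(J : ℝ) * √(1 + Real.log J) := by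
  have hlog : 0 ≤ Real.log J := Real.log_natCast_nonneg J
  rw [← Real.sqrt_mul (by positivity)]
  refine Real.le_sqrt_of_sq_le ?_
  calc _ ≤ ((Finset.Icc 1 J).card : ℝ) * ∑ j ∈ Finset.Icc 1 J, (1 / √(j : ℝ)) ^ 2 :=
        sq_sum_le_card_mul_sum_sq
    _ = J * ∑ j ∈ Finset.Icc 1 J, 1 / (j : ℝ) := by
        rw [Nat.card_Icc, Nat.add_sub_cancel]
        congr 1
        exact Finset.sum_congr rfl fun j _ => by
          rw [div_pow, one_pow, Real.sq_sqrt (by positivity)]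
    _ ≤ _ := by gcongr; exact sum_Icc_inv_le_one_add_log J

/-- The possibly incomplete last block is filled up, as `F ≥ 0`; the rounds of block `q` use index
`q - 1`. -/
theorem sum_block_index_le {F : ℕ → ℝ} (hF : ∀ j, 0 ≤ F j) {τ T : ℕ} (hτ : 0 < τ) :
    ∑ t ∈ Finset.Ico (τ + 1) (T + 1), F ((t - 1) / τ) ≤ τ * ∑ j ∈ Finset.Icc 1 (T / τ), F j := by
  have hT : T + 1 ≤ (T / τ + 1) * τ + 1 := by
    have := Nat.div_add_mod T τ
    have := Nat.mod_lt T hτ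
    have : (T / τ + 1) * τ = τ * (T / τ) + τ := by ring
    omega
  calc _ ≤ ∑ t ∈ Finset.Ico (τ + 1) ((T / τ + 1) * τ + 1), F ((t - 1) / τ) :=
        Finset.sum_le_sum_of_subset_of_nonneg (Finset.Ico_subset_Ico_right hT) fun _ _ _ => hF _
    _ = ∑ q ∈ Finset.Icc 2 (T / τ + 1), ∑ t ∈ Finset.Icc ((q - 1) * τ + 1) (q * τ),
          F ((t - 1) / τ) := Finset.sum_Ico_blocks _ τ (Nat.le_add_left 1 _)
    _ = ∑ q ∈ Finset.Icc 2 (T / τ + 1), τ * F (q - 1) := by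
        refine Finset.sum_congr rfl fun q hq => ?_
        rw [Finset.mem_Icc] at hq
        rw [Finset.sum_congr rfl (g := fun _ => F (q - 1)), Finset.sum_const,
          Play.card_block (by omega), nsmul_eq_mul]
        intro t ht
        rw [Finset.mem_Icc] at ht
        congr 1
        obtain ⟨r, rfl⟩ : ∃ r, q = r + 1 := ⟨q - 1, by omega⟩
        rw [Nat.add_sub_cancel] at ht ⊢
        have : (r + 1) * τ = r * τ + τ := by ring
        exact Nat.div_eq_of_lt_le (by omega) (by omega)
    _ = _ := by
        rw [← Finset.mul_sum]
        congr 1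
        refine Finset.sum_nbij' (fun q => q - 1) (fun j => j + 1) ?_ ?_ ?_ ?_ ?_ <;>
          simp only [Finset.mem_Icc] <;> intros <;> first | omega | trivial

/-! ### The regret of a single round -/

namespace Play

variable {d K : ℕ} {Ω : Type*} (W : Play d K Ω) (B : GLBandit d K)

/-- The regret of round `t`. -/
def instRegret (t : ℕ) (ω : Ω) : ℝ :=
  (⨆ a : Fin K, B.μ (inner ℝ (W.ctx t ω a) B.θstar)) - B.μ (inner ℝ (W.X t ω) B.θstar)

theorem instRegret_nonneg (t : ℕ) (ω : Ω) : 0 ≤ W.instRegret B t ω :=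
  sub_nonneg.mpr (le_ciSup (f := fun a => B.μ (inner ℝ (W.ctx t ω a) B.θstar))
    (Set.finite_range _).bddAbove (W.arm t ω))

theorem instRegret_le_one (t : ℕ) (ω : Ω) : W.instRegret B t ω ≤ 1 := by
  have : Nonempty (Fin K) := ⟨W.arm t ω⟩
  have h1 : (⨆ a : Fin K, B.μ (inner ℝ (W.ctx t ω a) B.θstar)) ≤ 1 :=
    ciSup_le fun a => (B.μ_mem _).2
  have h2 := (B.μ_mem (inner ℝ (W.X t ω) B.θstar)).1
  rw [instRegret]; linarith

theorem regret_eq_sum (T : ℕ) (ω : Ω) :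
    W.regret B T ω = ∑ t ∈ Finset.Icc 1 T, W.instRegret B t ω := rfl

namespace IsSGDTS

variable {W B} {T τ : ℕ} {α : ℝ} [mΩ : MeasurableSpace Ω] {P : Measure Ω}

theorem measurable_instRegret (h : W.IsSGDTS B T τ α P) (t : ℕ) :
    Measurable (W.instRegret B t) := by
  refine Measurable.sub (Measurable.iSup fun a => ?_) ?_
  · exact B.continuous_μ.measurable.comp
      (((measurable_feat_apply a).comp (h.ctx_measurable t)).inner measurable_const)
  · exact B.continuous_μ.measurable.comp ((h.measurable_X t).inner measurable_const)

theorem integrable_instRegret [IsProbabilityMeasure P] (h : W.IsSGDTS B T τ α P) (t : ℕ) :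
    Integrable (W.instRegret B t) P :=
  Integrable.of_bound (h.measurable_instRegret t).aestronglyMeasurable 1
    (ae_of_all _ fun ω => by
      rw [Real.norm_of_nonneg (W.instRegret_nonneg B t ω)]; exact W.instRegret_le_one B t ω)

theorem integrable_regret [IsProbabilityMeasure P] (h : W.IsSGDTS B T τ α P) :
    Integrable (W.regret B T) P := by
  have : W.regret B T = fun ω => ∑ t ∈ Finset.Icc 1 T, W.instRegret B t ω := rfl
  rw [this]
  exact integrable_finsetSum _ fun t _ => h.integrable_instRegret t

theorem integral_regret [IsProbabilityMeasure P] (h : W.IsSGDTS B T τ α P) :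
    ∫ ω, W.regret B T ω ∂P = ∑ t ∈ Finset.Icc 1 T, ∫ ω, W.instRegret B t ω ∂P := by
  simp_rw [regret_eq_sum]
  exact integral_finsetSum _ fun t _ => h.integrable_instRegret t

theorem integral_instRegret_le_one [IsProbabilityMeasure P] (h : W.IsSGDTS B T τ α P) (t : ℕ) :
    ∫ ω, W.instRegret B t ω ∂P ≤ 1 := by
  have := integral_mono (h.integrable_instRegret t) (integrable_const (1 : ℝ))
    (W.instRegret_le_one B t)
  simpa using this

/-- The regret of a round in which the estimate and the draw are under control. -/
theorem instRegret_le (h : W.IsSGDTS B T τ α P) {t : ℕ} (ht : τ < t) (htT : t ≤ T) {ω : Ω}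
    (hx : ∀ a, ‖W.ctx t ω a‖ ≤ 1) {e u : ℝ}
    (he : ‖W.sgdAvg B.μ τ α ((t - 1) / τ) ω - B.θstar‖ ≤ e)
    (hu : ∀ a, |inner ℝ (W.ctx t ω a) (W.Z ((t - 1) / τ) ω)| ≤ u) :
    W.instRegret B t ω ≤ 2 * B.L * (e + u * √(B.params.tsVar T τ α ((t - 1) / τ))) := by
  have hne : Nonempty (Fin K) := ⟨W.arm t ω⟩
  obtain ⟨a, ha⟩ := exists_eq_ciSup_of_finite (f := fun a => B.μ (inner ℝ (W.ctx t ω a) B.θstar))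
  rw [instRegret, ← ha]
  have hmax := h.inner_le_of_arm_max ht htT ω a
  have hTS : W.thetaTS B T τ α ((t - 1) / τ) ω = W.sgdAvg B.μ τ α ((t - 1) / τ) ω
    + √(B.params.tsVar T τ α ((t - 1) / τ)) • W.Z ((t - 1) / τ) ω := rfl
  rw [hTS] at hmax
  set s := √(B.params.tsVar T τ α ((t - 1) / τ)) with hs
  have hs0 : 0 ≤ s := Real.sqrt_nonneg _
  set θ := W.sgdAvg B.μ τ α ((t - 1) / τ) ω with hθ
  set z := W.Z ((t - 1) / τ) ω
  have he0 : 0 ≤ e := (norm_nonneg _).trans he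
  have hu0 : 0 ≤ u := (abs_nonneg _).trans (hu a)
  have hL := B.L_pos
  have hin : ∀ b, |inner ℝ (W.ctx t ω b) (θ - B.θstar)| ≤ e := fun b =>
    (abs_real_inner_le_norm _ _).trans
      ((mul_le_of_le_one_left (norm_nonneg _) (hx b)).trans he)
  have hXb : W.X t ω = W.ctx t ω (W.arm t ω) := rfl
  rcases le_total (inner ℝ (W.ctx t ω a) B.θstar) (inner ℝ (W.X t ω) B.θstar) with hle | hle
  · have h1 := B.strictMono.monotone hle
    have h2 : 0 ≤ 2 * B.L * (e + u * s) := by positivity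
    linarith
  · refine (B.sub_le_L_mul hle).trans ?_
    have h1 := abs_le.mp (hin a)
    have h2 := abs_le.mp (hin (W.arm t ω))
    have h3 := abs_le.mp (hu a)
    have h4 := abs_le.mp (hu (W.arm t ω))
    rw [← hXb, inner_sub_right] at h2
    rw [inner_sub_right] at h1
    rw [← hXb] at h4
    rw [inner_add_right, inner_add_right, real_inner_smul_right, real_inner_smul_right] at hmax
    -- Both arms are transferred from `θstar` to the Thompson sample, where the pulled arm wins;
    -- each transfer costs `e + u s`.
    have h5 : inner ℝ (W.ctx t ω a) B.θstar - inner ℝ (W.X t ω) B.θstar ≤ 2 * (e + u * s) := by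
      have h6 := mul_le_mul_of_nonneg_left h3.1 hs0
      have h7 := mul_le_mul_of_nonneg_left h4.2 hs0
      linarith [h1.1, h1.2, h2.1, h2.2]
    calc _ ≤ B.L * (2 * (e + u * s)) := by gcongr
      _ = _ := by ring

/-- The regret of a round is at most `1` on the exceptional event, whose probability is `4/T²` for
the run plus `2/T²` for the draw. -/
theorem integral_instRegret_le [IsProbabilityMeasure P]
    (h : W.IsSGDTS B T (B.params.tau 1000 1000 T) (B.params.alpha T) P)
    (hτ : B.params.tau 1000 1000 T ≤ T) {t j : ℕ} (ht : B.params.tau 1000 1000 T < t)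
    (htT : t ≤ T) (hj : (t - 1) / B.params.tau 1000 1000 T = j) :
    ∫ ω, W.instRegret B t ω ∂P ≤ 2 * B.L
      * (GLBParams.g₂ (B.params.tau 1000 1000 T) (B.params.alpha T) j / √j
        + √(2 * Real.log (K * B.params.tau 1000 1000 T * (T : ℝ) ^ 2))
          * √(B.params.tsVar T (B.params.tau 1000 1000 T) (B.params.alpha T) j))
      + 6 / (T : ℝ) ^ 2 := by
  have hτ0 := B.tau_pos T
  have hα := B.alpha_pos T
  have hατ := B.alpha_le_tau T
  have hlam := B.two_alpha_le T
  have hT : 0 < T := hτ0.trans_le hτ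
  have hlog : 0 ≤ Real.log T := Real.log_natCast_nonneg T
  have hL32 : 32 * (3 * Real.log T) ≤ B.params.tau 1000 1000 T :=
    B.le_tau_of_le T (by linarith [B.one_le_d])
  have hgood := h.measure_not_goodRun_le hτ (J := T / B.params.tau 1000 1000 T)
    (Nat.div_mul_le_self _ _)
  generalize B.params.tau 1000 1000 T = τ at *
  generalize B.params.alpha T = α at *
  obtain ⟨h1, h2, h3⟩ := block_index hτ0 ht
  rw [hj] at h1 h2 h3
  have hjJ : j ≤ T / τ := by rw [← hj]; exact Nat.div_le_div_right (by omega)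
  have hK : (1 : ℝ) ≤ K := by exact_mod_cast B.K_pos
  have hτ1 : (1 : ℝ) ≤ τ := by exact_mod_cast hτ0
  have hT1 : (1 : ℝ) ≤ T := by exact_mod_cast hT
  have hKT : 1 ≤ (K : ℝ) * τ * (T : ℝ) ^ 2 :=
    one_le_mul_of_one_le_of_one_le (one_le_mul_of_one_le_of_one_le hK hτ1) (one_le_pow₀ hT1)
  set u := √(2 * Real.log (K * τ * (T : ℝ) ^ 2)) with hu
  have hu0 : 0 ≤ u := Real.sqrt_nonneg _
  have husq : u ^ 2 = 2 * Real.log (K * τ * (T : ℝ) ^ 2) :=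
    Real.sq_sqrt (mul_nonneg zero_le_two (Real.log_nonneg hKT))
  have htail := h.measure_draw_tail_le h1 h2 htT hu0
  -- The choice of `u` makes `exp (-u²/2)` equal to `1 / (K τ T²)`, which pays for the union over
  -- arms.
  have htail' : 2 * K * Real.exp (-u ^ 2 / 2) ≤ 2 / (T : ℝ) ^ 2 := by
    have : -u ^ 2 / 2 = -Real.log (K * τ * (T : ℝ) ^ 2) := by rw [husq]; ring
    rw [this, Real.exp_neg, Real.exp_log (by linarith)]
    calc 2 * (K : ℝ) * ((K : ℝ) * τ * (T : ℝ) ^ 2)⁻¹ = 2 / (τ * (T : ℝ) ^ 2) := by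
          field_simp
      _ ≤ 2 / (1 * (T : ℝ) ^ 2) := by gcongr
      _ = _ := by rw [one_mul]
  have hg0 : 0 ≤ GLBParams.g₂ τ α j / √j := by
    unfold GLBParams.g₂; positivity
  have hL := B.L_pos
  refine integral_le_add_of_measure_lt_le (h.measurable_instRegret t) (W.instRegret_nonneg B t)
    (W.instRegret_le_one B t) (by positivity) (by positivity) ?_
  have hnull : P {ω | ¬ ∀ a, ‖W.ctx t ω a‖ ≤ 1} = 0 := h.ae_ctx_norm_le (by omega) htT
  calc _ ≤ P ({ω | ¬ ∀ a, ‖W.ctx t ω a‖ ≤ 1}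
        ∪ ({ω | ¬ W.GoodRun B τ α (lambdaF B.ν B.best) (3 * Real.log T) (T / τ) ω}
          ∪ {ω | ∃ a, u ≤ |inner ℝ (W.ctx t ω a) (W.Z j ω)|})) := by
        refine measure_mono fun ω hω => ?_
        by_contra hcon
        simp only [Set.mem_union, not_or] at hcon
        obtain ⟨c1, c2, c3⟩ := hcon
        have c3' : ∀ a, |inner ℝ (W.ctx t ω a) (W.Z j ω)| ≤ u := fun a =>
          (not_le.mp fun ha => c3 ⟨a, ha⟩).le
        have hrun := (not_not.mp c2).norm_sgdAvg_sub_le hα hτ0 hατ hlam hL32 h1 hjJ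
        rw [← hj] at hrun c3'
        have := h.instRegret_le ht htT (not_not.mp c1) hrun c3'
        rw [hj] at this
        exact absurd hω (not_lt.mpr this)
    _ ≤ 0 + (ENNReal.ofReal (4 / (T : ℝ) ^ 2) + ENNReal.ofReal (2 / (T : ℝ) ^ 2)) := by
        refine (measure_union_le _ _).trans (add_le_add hnull.le ?_)
        exact (measure_union_le _ _).trans (add_le_add hgood
          (htail.trans (ENNReal.ofReal_le_ofReal htail')))
    _ = _ := by
        rw [zero_add, ← ENNReal.ofReal_add (by positivity) (by positivity)]
        congr 1; ring

end IsSGDTS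

end Play

/-! ### Elementary estimates of the explicit bound -/

namespace GLBParams

/-- The factor `p` of the regret bound. -/
def pFactor (T : ℕ) : ℝ := 1 + 2 / (1 / (4 * √(Real.pi * Real.exp 1)) - 1 / (T : ℝ) ^ 2)

theorem regretBound_eq (q : GLBParams) (T τ : ℕ) (α : ℝ) :
    q.regretBound T τ α = (τ : ℝ) + 7 / (T : ℝ)
      + q.L * pFactor T * √((τ : ℝ) * T)
        * (2 * √(q.c₃ / α) * q.g₁ T τ (T / τ) + 2 * g₂ τ α (T / τ))
      + q.L * pFactor T * √((τ : ℝ) * T) * √(2 * Real.log ((q.K : ℝ) * τ * (T : ℝ) ^ 2))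
        * √(2 * q.c₃ * q.g₁ T τ (T / τ) ^ 2 / α + 2 * g₂ τ α (T / τ) ^ 2)
        * √(1 + Real.log ((T / τ : ℕ) : ℝ)) := rfl

/-- As `1 ≤ √(π e) ≤ 4`, the denominator lies in `[1/32, 1/4]` for `T ≥ 10`. The lower bound absorbs
the factor lost in a round; the upper one serves the `√T` growth. -/
theorem pFactor_mem {T : ℕ} (hT : 10 ≤ T) : 2 ≤ pFactor T ∧ pFactor T ≤ 65 := by
  have hT' : (10 : ℝ) ≤ T := by exact_mod_cast hT
  set s := √(Real.pi * Real.exp 1) with hs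
  have hpi := Real.pi_gt_three
  have hpi4 := Real.pi_le_four
  have he := Real.exp_one_lt_d9
  have he1 : 1 ≤ Real.exp 1 := Real.one_le_exp zero_le_one
  have hs1 : 1 ≤ s := by rw [hs, Real.one_le_sqrt]; nlinarith
  have hs4 : s ≤ 4 := by
    rw [hs]; refine Real.sqrt_le_iff.mpr ⟨by norm_num, ?_⟩; nlinarith
  have hT2 : 1 / (T : ℝ) ^ 2 ≤ 1 / 100 := by
    apply one_div_le_one_div_of_le (by norm_num); nlinarith
  have hT0 : 0 ≤ 1 / (T : ℝ) ^ 2 := by positivity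
  have h1 : 1 / (4 * s) ≤ 1 / 4 := one_div_le_one_div_of_le (by norm_num) (by linarith)
  have h2 : 1 / 16 ≤ 1 / (4 * s) := one_div_le_one_div_of_le (by positivity) (by linarith)
  rw [pFactor, ← hs]
  set x := 1 / (4 * s) - 1 / (T : ℝ) ^ 2 with hx
  have hx0 : 1 / 32 ≤ x := by rw [hx]; linarith
  have hxp : 0 < x := by linarith
  constructor
  · have : 1 ≤ 2 / x := by rw [le_div_iff₀ hxp]; linarith
    linarith
  · have : 2 / x ≤ 64 := by rw [div_le_iff₀ hxp]; linarith
    linarith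

theorem g₁_nonneg {q : GLBParams} (hR : 0 ≤ q.R) (hc : 0 ≤ q.c₁) (T τ j : ℕ) : 0 ≤ q.g₁ T τ j := by
  unfold g₁; positivity

theorem g₁_mono {q : GLBParams} (hR : 0 ≤ q.R) (hc : 0 ≤ q.c₁) (T τ : ℕ) {i j : ℕ} (hij : i ≤ j) :
    q.g₁ T τ i ≤ q.g₁ T τ j := by
  unfold g₁
  gcongr

theorem g₂_nonneg {α : ℝ} (hα : 0 ≤ α) (τ j : ℕ) : 0 ≤ g₂ τ α j := by
  unfold g₂; positivity

theorem g₂_mono {α : ℝ} (hα : 0 ≤ α) (τ : ℕ) {i j : ℕ} (hi : 1 ≤ i) (hij : i ≤ j) :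
    g₂ τ α i ≤ g₂ τ α j := by
  unfold g₂
  have : (0 : ℝ) < i := by exact_mod_cast hi
  gcongr

theorem sqrt_tsVar_le {q : GLBParams} (hR : 0 ≤ q.R) (hc : 0 ≤ q.c₁) (hc₃ : 0 ≤ q.c₃) {α : ℝ}
    (hα : 0 < α) (T τ : ℕ) {j J : ℕ} (hj : 1 ≤ j) (hjJ : j ≤ J) :
    √(q.tsVar T τ α j) ≤ √(2 * q.c₃ * q.g₁ T τ J ^ 2 / α + 2 * g₂ τ α J ^ 2) * (1 / √j) := by
  have hj0 : (0 : ℝ) < j := by exact_mod_cast hj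
  rw [mul_one_div, ← Real.sqrt_div' _ hj0.le]
  refine Real.sqrt_le_sqrt ?_
  have h1 := g₁_mono hR hc T τ hjJ
  have h2 := g₂_mono hα.le τ hj hjJ
  have h1' := g₁_nonneg hR hc T τ j
  have h2' := g₂_nonneg hα.le τ j
  calc q.tsVar T τ α j = (2 * q.c₃ * q.g₁ T τ j ^ 2 / α + 2 * g₂ τ α j ^ 2) / j := by
        unfold tsVar; field_simp
    _ ≤ _ := by gcongr

end GLBParams

theorem mul_sqrt_div_le_sqrt_mul (T τ : ℕ) : (τ : ℝ) * √((T / τ : ℕ) : ℝ) ≤ √((τ : ℝ) * T) := by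
  refine Real.le_sqrt_of_sq_le ?_
  rw [mul_pow, Real.sq_sqrt (by positivity), sq, mul_assoc]
  gcongr
  exact_mod_cast Nat.mul_div_le T τ

/-! ### Summation of the regret -/

namespace Play.IsSGDTS

variable {d K T : ℕ} {Ω : Type*} [mΩ : MeasurableSpace Ω] {W : Play d K Ω}
  {B : GLBandit d K} {P : Measure Ω}

theorem integral_regret_le_regretBound [IsProbabilityMeasure P]
    (h : W.IsSGDTS B T (B.params.tau 1000 1000 T) (B.params.alpha T) P)
    (hτ : B.params.tau 1000 1000 T ≤ T) :
    ∫ ω, W.regret B T ω ∂P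
      ≤ B.params.regretBound T (B.params.tau 1000 1000 T) (B.params.alpha T) := by
  have hτ0 := B.tau_pos T
  have hα := B.alpha_pos T
  have hT10 : 10 ≤ T := by
    have h1 := B.million_le_tau T
    have h2 : (10 : ℝ) ≤ B.params.tau 1000 1000 T := by linarith
    exact le_trans (by exact_mod_cast h2) hτ
  have hround := fun t j (ht : B.params.tau 1000 1000 T < t) htT hj =>
    h.integral_instRegret_le hτ (t := t) (j := j) ht htT hj
  have hR : 0 ≤ B.params.R := B.R_pos.le
  have hc : 0 ≤ B.params.c₁ := B.c₁_pos.le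
  have hc₃ : 0 ≤ B.params.c₃ := B.c₃_pos.le
  have hL := B.L_pos
  generalize B.params.tau 1000 1000 T = τ at *
  generalize B.params.alpha T = α at *
  set J := T / τ with hJ
  set V := √(2 * B.params.c₃ * B.params.g₁ T τ J ^ 2 / α + 2 * GLBParams.g₂ τ α J ^ 2) with hV
  set u := √(2 * Real.log (K * τ * (T : ℝ) ^ 2)) with hu
  set G := GLBParams.g₂ τ α J with hG
  have hG0 : 0 ≤ G := GLBParams.g₂_nonneg hα.le τ J
  have hu0 : 0 ≤ u := Real.sqrt_nonneg _
  have hV0 : 0 ≤ V := Real.sqrt_nonneg _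
  let F : ℕ → ℝ := fun j => 2 * B.L * (G + u * V) * (1 / √(j : ℝ))
  have hF : ∀ j, 0 ≤ F j := fun j => by positivity
  have hlater : ∀ t ∈ Finset.Ico (τ + 1) (T + 1),
      ∫ ω, W.instRegret B t ω ∂P ≤ F ((t - 1) / τ) + 6 / (T : ℝ) ^ 2 := by
    intro t ht
    rw [Finset.mem_Ico] at ht
    obtain ⟨h1, -, -⟩ := block_index hτ0 (show τ < t by omega)
    have hjJ : (t - 1) / τ ≤ J := Nat.div_le_div_right (by omega)
    refine (hround t _ (by omega) (by omega) rfl).trans (add_le_add ?_ le_rfl)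
    have h2 := GLBParams.g₂_mono hα.le τ h1 hjJ
    have h3 := GLBParams.sqrt_tsVar_le hR hc hc₃ hα T τ h1 hjJ
    calc _ ≤ 2 * B.L * (G / √(((t - 1) / τ : ℕ) : ℝ)
            + u * (V * (1 / √(((t - 1) / τ : ℕ) : ℝ)))) := by
          gcongr
      _ = _ := by simp only [F]; ring
  have hT0 : (0 : ℝ) < T := by exact_mod_cast (by omega : 0 < T)
  have hcount : ((T + 1 - (τ + 1) : ℕ) : ℝ) * (6 / (T : ℝ) ^ 2) ≤ 7 / T := by
    have : ((T + 1 - (τ + 1) : ℕ) : ℝ) ≤ T := by exact_mod_cast (by omega)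
    calc _ ≤ (T : ℝ) * (6 / (T : ℝ) ^ 2) := by gcongr
      _ = 6 / T := by field_simp
      _ ≤ _ := by gcongr; norm_num
  have hsplit : ∑ t ∈ Finset.Icc 1 T, ∫ ω, W.instRegret B t ω ∂P
      ≤ τ + (τ * ∑ j ∈ Finset.Icc 1 J, F j + 7 / T) := by
    have hIcc : Finset.Icc 1 T = Finset.Ico 1 (T + 1) := rfl
    rw [hIcc, ← Finset.sum_Ico_consecutive _ (show 1 ≤ τ + 1 by omega)
      (show τ + 1 ≤ T + 1 by omega)]
    refine add_le_add ?_ ?_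
    · calc _ ≤ ∑ t ∈ Finset.Ico 1 (τ + 1), (1 : ℝ) :=
            Finset.sum_le_sum fun t _ => h.integral_instRegret_le_one t
        _ = τ := by simp
    · refine (Finset.sum_le_sum hlater).trans ?_
      rw [Finset.sum_add_distrib, Finset.sum_const, Nat.card_Ico, nsmul_eq_mul]
      exact add_le_add (sum_block_index_le hF hτ0) hcount
  rw [h.integral_regret, GLBParams.regretBound_eq]
  refine hsplit.trans ?_
  have hsq := mul_sqrt_div_le_sqrt_mul T τ
  rw [← hJ] at hsq
  set S := ∑ j ∈ Finset.Icc 1 J, 1 / √(j : ℝ) with hS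
  have hS1 := sum_Icc_inv_sqrt_le J
  have hS2 := sum_Icc_inv_sqrt_le_sqrt_log J
  rw [← hS] at hS1 hS2
  set ℓ := √(1 + Real.log (J : ℝ)) with hℓ
  have hℓ0 : 0 ≤ ℓ := Real.sqrt_nonneg _
  set Q := √((τ : ℝ) * T) with hQ
  have hQ0 : 0 ≤ Q := Real.sqrt_nonneg _
  have hτS1 : τ * S ≤ 2 * Q := by
    calc (τ : ℝ) * S ≤ τ * (2 * √(J : ℝ)) := by gcongr
      _ = 2 * (τ * √(J : ℝ)) := by ring
      _ ≤ _ := by gcongr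
  have hτS2 : τ * S ≤ Q * ℓ := by
    calc (τ : ℝ) * S ≤ τ * (√(J : ℝ) * ℓ) := by gcongr
      _ = (τ * √(J : ℝ)) * ℓ := by ring
      _ ≤ _ := by gcongr
  have hmain : τ * ∑ j ∈ Finset.Icc 1 J, F j
      ≤ 2 * B.L * (G * (2 * Q)) + 2 * B.L * (u * V * (Q * ℓ)) := by
    have : τ * ∑ j ∈ Finset.Icc 1 J, F j
        = 2 * B.L * (G * (τ * S)) + 2 * B.L * (u * V * (τ * S)) := by
      simp only [F]; rw [← Finset.mul_sum, ← hS]; ring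
    rw [this]
    gcongr
  obtain ⟨hp, -⟩ := GLBParams.pFactor_mem hT10
  set p := GLBParams.pFactor T
  -- Only nonnegativity of the `g₁` term is used; `p ≥ 2` does the rest.
  have hA : 2 * B.L * (G * (2 * Q))
      ≤ B.L * p * Q * (2 * √(B.params.c₃ / α) * B.params.g₁ T τ J + 2 * G) := by
    have hg1 : 0 ≤ 2 * √(B.params.c₃ / α) * B.params.g₁ T τ J :=
      mul_nonneg (by positivity) (GLBParams.g₁_nonneg hR hc T τ J)
    calc 2 * B.L * (G * (2 * Q)) = B.L * 2 * Q * (0 + 2 * G) := by ring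
      _ ≤ _ := by gcongr
  have hB : 2 * B.L * (u * V * (Q * ℓ)) ≤ B.L * p * Q * u * V * ℓ := by
    calc 2 * B.L * (u * V * (Q * ℓ)) = B.L * 2 * Q * u * V * ℓ := by ring
      _ ≤ _ := by gcongr
  have hLL : B.params.L = B.L := rfl
  have hKK : B.params.K = K := rfl
  rw [hLL, hKK]
  linarith

theorem integral_regret_le [IsProbabilityMeasure P] {τ : ℕ} {α : ℝ} (h : W.IsSGDTS B T τ α P) :
    ∫ ω, W.regret B T ω ∂P ≤ T := by
  rw [h.integral_regret]
  calc _ ≤ ∑ t ∈ Finset.Icc 1 T, (1 : ℝ) :=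
        Finset.sum_le_sum fun t _ => h.integral_instRegret_le_one t
    _ = T := by simp

end Play.IsSGDTS

/-! ### Poly-logarithmic growth -/

/-- A nonnegative function of the horizon that is bounded by a polynomial in `log T`. -/
def IsPolylog (f : ℕ → ℝ) : Prop :=
  ∃ (A : ℝ) (k : ℕ), ∀ T : ℕ, 2 ≤ T → 0 ≤ f T ∧ f T ≤ A * (1 + Real.log T) ^ k

namespace IsPolylog

theorem one_le_one_add_log (T : ℕ) : 1 ≤ 1 + Real.log T := by
  linarith [Real.log_natCast_nonneg T]

theorem mono {f g : ℕ → ℝ} (hg : IsPolylog g) (hfg : ∀ T, 2 ≤ T → 0 ≤ f T ∧ f T ≤ g T) :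
    IsPolylog f := by
  obtain ⟨A, k, h⟩ := hg
  exact ⟨A, k, fun T hT => ⟨(hfg T hT).1, (hfg T hT).2.trans (h T hT).2⟩⟩

theorem const {c : ℝ} (hc : 0 ≤ c) : IsPolylog fun _ => c :=
  ⟨c, 0, fun T _ => ⟨hc, by simp⟩⟩

theorem log : IsPolylog fun T => Real.log T :=
  ⟨1, 1, fun T _ => ⟨Real.log_natCast_nonneg T, by simp⟩⟩

theorem add {f g : ℕ → ℝ} (hf : IsPolylog f) (hg : IsPolylog g) :
    IsPolylog fun T => f T + g T := by
  obtain ⟨A, k, h⟩ := hf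
  obtain ⟨A', k', h'⟩ := hg
  refine ⟨|A| + |A'|, max k k', fun T hT => ⟨add_nonneg (h T hT).1 (h' T hT).1, ?_⟩⟩
  have h1 := one_le_one_add_log T
  have hp : ∀ (a : ℝ) (n : ℕ), n ≤ max k k' →
      a * (1 + Real.log T) ^ n ≤ |a| * (1 + Real.log T) ^ max k k' := fun a n hn => by
    gcongr
    exact le_abs_self a
  rw [add_mul]
  exact add_le_add ((h T hT).2.trans (hp A k (le_max_left _ _)))
    ((h' T hT).2.trans (hp A' k' (le_max_right _ _)))

theorem mul {f g : ℕ → ℝ} (hf : IsPolylog f) (hg : IsPolylog g) :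
    IsPolylog fun T => f T * g T := by
  obtain ⟨A, k, h⟩ := hf
  obtain ⟨A', k', h'⟩ := hg
  refine ⟨A * A', k + k', fun T hT => ⟨mul_nonneg (h T hT).1 (h' T hT).1, ?_⟩⟩
  calc f T * g T ≤ (A * (1 + Real.log T) ^ k) * (A' * (1 + Real.log T) ^ k') :=
        mul_le_mul (h T hT).2 (h' T hT).2 (h' T hT).1 ((h T hT).1.trans (h T hT).2)
    _ = _ := by ring

theorem const_mul {c : ℝ} (hc : 0 ≤ c) {f : ℕ → ℝ} (hf : IsPolylog f) :
    IsPolylog fun T => c * f T := (const hc).mul hf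

theorem div_const {c : ℝ} (hc : 0 ≤ c) {f : ℕ → ℝ} (hf : IsPolylog f) :
    IsPolylog fun T => f T / c := by
  simp_rw [div_eq_mul_inv]
  exact hf.mul (const (inv_nonneg.mpr hc))

theorem sq {f : ℕ → ℝ} (hf : IsPolylog f) : IsPolylog fun T => f T ^ 2 := by
  simp_rw [pow_two]
  exact hf.mul hf

/-- Because `√x ≤ 1 + x`, half-integer powers of the logarithm are not needed. -/
theorem sqrt {f : ℕ → ℝ} (hf : IsPolylog f) : IsPolylog fun T => √(f T) := by
  refine ((const zero_le_one).add hf).mono fun T hT => ⟨Real.sqrt_nonneg _, ?_⟩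
  obtain ⟨A, k, h⟩ := hf
  have h0 := (h T hT).1
  exact Real.sqrt_le_iff.mpr ⟨by linarith, by nlinarith⟩

/-- Since `log 2 > 1/2`, `1 + log T ≤ 3 log T` for `T ≥ 2`. -/
theorem exists_le_log_pow {f : ℕ → ℝ} (hf : IsPolylog f) :
    ∃ (A : ℝ) (k : ℕ), ∀ T : ℕ, 2 ≤ T → f T ≤ A * Real.log T ^ k := by
  obtain ⟨A, k, h⟩ := hf
  refine ⟨|A| * 3 ^ k, k, fun T hT => (h T hT).2.trans ?_⟩
  have h2 : Real.log 2 ≤ Real.log T :=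
    Real.log_le_log (by norm_num) (by exact_mod_cast hT)
  have h3 := Real.log_two_gt_d9
  calc A * (1 + Real.log T) ^ k ≤ |A| * (3 * Real.log T) ^ k := by
        gcongr
        · exact le_abs_self A
        · linarith
    _ = _ := by rw [mul_pow]; ring

end IsPolylog

/-! ### Poly-logarithmic control of the regret bound -/

namespace GLBParams

/-- The positivity of the numerical parameters. -/
structure Pos (q : GLBParams) : Prop where
  d : (1 : ℝ) ≤ q.d
  K : (1 : ℝ) ≤ q.K
  R : 0 ≤ q.R
  L : 0 ≤ q.L
  c₁ : 0 ≤ q.c₁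
  c₃ : 0 ≤ q.c₃
  lamF : 0 < q.lamF

variable {q : GLBParams}

theorem Pos.one_div_alpha_le (hq : q.Pos) (T : ℕ) : 1 / q.alpha T ≤ q.lamF := by
  have h1 : 1 ≤ max (max q.c₃ (q.d : ℝ)) (Real.log T) :=
    (hq.d.trans (le_max_right _ _)).trans (le_max_left _ _)
  unfold alpha
  rw [one_div_div]
  exact div_le_self hq.lamF.le h1

theorem Pos.alpha_pos (hq : q.Pos) (T : ℕ) : 0 < q.alpha T := by
  have h1 : 1 ≤ max (max q.c₃ (q.d : ℝ)) (Real.log T) :=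
    (hq.d.trans (le_max_right _ _)).trans (le_max_left _ _)
  have := hq.lamF
  unfold alpha
  positivity

theorem Pos.isPolylog_alpha (hq : q.Pos) : IsPolylog q.alpha := by
  have hd := hq.d
  refine (((((IsPolylog.const hq.c₃).add (IsPolylog.const (zero_le_one.trans hd))).add
    IsPolylog.log).div_const hq.lamF.le)).mono fun T _ => ⟨(hq.alpha_pos T).le, ?_⟩
  unfold alpha
  have := hq.lamF
  have := hq.c₃
  have := Real.log_natCast_nonneg T
  gcongr
  refine max_le (max_le ?_ ?_) ?_ <;> linarith

theorem Pos.isPolylog_tau (hq : q.Pos) {C₁ C₂ : ℝ} (h₁ : 0 ≤ C₁) (h₂ : 0 ≤ C₂) :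
    IsPolylog fun T => (q.tau C₁ C₂ T : ℝ) := by
  have hd : 0 ≤ (q.d : ℝ) := by positivity
  have e1 : IsPolylog (q.tau₁ C₁ C₂) := by
    unfold tau₁
    exact ((((IsPolylog.const (mul_nonneg h₁ (Real.sqrt_nonneg _))).add
      ((IsPolylog.log.const_mul zero_le_two).sqrt.const_mul h₂)).div_const (sq_nonneg _)).sq).add
      ((((IsPolylog.const hd).add (IsPolylog.log.const_mul zero_le_two)).const_mul
        (by positivity)).div_const (by positivity))
  have e2 : IsPolylog fun T => q.tau₂ C₁ C₂ T (q.alpha T) := by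
    unfold tau₂
    exact ((((IsPolylog.const (mul_nonneg h₁ (Real.sqrt_nonneg _))).add
      ((IsPolylog.log.const_mul zero_le_three).sqrt.const_mul h₂)).div_const hq.lamF.le).sq).add
      ((hq.isPolylog_alpha.const_mul zero_le_two).div_const (mul_nonneg hq.c₃ hq.lamF.le))
  refine ((e1.add e2).add (IsPolylog.const zero_le_one)).mono fun T hT => ⟨by positivity, ?_⟩
  obtain ⟨A₁, k₁, b₁⟩ := e1
  obtain ⟨A₂, k₂, b₂⟩ := e2
  have n1 := (b₁ T hT).1
  have n2 := (b₂ T hT).1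
  have h0 : 0 ≤ max (q.tau₁ C₁ C₂ T) (q.tau₂ C₁ C₂ T (q.alpha T)) := n1.trans (le_max_left _ _)
  refine (Nat.ceil_lt_add_one h0).le.trans ?_
  gcongr
  exact max_le (by linarith) (by linarith)

/-- The regret bound is `√T` up to poly-logarithmic factors. -/
theorem Pos.exists_isPolylog_regretBound_le (hq : q.Pos) {C₁ C₂ : ℝ} (h₁ : 0 ≤ C₁) (h₂ : 0 ≤ C₂) :
    ∃ G : ℕ → ℝ, IsPolylog G ∧ (∀ T, 2 ≤ T → (q.tau C₁ C₂ T : ℝ) ≤ G T) ∧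
      ∀ T, 10 ≤ T → 0 < q.tau C₁ C₂ T → q.tau C₁ C₂ T ≤ T →
        q.regretBound T (q.tau C₁ C₂ T) (q.alpha T) ≤ √(T : ℝ) * G T := by
  have hd := hq.d
  have hK := hq.K
  have hR := hq.R
  have hL := hq.L
  have hc₁ := hq.c₁
  have hc₃ := hq.c₃
  have hlam := hq.lamF
  have eτ := hq.isPolylog_tau h₁ h₂
  let gg₁ : ℕ → ℝ := fun T => q.R / q.c₁ * √((q.d : ℝ) / 2 * (3 * Real.log T) + 2 * Real.log T)
  let gg₂ : ℕ → ℝ := fun T => (q.tau C₁ C₂ T : ℝ) * q.lamF * √(1 + Real.log T)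
  have eℓ : IsPolylog fun T => √(1 + Real.log T) := ((IsPolylog.const zero_le_one).add
    IsPolylog.log).sqrt
  have e₁ : IsPolylog gg₁ := ((((IsPolylog.log.const_mul (by norm_num)).const_mul
    (by positivity)).add (IsPolylog.log.const_mul zero_le_two)).sqrt).const_mul (by positivity)
  have e₂ : IsPolylog gg₂ := (eτ.mul (IsPolylog.const hlam.le)).mul eℓ
  let H₁ : ℕ → ℝ := fun T => q.L * 65 * √(q.tau C₁ C₂ T : ℝ)
    * (2 * √(q.c₃ * q.lamF) * gg₁ T + 2 * gg₂ T)
  let H₂ : ℕ → ℝ := fun T => q.L * 65 * √(q.tau C₁ C₂ T : ℝ)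
    * √(2 * (Real.log q.K + 3 * Real.log T))
    * √(2 * q.c₃ * gg₁ T ^ 2 * q.lamF + 2 * gg₂ T ^ 2) * √(1 + Real.log T)
  have eH₁ : IsPolylog H₁ := (eτ.sqrt.const_mul (by positivity)).mul
    ((e₁.const_mul (by positivity)).add (e₂.const_mul zero_le_two))
  have eH₂ : IsPolylog H₂ := (((eτ.sqrt.const_mul (by positivity)).mul
    ((((IsPolylog.const (Real.log_natCast_nonneg q.K)).add
      (IsPolylog.log.const_mul zero_le_three)).const_mul zero_le_two).sqrt)).mul
    ((((e₁.sq.const_mul (by positivity)).mul (IsPolylog.const hlam.le)).add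
      (e₂.sq.const_mul zero_le_two)).sqrt)).mul eℓ
  -- The summand `τ` makes this function dominate the block length too, which settles horizons
  -- shorter than one block.
  refine ⟨fun T => (q.tau C₁ C₂ T : ℝ) + 7 + H₁ T + H₂ T,
    ((eτ.add (IsPolylog.const (by norm_num))).add eH₁).add eH₂, fun T _ => ?_,
    fun T hT hτ0 hτT => ?_⟩
  · have hg : 0 ≤ Real.log T := Real.log_natCast_nonneg T
    have : 0 ≤ H₁ T := by positivity
    have : 0 ≤ H₂ T := by positivity
    linarith
  have hg : 0 ≤ Real.log T := Real.log_natCast_nonneg T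
  have hα := hq.alpha_pos T
  have hα1 := hq.one_div_alpha_le T
  obtain ⟨hp2, hp⟩ := pFactor_mem hT
  rw [regretBound_eq]
  simp only [H₁, H₂, gg₁, gg₂]
  generalize q.tau C₁ C₂ T = τ at *
  generalize q.alpha T = α at *
  have hT1 : (1 : ℝ) ≤ T := by exact_mod_cast (by omega : 1 ≤ T)
  have hT2 : (2 : ℝ) ≤ T := by exact_mod_cast (by omega : 2 ≤ T)
  have hτ1 : (1 : ℝ) ≤ τ := by exact_mod_cast hτ0
  have hτT' : (τ : ℝ) ≤ T := by exact_mod_cast hτT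
  have hJ1 : 1 ≤ T / τ := (Nat.one_le_div_iff hτ0).mpr hτT
  have hJ1' : (1 : ℝ) ≤ ((T / τ : ℕ) : ℝ) := by exact_mod_cast hJ1
  have hJT : ((T / τ : ℕ) : ℝ) ≤ T := by exact_mod_cast Nat.div_le_self T τ
  have hJτ : ((T / τ : ℕ) : ℝ) * τ ≤ T := by exact_mod_cast Nat.div_mul_le_self T τ
  have hlogJ : Real.log ((T / τ : ℕ) : ℝ) ≤ Real.log T := Real.log_le_log (by linarith) hJT
  have hlogJ0 : 0 ≤ Real.log ((T / τ : ℕ) : ℝ) := Real.log_natCast_nonneg _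
  have hsT : 1 ≤ √(T : ℝ) := Real.one_le_sqrt.mpr hT1
  have b₁ : q.g₁ T τ (T / τ)
      ≤ q.R / q.c₁ * √((q.d : ℝ) / 2 * (3 * Real.log T) + 2 * Real.log T) := by
    unfold g₁
    gcongr
    -- From `J τ ≤ T` and `d ≥ 1` the left side is at most `1 + 2 T`, which is at most `T³` for `T ≥
    -- 2`.
    have h3 : 1 + 2 * ((T / τ : ℕ) : ℝ) * τ / q.d ≤ (T : ℝ) ^ 3 := by
      have h4 : 2 * ((T / τ : ℕ) : ℝ) * τ / q.d ≤ 2 * T := by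
        refine (div_le_self (by positivity) hd).trans ?_
        linarith
      nlinarith [mul_nonneg (sub_nonneg.mpr hT2) (sub_nonneg.mpr hT2),
        mul_nonneg (mul_nonneg (sub_nonneg.mpr hT2) (sub_nonneg.mpr hT2)) (sub_nonneg.mpr hT2)]
    have h5 := Real.log_le_log (by positivity) h3
    rw [Real.log_pow] at h5
    exact_mod_cast h5
  have b₂ : g₂ τ α (T / τ) ≤ τ * q.lamF * √(1 + Real.log T) := by
    unfold g₂
    rw [div_eq_mul_one_div]
    gcongr
  have n₁ := g₁_nonneg hR hc₁ T τ (T / τ)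
  have n₂ := g₂_nonneg hα.le τ (T / τ)
  generalize q.R / q.c₁ * √((q.d : ℝ) / 2 * (3 * Real.log T) + 2 * Real.log T) = γ₁ at *
  generalize τ * q.lamF * √(1 + Real.log T) = γ₂ at *
  generalize q.g₁ T τ (T / τ) = δ₁ at *
  generalize g₂ τ α (T / τ) = δ₂ at *
  have hu : Real.log ((q.K : ℝ) * τ * (T : ℝ) ^ 2) ≤ Real.log q.K + 3 * Real.log T := by
    have h6 : (q.K : ℝ) * τ * (T : ℝ) ^ 2 ≤ q.K * (T : ℝ) ^ 3 := by
      calc _ ≤ (q.K : ℝ) * T * (T : ℝ) ^ 2 := by gcongr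
        _ = _ := by ring
    refine (Real.log_le_log (by positivity) h6).trans_eq ?_
    rw [Real.log_mul (by positivity) (by positivity), Real.log_pow]
    norm_num
  have hsq : √((τ : ℝ) * T) = √(τ : ℝ) * √(T : ℝ) := Real.sqrt_mul (by positivity) _
  have hca : q.c₃ / α ≤ q.c₃ * q.lamF := by
    rw [div_eq_mul_one_div]; gcongr
  have hva : 2 * q.c₃ * δ₁ ^ 2 / α ≤ 2 * q.c₃ * γ₁ ^ 2 * q.lamF := by
    rw [div_eq_mul_one_div]; gcongr
  have hp0 : 0 ≤ pFactor T := by linarith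
  have t1 : (τ : ℝ) + 7 / T ≤ √(T : ℝ) * (τ + 7) := by
    have : 7 / (T : ℝ) ≤ 7 := div_le_self (by norm_num) hT1
    nlinarith
  have t2 : q.L * pFactor T * √((τ : ℝ) * T) * (2 * √(q.c₃ / α) * δ₁ + 2 * δ₂)
      ≤ √(T : ℝ) * (q.L * 65 * √(τ : ℝ) * (2 * √(q.c₃ * q.lamF) * γ₁ + 2 * γ₂)) := by
    calc _ ≤ q.L * 65 * (√(τ : ℝ) * √(T : ℝ)) * (2 * √(q.c₃ * q.lamF) * γ₁ + 2 * γ₂) := by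
          rw [hsq]; gcongr
      _ = _ := by ring
  have t3 : q.L * pFactor T * √((τ : ℝ) * T) * √(2 * Real.log ((q.K : ℝ) * τ * (T : ℝ) ^ 2))
        * √(2 * q.c₃ * δ₁ ^ 2 / α + 2 * δ₂ ^ 2) * √(1 + Real.log ((T / τ : ℕ) : ℝ))
      ≤ √(T : ℝ) * (q.L * 65 * √(τ : ℝ) * √(2 * (Real.log q.K + 3 * Real.log T))
        * √(2 * q.c₃ * γ₁ ^ 2 * q.lamF + 2 * γ₂ ^ 2) * √(1 + Real.log T)) := by
    calc _ ≤ q.L * 65 * (√(τ : ℝ) * √(T : ℝ)) * √(2 * (Real.log q.K + 3 * Real.log T))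
        * √(2 * q.c₃ * γ₁ ^ 2 * q.lamF + 2 * γ₂ ^ 2) * √(1 + Real.log T) := by
          rw [hsq]; gcongr
      _ = _ := by ring
  linarith

end GLBParams

theorem GLBandit.params_pos {d K : ℕ} (B : GLBandit d K) : B.params.Pos where
  d := B.one_le_d
  K := by exact_mod_cast B.K_pos
  R := B.R_pos.le
  L := B.L_pos.le
  c₁ := B.c₁_pos.le
  c₃ := B.c₃_pos.le
  lamF := B.lambdaF_pos

end

/-! ### The theorem -/

theorem theorem1 :
    ∃ C₁ C₂ : ℝ, 0 < C₁ ∧ 0 < C₂ ∧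
      -- the explicit bound
      (∀ (d K : ℕ) (B : GLBandit d K) (T : ℕ), B.params.tau C₁ C₂ T ≤ T →
        ∀ (Ω : Type*) [MeasurableSpace Ω] (P : Measure Ω) [IsProbabilityMeasure P]
          (W : Play d K Ω),
          W.IsSGDTS B T (B.params.tau C₁ C₂ T) (B.params.alpha T) P →
            Integrable (W.regret B T) P ∧
            ∫ ω, W.regret B T ω ∂P
              ≤ B.params.regretBound T (B.params.tau C₁ C₂ T) (B.params.alpha T)) ∧
      -- the regret is `√T` up to logarithmic factors, with constants that depend only on
      -- the numerical parameters of the bandit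
      (∀ q : GLBParams, ∃ (A : ℝ) (k : ℕ),
        ∀ (d K : ℕ) (B : GLBandit d K), B.params = q → ∀ T : ℕ, 2 ≤ T →
        ∀ (Ω : Type*) [MeasurableSpace Ω] (P : Measure Ω) [IsProbabilityMeasure P]
          (W : Play d K Ω),
          W.IsSGDTS B T (q.tau C₁ C₂ T) (q.alpha T) P →
            ∫ ω, W.regret B T ω ∂P ≤ A * √(T : ℝ) * Real.log T ^ k) := by
  refine ⟨1000, 1000, by norm_num, by norm_num, ?_, ?_⟩
  · intro d K B T hτ Ω _ P _ W h
    exact ⟨h.integrable_regret, h.integral_regret_le_regretBound hτ⟩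
  · intro q
    -- Parameters violating these signs belong to no bandit, so any constants serve for them.
    by_cases hq : q.Pos
    · obtain ⟨G, hG, hτG, hbound⟩ := hq.exists_isPolylog_regretBound_le
        (C₁ := 1000) (C₂ := 1000) (by norm_num) (by norm_num)
      obtain ⟨A, k, hA⟩ := hG.exists_le_log_pow
      refine ⟨A, k, ?_⟩
      intro d K B hB T hT Ω _ P _ W h
      subst hB
      have hsT : 1 ≤ √(T : ℝ) := Real.one_le_sqrt.mpr (by exact_mod_cast (by omega : 1 ≤ T))
      have hG0 : 0 ≤ G T := le_trans (by positivity) (hτG T hT)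
      have hmain : ∫ ω, W.regret B T ω ∂P ≤ √(T : ℝ) * G T := by
        -- If the horizon ends before the first block does, the regret is at most `T < τ`, and `τ`
        -- is polylogarithmic.
        rcases le_or_gt (B.params.tau 1000 1000 T) T with hle | hlt
        · have hT10 : 10 ≤ T := by
            have h2 : (10 : ℝ) ≤ B.params.tau 1000 1000 T := by linarith [B.million_le_tau T]
            exact le_trans (by exact_mod_cast h2) hle
          exact (h.integral_regret_le_regretBound hle).trans (hbound T hT10 (B.tau_pos T) hle)
        · have h1 : (T : ℝ) ≤ B.params.tau 1000 1000 T := by exact_mod_cast hlt.le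
          calc _ ≤ (T : ℝ) := h.integral_regret_le
            _ ≤ G T := h1.trans (hτG T hT)
            _ ≤ _ := le_mul_of_one_le_left hG0 hsT
      calc _ ≤ √(T : ℝ) * G T := hmain
        _ ≤ √(T : ℝ) * (A * Real.log T ^ k) := by gcongr; exact hA T hT
        _ = _ := by ring
    · exact ⟨0, 0, fun d K B hB => absurd (hB ▸ B.params_pos) hq⟩
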